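/- **Proposition (variational principle over the class of GREMs).** Fix $\beta,h\in\mathbb R$. *Notation.* Let $\mathcal M_a$ be the set of probability measures on $[0,1]$ with finitely many atoms, each identified with its distribution function $x$ and given the topology of the $L^1([0,1],dq)$-distance of distribution functions; let $\mathcal M_a^{<1}\subset\mathcal M_a$ be the subset of those measures that have an atom at $1$. Let $x\in\mathcal M_a^{<1}$ have atoms $0\le q_1<\dots<q_{k+1}=1$ with $x_l=x(q_l)$, so that $0<x_1<\dots<x_{k+1}=1$ ($k\ge 0$). For $0<s<1$, a REM($s$) is a Poisson point process on $(0,\infty)$ with intensity $s\,t^{-s-1}dt$. A GREM with parameter $x$ is given by independent point processes $\zeta^{\alpha(l-1)}$, $1\le l\le k$, $\alpha(l-1)\in\mathbb N^{l-1}$, where $\zeta^{\alpha(l-1)}$ is a REM($x_l$) with its points enumerated by $\mathbb N$. Its weights are $\xi_\alpha=\prod_{l=1}^k(\zeta^{\alpha(l-1)})_{\alpha_l}$ for $\alpha=(\alpha_1,\dots,\alpha_k)\in\mathbb N^k$, where $\alpha(l)=(\alpha_1,\dots,\alpha_l)$, and its overlaps are $q_{\alpha,\alpha'}=\max\{q_{l+1}:0\le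 l\le k,\ \alpha(l)=\alpha'(l)\}$. Let $\eta^1,\eta^2,\dots$ and $\kappa^1,\kappa^2,\dots$ be centred Gaussian fields indexed by $\mathbb N^k$, all independent of each other and of the point processes, with covariances $$\operatorname{Cov}(\eta^i_\alpha,\eta^i_{\alpha'})=q_{\alpha,\alpha'},\qquad \operatorname{Cov}(\kappa^i_\alpha,\kappa^i_{\alpha'})=\tfrac12 q_{\alpha,\alpha'}^2 ,$$ i.e. Gaussian fields on the GREM with covariance functions $g(q)=q$ and $g(q)=q^2/2$. Write $\mu$ for the GREM together with these fields, and for $M\ge1$ put $$G_M(\beta,h,\mu)=\frac1M\,\mathbb E\left[\log\frac{\sum_\alpha\xi_\alpha\prod_{i=1}^M2\cosh(\beta\eta^i_\alpha+h)}{\sum_\alpha\xi_\alpha\prod_{i=1}^Me^{\beta\kappa^i_\alpha}}\right].$$ *Claim.* A GREM with parameter $x$ exists for every $x\in\mathcal M_a^{<1}$. For every such $x$ and every GREM $\mu$ with parameter $x$: 1. All the expectations in this statement are well defined (the sums are almost surely finite and positive, and the logarithms of their ratios are integrable), and $G_M(\beta,h,\mu)=G_1(\beta,h,\mu)$ for all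 $M\ge1$. 2. $G_1(\beta,h,\mu)$ is the difference of two RPC functionals, one with $\psi(y)=\log(2\cosh(\beta y+h))$, $g(q)=q$, the other with $\psi(y)=\beta y$, $g(q)=q^2/2$: $$G_1(\beta,h,\mu)=\mathbb E\left[\log\frac{\sum_\alpha\xi_\alpha\,2\cosh(\beta\eta^1_\alpha+h)}{\sum_\alpha\xi_\alpha}\right]-\mathbb E\left[\log\frac{\sum_\alpha\xi_\alpha e^{\beta\kappa^1_\alpha}}{\sum_\alpha\xi_\alpha}\right].$$ 3. $G_1(\beta,h,\mu)$ depends on $\mu$ only through $x$. The resulting function $G_{\beta,h}(x)$ on $\mathcal M_a^{<1}$ extends to an $L^1$-continuous function on $\mathcal M_a$, also denoted $G_{\beta,h}$, which is bounded below. For each $M\ge 1$ the functional $G_M(\beta,h,\cdot)$ is bounded below over all GREMs, and $$\lim_{M\to\infty}\ \inf_{\mu\ \mathrm{GREM}}G_M(\beta,h,\mu)=\inf_{x\in\mathcal M_a}G_{\beta,h}(x)=\inf_{x\in\mathcal M_a^{<1}}G_{\beta,h}(x).$$ -/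

import Mathlib

open MeasureTheory ProbabilityTheory Filter
open scoped ENNReal NNReal Topology

noncomputable section

namespace RPC

/-! ### Atomic probability measures on the unit interval -/

/-- A probability measure on `[0,1]` with finitely many atoms.  The atoms are `k + 1` points
`q 0 < ... < q k` of `[0,1]`, and `x i` is the value at `q i` of the distribution function, so that
`0 < x 0 < ... < x k = 1`.  (The indices are shifted by one from the usual `q_1, ..., q_{k+1}`.) -/
structure AtomicMeasure where
  k : ℕ
  q : Fin (k + 1) → ℝ
  x : Fin (k + 1) → ℝ
  q_nonneg : ∀ i, 0 ≤ q i
  q_le_one : ∀ i, q i ≤ 1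
  q_strictMono : StrictMono q
  x_pos : ∀ i, 0 < x i
  x_strictMono : StrictMono x
  x_last : x (Fin.last k) = 1

/-- The distribution function: the value `x i` at the last atom `q i ≤ r`, and `0` if there is no
such atom. -/
def AtomicMeasure.cdf (m : AtomicMeasure) (r : ℝ) : ℝ :=
  Finset.univ.sup' Finset.univ_nonempty (fun i => if m.q i ≤ r then m.x i else 0)

/-- The `L¹([0,1], dq)` distance of the distribution functions. -/
def l1Dist (m m' : AtomicMeasure) : ℝ :=
  ∫ r in (0 : ℝ)..1, |m.cdf r - m'.cdf r|

/-- Continuity of a functional of atomic measures with respect to the `L¹` distance. -/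
def L1Continuous (F : AtomicMeasure → ℝ) : Prop :=
  ∀ m, ∀ ε > 0, ∃ δ > 0, ∀ m', l1Dist m m' < δ → |F m' - F m| < ε

/-- The atomic measures that have an atom at `1`; the other `k` atoms are in `[0,1)`. -/
def AtomicMeasureOne : Type := {m : AtomicMeasure // m.q (Fin.last m.k) = 1}

/-! ### Poisson point processes and the REM -/

/-- The number of points of the configuration `(z j ω)_j` that lie in `B`. -/
def count {Ω : Type} (z : ℕ → Ω → ℝ) (B : Set ℝ) (ω : Ω) : ℝ≥0∞ :=
  ∑' j, B.indicator (fun _ => (1 : ℝ≥0∞)) (z j ω)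

/-- The random points `z 0, z 1, ...` form a Poisson point process with intensity measure `Λ`:
the number of points in a measurable set of finite intensity is Poisson distributed, and the numbers
of points in pairwise disjoint measurable sets are independent. The points may be listed in any
measurable order, in particular in decreasing order. -/
structure IsPoissonProcess {Ω : Type} [MeasurableSpace Ω] (P : Measure Ω) (z : ℕ → Ω → ℝ)
    (Λ : Measure ℝ) : Prop where
  measurable : ∀ j, Measurable (z j)
  law_count : ∀ B : Set ℝ, MeasurableSet B → Λ B ≠ ∞ →
    P.map (count z B) = (poissonMeasure (Λ B).toNNReal).map (fun n : ℕ => (n : ℝ≥0∞))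
  indep_count : ∀ (n : ℕ) (B : Fin n → Set ℝ), (∀ i, MeasurableSet (B i)) →
    Pairwise (fun i j => Disjoint (B i) (B j)) → iIndepFun (fun i => count z (B i)) P

/-- The measure `x s^{-x-1} ds` on `(0,∞)`. -/
def remIntensity (x : ℝ) : Measure ℝ :=
  (volume.restrict (Set.Ioi 0)).withDensity (fun s => ENNReal.ofReal (x * s ^ (-x - 1)))

/-- REM(`x`). -/
def IsREM {Ω : Type} [MeasurableSpace Ω] (P : Measure Ω) (z : ℕ → Ω → ℝ) (x : ℝ) : Prop :=
  IsPoissonProcess P z (remIntensity x)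

/-! ### The GREM -/

/-- The inner nodes `α(l) ∈ ℕ^l`, `0 ≤ l < k`, of the tree of depth `k`. -/
abbrev Node (k : ℕ) : Type := Σ l : Fin k, (Fin l → ℕ)

/-- The truncation `α(l)` of a leaf `α ∈ ℕ^k`, for `l < k`. -/
def trunc {k : ℕ} (α : Fin k → ℕ) (l : Fin k) : Node k :=
  ⟨l, fun i => α (Fin.castLE l.isLt.le i)⟩

/-- The weight of the leaf `α`: the product along the path to `α` of the points
`(ζ^{α(l)})_{α_{l+1}}`, `0 ≤ l < k`. -/
def cascadeWeight {k : ℕ} {Ω : Type} (ζ : Node k → ℕ → Ω → ℝ) (α : Fin k → ℕ) (ω : Ω) : ℝ :=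
  ∏ l : Fin k, ζ (trunc α l) (α l) ω

/-- The levels `0 ≤ l ≤ k` up to which the leaves `α` and `α'` agree. -/
def commonLevels {k : ℕ} (α α' : Fin k → ℕ) : Finset (Fin (k + 1)) :=
  Finset.univ.filter (fun l => ∀ i : Fin k, (i : ℕ) < (l : ℕ) → α i = α' i)

theorem commonLevels_nonempty {k : ℕ} (α α' : Fin k → ℕ) : (commonLevels α α').Nonempty :=
  ⟨0, by simp [commonLevels]⟩

/-- The overlap of two leaves (with indices shifted by one, `q l` is the usual `q_{l+1}`). -/
def overlap (m : AtomicMeasure) (α α' : Fin m.k → ℕ) : ℝ :=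
  (commonLevels α α').sup' (commonLevels_nonempty α α') m.q

/-- A centred Gaussian family `(κ_α)_α` with the given covariance `c`. -/
structure IsCentredGaussianField {Ω A : Type} [MeasurableSpace Ω] (P : Measure Ω)
    (κ : A → Ω → ℝ) (c : A → A → ℝ) : Prop where
  measurable : ∀ α, Measurable (κ α)
  gaussian : IsGaussianProcess κ P
  centred : ∀ α, ∫ ω, κ α ω ∂P = 0
  cov : ∀ α α', covariance (κ α) (κ α') P = c α α'

/-- A GREM with parameter `m`, on some probability space, together with independent copies
`η 0, η 1, ...` of its cavity field (covariance function `g(q) = q`) and `κ 0, κ 1, ...` of its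
Gaussian field with covariance function `g(q) = q²/2`. Here `η i α` and `κ i α` are the fields at
the final parameter `1`, where the covariance of the leaves `α, α'` is `g(q_{α,α'})`. -/
structure GREM (m : AtomicMeasureOne) where
  Ω : Type
  [mΩ : MeasurableSpace Ω]
  P : Measure Ω
  [isProb : IsProbabilityMeasure P]
  ζ : Node m.1.k → ℕ → Ω → ℝ
  η : ℕ → (Fin m.1.k → ℕ) → Ω → ℝ
  κ : ℕ → (Fin m.1.k → ℕ) → Ω → ℝ
  rem : ∀ n : Node m.1.k, IsREM P (ζ n) (m.1.x n.1.castSucc)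
  field_η : ∀ i, IsCentredGaussianField P (η i) (fun α α' => overlap m.1 α α')
  field_κ : ∀ i, IsCentredGaussianField P (κ i) (fun α α' => overlap m.1 α α' ^ 2 / 2)
  indep_ζ : iIndepFun (fun (n : Node m.1.k) ω j => ζ n j ω) P
  indep_η : iIndepFun (fun i ω α => η i α ω) P
  indep_κ : iIndepFun (fun i ω α => κ i α ω) P
  indep_η_κ : IndepFun (fun ω i α => η i α ω) (fun ω i α => κ i α ω) P
  indep_ζ_fields : IndepFun (fun ω n j => ζ n j ω)
    (fun ω => ((fun i α => η i α ω), (fun i α => κ i α ω))) P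

attribute [instance] GREM.mΩ GREM.isProb

/-- The weights `ξ_α` of the GREM. -/
def GREM.ξ {m : AtomicMeasureOne} (μ : GREM m) (α : Fin m.1.k → ℕ) (ω : μ.Ω) : ℝ :=
  cascadeWeight μ.ζ α ω

/-! ### The functionals -/

/-- The logarithm of the ratio of the two weighted sums `∑_α ξ_α u_α` and `∑_α ξ_α v_α`. -/
def logRatio {A Ω : Type} (ξ u v : A → Ω → ℝ) (ω : Ω) : ℝ :=
  Real.log ((∑' α, ξ α ω * u α ω) / ∑' α, ξ α ω * v α ω)

/-- The expectation of `logRatio` is meaningful: almost surely both sums converge and are positive,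
and the logarithm of their ratio is integrable. -/
def LogRatioWellDefined {A Ω : Type} [MeasurableSpace Ω] (P : Measure Ω) (ξ u v : A → Ω → ℝ) :
    Prop :=
  (∀ᵐ ω ∂P, Summable (fun α => ξ α ω * u α ω) ∧ 0 < ∑' α, ξ α ω * u α ω) ∧
  (∀ᵐ ω ∂P, Summable (fun α => ξ α ω * v α ω) ∧ 0 < ∑' α, ξ α ω * v α ω) ∧
  Integrable (logRatio ξ u v) P

/-- `∏_{i < M} 2 cosh (β η^i_α + h)`. -/
def coshFactor {A Ω : Type} (β h : ℝ) (M : ℕ) (η : ℕ → A → Ω → ℝ) (α : A) (ω : Ω) : ℝ :=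
  ∏ i ∈ Finset.range M, 2 * Real.cosh (β * η i α ω + h)

/-- `∏_{i < M} exp (β κ^i_α)`. -/
def expFactor {A Ω : Type} (β : ℝ) (M : ℕ) (κ : ℕ → A → Ω → ℝ) (α : A) (ω : Ω) : ℝ :=
  ∏ i ∈ Finset.range M, Real.exp (β * κ i α ω)

/-- The Aizenman-Sims-Starr functional `G_M(β,h,μ)` of a GREM `μ`. -/
def asFunctional (M : ℕ) (β h : ℝ) {m : AtomicMeasureOne} (μ : GREM m) : ℝ :=
  (1 / (M : ℝ)) * ∫ ω, logRatio μ.ξ (coshFactor β h M μ.η) (expFactor β M μ.κ) ω ∂μ.P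

/-- The expectation in `G_M(β,h,μ)` is meaningful. -/
def AsWellDefined (M : ℕ) (β h : ℝ) {m : AtomicMeasureOne} (μ : GREM m) : Prop :=
  LogRatioWellDefined μ.P μ.ξ (coshFactor β h M μ.η) (expFactor β M μ.κ)

/-- The functional `E [log (∑_α ξ_α e^{ψ(φ_α)} / ∑_α ξ_α)]` for a field `φ` on the GREM `μ`. -/
def rpcFunctional (ψ : ℝ → ℝ) {m : AtomicMeasureOne} (μ : GREM m)
    (φ : (Fin m.1.k → ℕ) → μ.Ω → ℝ) : ℝ :=
  ∫ ω, logRatio μ.ξ (fun α ω => Real.exp (ψ (φ α ω))) (fun _ _ => 1) ω ∂μ.P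

/-- The expectation in `rpcFunctional` is meaningful. -/
def RpcWellDefined (ψ : ℝ → ℝ) {m : AtomicMeasureOne} (μ : GREM m)
    (φ : (Fin m.1.k → ℕ) → μ.Ω → ℝ) : Prop :=
  LogRatioWellDefined μ.P μ.ξ (fun α ω => Real.exp (ψ (φ α ω))) (fun _ _ => 1)

/-- The set of all values `G_M(β,h,μ)`, where `μ` is a GREM. -/
def asValues (M : ℕ) (β h : ℝ) : Set ℝ :=
  {v | ∃ (m : AtomicMeasureOne) (μ : GREM m), v = asFunctional M β h μ}

end RPC

end

/-! The core is one formula. For Lipschitz `f` and independent copies `X^i` of a Gaussian field on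
the GREM, put `S = ∑_α ξ_α exp ∑_{i<M} f(X^i_α)`. Then `E log S = M · P(f) + C`, where `P(f)` is a
nested Gaussian expectation of Parisi type and `C` depends only on the levels of `x`, not on `f`,
`M` or the covariance of the field (`integral_log_tsum`). In a ratio of two such sums `C` cancels.
Hence, for every `M ≥ 1` and every GREM, `G_M` is the same number: `P(log 2cosh(β·+h))` minus `P` of
the linear function, which is explicitly `β²/2 ∫ x(q) q dq` (`GREM.asFunctional_eq`). Comparing `M =
1` with `M = 0` gives the two RPC functionals.

For the formula, the law of a Gaussian field is fixed by its covariance, so the fields may be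
replaced by sums of independent Gaussian marks along the paths of a tree (`map_fields_eq`). The
Laplace transform of `S` is computed by recursion over the depth (`laplace_treeSum`). The Laplace
functional of a Poisson process handles the points at the root, and the scaling `∫ φ(at) t^{-x-1} dt
= a^x ∫ φ(t) t^{-x-1} dt` turns each level into an `L^x` norm, so that `E exp(-aS) = E exp(-c (a
N)^{x 0})` with `N` the iterated norm. The norm of a product of functions of independent coordinates
is the product of the norms, whence the factor `M`. A Frullani integral, `log s + const = ∫_0^1 (1 -
e^{-(ls)^x}) dl/l - ∫_1^∞ e^{-(ls)^x} dl/l`, recovers `E log S` from the Laplace transform, and its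
finiteness also yields `0 < S < ∞` almost surely and integrability (`integral_log_of_laplace`).

The functional `P` makes sense for every atomic measure as a backward flow driven by the
distribution function. One step of variance `v` changes by at most a constant times `v |x - x'|`
when its parameter changes, since the second derivative of a cumulant generating function is a
tilted variance (`parisiStep_sub_param_le`). Summing over a common refinement gives a Lipschitz
bound in the `L¹` distance (`parisiFlow_sub_le`), hence the continuous extension. Measures with an
atom at `1` are dense, so both infima agree, and the limit in `M` is that of an eventually constant
sequence.

Existence of a GREM reduces to that of Poisson processes. These are built from Poisson numbers of
independent points in the finite pieces of the intensity, and recognised by their Laplace functional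
(`isPoissonProcess_of_laplace`). -/

noncomputable section

namespace RPC

/-! ### The function `s ↦ exp (-s)` on `[0,∞]` -/

/-- `exp (-s)` for `s ∈ [0,∞]`, with value `0` at `∞`. -/
def nexp (s : ℝ≥0∞) : ℝ≥0∞ := (EReal.exp (s : EReal))⁻¹

@[simp] theorem nexp_zero : nexp 0 = 1 := by simp [nexp]

@[simp] theorem nexp_top : nexp ∞ = 0 := by simp [nexp]

theorem nexp_antitone : Antitone nexp := fun a b h => by
  unfold nexp
  rw [ENNReal.inv_le_inv]
  exact EReal.exp_monotone (by exact_mod_cast h)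

theorem nexp_le_one (s : ℝ≥0∞) : nexp s ≤ 1 := by
  simpa using nexp_antitone (zero_le (a := s))

theorem nexp_ne_top (s : ℝ≥0∞) : nexp s ≠ ∞ := ne_top_of_le_ne_top ENNReal.one_ne_top (nexp_le_one s)

theorem nexp_ofReal {s : ℝ} (hs : 0 ≤ s) : nexp (ENNReal.ofReal s) = ENNReal.ofReal (Real.exp (-s)) := by
  rw [nexp, EReal.coe_ennreal_ofReal, max_eq_left hs, EReal.exp_coe, Real.exp_neg,
    ENNReal.ofReal_inv_of_pos (Real.exp_pos _)]

theorem nexp_add (a b : ℝ≥0∞) : nexp (a + b) = nexp a * nexp b := by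
  rw [nexp, nexp, nexp, EReal.coe_ennreal_add, EReal.exp_add, ENNReal.mul_inv]
  · left; simp
  · right; simp

theorem nexp_continuous : Continuous nexp :=
  continuous_inv.comp (ENNReal.continuous_exp.comp continuous_coe_ennreal_ereal)

theorem nexp_measurable : Measurable nexp := nexp_continuous.measurable

theorem nexp_sum {ι : Type*} (s : Finset ι) (f : ι → ℝ≥0∞) :
    nexp (∑ i ∈ s, f i) = ∏ i ∈ s, nexp (f i) := by
  classical
  induction s using Finset.induction_on with
  | empty => simp
  | insert a s ha ih => rw [Finset.sum_insert ha, Finset.prod_insert ha, nexp_add, ih]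

theorem nexp_nat_mul (n : ℕ) (a : ℝ≥0∞) : nexp (n * a) = nexp a ^ n := by
  have := nexp_sum (Finset.range n) (fun _ => a)
  simpa using this

/-- The infinite product of numbers in `[0,1]`. -/
def infProd (a : ℕ → ℝ≥0∞) : ℝ≥0∞ := ⨅ N, ∏ j ∈ Finset.range N, a j

theorem prod_range_antitone {a : ℕ → ℝ≥0∞} (h : ∀ j, a j ≤ 1) :
    Antitone fun N => ∏ j ∈ Finset.range N, a j :=
  antitone_nat_of_succ_le fun n => by
    rw [Finset.prod_range_succ]; exact mul_le_of_le_one_right' (h n)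

/-- Continuity of `nexp` up to `∞` makes this hold for divergent sums too. It lets independence act
on Laplace transforms of infinite sums. -/
theorem nexp_tsum (f : ℕ → ℝ≥0∞) : nexp (∑' j, f j) = infProd fun j => nexp (f j) := by
  have h1 : Tendsto (fun N => ∏ j ∈ Finset.range N, nexp (f j)) atTop (𝓝 (nexp (∑' j, f j))) := by
    simp_rw [← nexp_sum]
    exact (nexp_continuous.tendsto _).comp ENNReal.summable.hasSum.tendsto_sum_nat
  exact tendsto_nhds_unique h1
    (tendsto_atTop_iInf (prod_range_antitone fun j => nexp_le_one _))

theorem infProd_measurable {Ω : Type*} [MeasurableSpace Ω] {a : ℕ → Ω → ℝ≥0∞}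
    (h : ∀ j, Measurable (a j)) : Measurable fun ω => infProd fun j => a j ω :=
  Measurable.iInf fun _ => Finset.measurable_fun_prod _ fun j _ => h j

/-- The partial products decrease because the factors are at most `1`, so monotone convergence
reduces the claim to finite products of independent factors. -/
theorem lintegral_infProd {Ω : Type*} [MeasurableSpace Ω] {P : Measure Ω} [IsProbabilityMeasure P]
    {a : ℕ → Ω → ℝ≥0∞} (h : ∀ j, Measurable (a j)) (h1 : ∀ j ω, a j ω ≤ 1)
    (hi : iIndepFun a P) :
    ∫⁻ ω, infProd (fun j => a j ω) ∂P = infProd fun j => ∫⁻ ω, a j ω ∂P := by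
  unfold infProd
  rw [lintegral_iInf]
  · exact iInf_congr fun N => lintegral_prod_eq_prod_lintegral_of_indepFun _ _ hi h
  · exact fun _ => Finset.measurable_fun_prod _ fun j _ => h j
  · exact fun m n hmn ω => prod_range_antitone (fun j => h1 j ω) hmn
  · simp

theorem lintegral_infProd_infinitePi {X : ℕ → Type*} [∀ i, MeasurableSpace (X i)]
    (μ : ∀ i, Measure (X i)) [∀ i, IsProbabilityMeasure (μ i)]
    {a : ∀ j, X j → ℝ≥0∞} (h : ∀ j, Measurable (a j)) (h1 : ∀ j ω, a j ω ≤ 1) :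
    ∫⁻ ω, infProd (fun j => a j (ω j)) ∂(Measure.infinitePi μ) =
      infProd fun j => ∫⁻ ω, a j ω ∂(μ j) := by
  refine (lintegral_infProd (a := fun j ω => a j (ω j)) (P := Measure.infinitePi μ) ?_ ?_ ?_).trans ?_
  rotate_left 3
  · congr 1; ext j
    rw [← Measure.infinitePi_map_eval μ j, lintegral_map (h j) (measurable_pi_apply j)]
  · exact fun j => (h j).comp (measurable_pi_apply j)
  · exact fun j ω => h1 j _
  · exact iIndepFun_infinitePi h

/-- The inverse of `nexp` on `[0,1]`. -/
def nlog (h : ℝ≥0∞) : ℝ≥0∞ := (-(ENNReal.log h)).toENNReal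

theorem nlog_measurable : Measurable nlog :=
  (measurable_neg.comp ENNReal.measurable_log).ereal_toENNReal

theorem nexp_nlog {h : ℝ≥0∞} (hh : h ≤ 1) : nexp (nlog h) = h := by
  have : 0 ≤ -(ENNReal.log h) := by
    rw [EReal.neg_nonneg]
    simpa using ENNReal.log_monotone hh
  rw [nexp, nlog, EReal.coe_toENNReal this, EReal.exp_neg, ENNReal.exp_log, inv_inv]

end RPC
end

noncomputable section

namespace RPC

/-! ### The Laplace functional of a Poisson process -/

theorem lintegral_pow_poissonMeasure (r : ℝ≥0) {h : ℝ≥0∞} (hh : h ≤ 1) :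
    ∫⁻ n, h ^ n ∂(poissonMeasure r) = nexp (r * (1 - h)) := by
  have hfin : h ≠ ∞ := ne_top_of_le_ne_top ENNReal.one_ne_top hh
  obtain ⟨t, ht0, rfl⟩ : ∃ t : ℝ, 0 ≤ t ∧ h = ENNReal.ofReal t :=
    ⟨h.toReal, ENNReal.toReal_nonneg, (ENNReal.ofReal_toReal hfin).symm⟩
  have ht1 : t ≤ 1 := by simpa using hh
  have key : HasSum (fun n : ℕ => Real.exp (-r) * r ^ n / (Nat.factorial n) * t ^ n)
      (Real.exp (-(r * (1 - t)))) := by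
    have h1 := (NormedSpace.expSeries_div_hasSum_exp ((r : ℝ) * t)).mul_left (Real.exp (-r))
    rw [← Real.exp_eq_exp_ℝ, ← Real.exp_add] at h1
    convert! h1 using 2
    · rw [mul_pow]; ring
    · ring
  rw [poissonMeasure, lintegral_sum_measure]
  simp_rw [lintegral_smul_measure, lintegral_dirac, smul_eq_mul, ← ENNReal.ofReal_pow ht0]
  have h2 : ∀ n : ℕ, 0 ≤ Real.exp (-r) * r ^ n / (Nat.factorial n) := fun n => by positivity
  simp_rw [← ENNReal.ofReal_mul (h2 _)]
  rw [← ENNReal.ofReal_tsum_of_nonneg (fun n => mul_nonneg (h2 n) (pow_nonneg ht0 n)) key.summable,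
    key.tsum_eq, ← ENNReal.ofReal_one, ← ENNReal.ofReal_sub _ ht0, ← ENNReal.ofReal_coe_nnreal,
    ← ENNReal.ofReal_mul (NNReal.coe_nonneg r)]
  exact (nexp_ofReal (mul_nonneg r.2 (by linarith))).symm

theorem count_measurable {Ω : Type} [MeasurableSpace Ω] {z : ℕ → Ω → ℝ}
    (hz : ∀ j, Measurable (z j)) {B : Set ℝ} (hB : MeasurableSet B) : Measurable (count z B) :=
  Measurable.tsum fun j => (measurable_const.indicator hB).comp (hz j)

theorem IsPoissonProcess.lintegral_nexp_count {Ω : Type} [MeasurableSpace Ω] {P : Measure Ω}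
    {z : ℕ → Ω → ℝ} {Λ : Measure ℝ} (hz : IsPoissonProcess P z Λ) {B : Set ℝ}
    (hB : MeasurableSet B) (hΛ : Λ B ≠ ∞) (a : ℝ≥0∞) :
    ∫⁻ ω, nexp (a * count z B ω) ∂P = nexp ((1 - nexp a) * Λ B) := by
  have hm : Measurable fun s : ℝ≥0∞ => nexp (a * s) :=
    nexp_measurable.comp (measurable_const.mul measurable_id)
  rw [← lintegral_map hm (count_measurable hz.measurable hB), hz.law_count B hB hΛ,
    lintegral_map hm (measurable_from_top)]
  simp_rw [mul_comm a, nexp_nat_mul]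
  rw [lintegral_pow_poissonMeasure _ (nexp_le_one a), ENNReal.coe_toNNReal hΛ, mul_comm]

theorem tsum_simpleFunc {Ω : Type} (z : ℕ → Ω → ℝ) (g : SimpleFunc ℝ ℝ≥0∞) (ω : Ω) :
    ∑' j, g (z j ω) = ∑ y ∈ g.range, y * count z (g ⁻¹' {y}) ω := by
  simp_rw [count, ← ENNReal.tsum_mul_left]
  rw [← Summable.tsum_finsetSum fun _ _ => ENNReal.summable]
  refine tsum_congr fun j => ?_
  rw [Finset.sum_eq_single (g (z j ω))]
  · simp
  · intro b _ hb
    rw [Set.indicator_of_notMem, mul_zero]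
    simpa using hb.symm
  · intro h; exact absurd (g.mem_range_self _) h

/-- The sum over the points is a combination of the counts in the fibres of `g`. These are disjoint,
so the counts are independent Poisson variables. -/
theorem IsPoissonProcess.laplace_simpleFunc {Ω : Type} [MeasurableSpace Ω] {P : Measure Ω}
    [IsProbabilityMeasure P]
    {z : ℕ → Ω → ℝ} {Λ : Measure ℝ} (hz : IsPoissonProcess P z Λ) (g : SimpleFunc ℝ ℝ≥0∞)
    (hg : ∀ y, y ≠ 0 → Λ (g ⁻¹' {y}) ≠ ∞) :
    ∫⁻ ω, nexp (∑' j, g (z j ω)) ∂P = nexp (∫⁻ t, (1 - nexp (g t)) ∂Λ) := by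
  have hR : ∫⁻ t, (1 - nexp (g t)) ∂Λ = ∑ y ∈ g.range, (1 - nexp y) * Λ (g ⁻¹' {y}) := by
    rw [← SimpleFunc.map_lintegral (fun y => 1 - nexp y) g, ← SimpleFunc.lintegral_eq_lintegral]
    rfl
  rw [hR, nexp_sum]
  simp_rw [tsum_simpleFunc, nexp_sum]
  let e := g.range.equivFin
  have hind := hz.indep_count g.range.card (fun i => g ⁻¹' {(e.symm i : ℝ≥0∞)})
    (fun i => g.measurableSet_fiber _) (fun i j hij => by
      refine Set.disjoint_left.2 fun t h1 h2 => hij ?_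
      simp only [Set.mem_preimage, Set.mem_singleton_iff] at h1 h2
      exact e.symm.injective (Subtype.ext (h1.symm.trans h2)))
  have hm : ∀ y, Measurable fun s : ℝ≥0∞ => nexp (y * s) := fun y =>
    nexp_measurable.comp (measurable_const.mul measurable_id)
  have hind2 := hind.comp (fun i s => nexp (e.symm i * s)) (fun i => hm _)
  have := lintegral_prod_eq_prod_lintegral_of_indepFun Finset.univ _ hind2
    (fun i => (hm _).comp (count_measurable hz.measurable (g.measurableSet_fiber _)))
  have hsw : ∀ F : ℝ≥0∞ → ℝ≥0∞, ∏ y ∈ g.range, F y = ∏ i, F (e.symm i) := fun F => by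
    rw [← Finset.prod_coe_sort, ← e.symm.prod_comp]
  simp_rw [hsw]
  refine this.trans (Finset.prod_congr rfl fun i _ => ?_)
  simp only [Function.comp_def]
  -- The fibre over `0` may have infinite intensity, but its count enters with coefficient `0`.
  by_cases h0 : (e.symm i : ℝ≥0∞) = 0
  · simp [h0]
  · exact hz.lintegral_nexp_count (g.measurableSet_fiber _) (hg _ h0) _

theorem ennreal_tsum_iSup {f : ℕ → ℕ → ℝ≥0∞} (hf : Monotone f) :
    ∑' j, ⨆ n, f n j = ⨆ n, ∑' j, f n j := by
  simp_rw [← lintegral_count]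
  exact lintegral_iSup (fun n => measurable_from_top) hf

/-- Approximation from below by simple functions cut off to sets of finite intensity, so that their
nonzero fibres have finite intensity. The left side converges by dominated, the exponent on the
right by monotone convergence. -/
theorem IsPoissonProcess.laplace {Ω : Type} [MeasurableSpace Ω] {P : Measure Ω}
    [IsProbabilityMeasure P] {z : ℕ → Ω → ℝ} {Λ : Measure ℝ} [SigmaFinite Λ]
    (hz : IsPoissonProcess P z Λ) {f : ℝ → ℝ≥0∞} (hf : Measurable f) :
    ∫⁻ ω, nexp (∑' j, f (z j ω)) ∂P = nexp (∫⁻ t, (1 - nexp (f t)) ∂Λ) := by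
  let g : ℕ → SimpleFunc ℝ ℝ≥0∞ := fun n => (SimpleFunc.eapprox f n).restrict (spanningSets Λ n)
  have hgv : ∀ n t, g n t = (spanningSets Λ n).indicator (SimpleFunc.eapprox f n) t := fun n t => by
    rw [SimpleFunc.restrict_apply _ (measurableSet_spanningSets Λ n)]
  have hmono : ∀ t, Monotone fun n => g n t := by
    intro t m n hmn
    simp only [hgv]
    exact (Set.indicator_le_indicator_of_subset (monotone_spanningSets Λ hmn)
      (fun _ => zero_le) t).trans
      (Set.indicator_le_indicator (SimpleFunc.monotone_eapprox f hmn t))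
  have hsup : ∀ t, ⨆ n, g n t = f t := by
    intro t
    apply le_antisymm
    · refine iSup_le fun n => ?_
      rw [hgv]
      exact (Set.indicator_le_self _ _ t).trans
        (SimpleFunc.iSup_eapprox_apply hf t ▸ le_iSup (fun n => SimpleFunc.eapprox f n t) n)
    · rw [← SimpleFunc.iSup_eapprox_apply hf t]
      refine iSup_le fun n => ?_
      obtain ⟨m, hm⟩ : ∃ m, t ∈ spanningSets Λ m := by
        have := iUnion_spanningSets Λ
        exact Set.mem_iUnion.1 (this ▸ Set.mem_univ t)
      refine le_trans ?_ (le_iSup _ (max n m))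
      rw [hgv, Set.indicator_of_mem (monotone_spanningSets Λ (le_max_right n m) hm)]
      exact SimpleFunc.monotone_eapprox f (le_max_left n m) t
  have hfin : ∀ n, ∀ y, y ≠ 0 → Λ (g n ⁻¹' {y}) ≠ ∞ := by
    intro n y hy
    refine ne_top_of_le_ne_top (measure_spanningSets_lt_top Λ n).ne (measure_mono fun t ht => ?_)
    by_contra hts
    refine hy ?_
    rw [← (show g n t = y from ht), hgv, Set.indicator_of_notMem hts]
  have hlim : ∀ t, Tendsto (fun n => g n t) atTop (𝓝 (f t)) := fun t => by
    rw [← hsup t]; exact tendsto_atTop_iSup (hmono t)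
  have hL : Tendsto (fun n => ∫⁻ ω, nexp (∑' j, g n (z j ω)) ∂P) atTop
      (𝓝 (∫⁻ ω, nexp (∑' j, f (z j ω)) ∂P)) := by
    refine tendsto_lintegral_of_dominated_convergence (fun _ => 1) (fun n => ?_) (fun n => ?_)
      (by simp) (ae_of_all _ fun ω => ?_)
    · exact nexp_measurable.comp
        (Measurable.tsum fun j => (g n).measurable.comp (hz.measurable j))
    · exact ae_of_all _ fun ω => nexp_le_one _
    · refine (nexp_continuous.tendsto _).comp ?_
      have h1 : ∑' j, f (z j ω) = ⨆ n, ∑' j, g n (z j ω) := by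
        rw [← ennreal_tsum_iSup (f := fun n j => g n (z j ω)) fun m n hmn j => hmono _ hmn]
        simp_rw [hsup]
      rw [h1]
      exact tendsto_atTop_iSup fun m n hmn => ENNReal.tsum_le_tsum fun j => hmono _ hmn
  have hRt : Tendsto (fun n => nexp (∫⁻ t, (1 - nexp (g n t)) ∂Λ)) atTop
      (𝓝 (nexp (∫⁻ t, (1 - nexp (f t)) ∂Λ))) := by
    refine (nexp_continuous.tendsto _).comp (lintegral_tendsto_of_tendsto_of_monotone
      (fun n => ?_) (ae_of_all _ fun t m n hmn => ?_) (ae_of_all _ fun t => ?_))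
    · exact (measurable_const.sub (nexp_measurable.comp (g n).measurable)).aemeasurable
    · exact tsub_le_tsub_left (nexp_antitone (hmono t hmn)) _
    · exact ENNReal.Tendsto.sub tendsto_const_nhds ((nexp_continuous.tendsto _).comp (hlim t))
        (Or.inl ENNReal.one_ne_top)
  refine tendsto_nhds_unique hL ?_
  simp_rw [fun n => hz.laplace_simpleFunc (g n) (hfin n)]
  exact hRt

/-- The Laplace functional of a Poisson process in multiplicative form. -/
theorem IsPoissonProcess.lintegral_infProd {Ω : Type} [MeasurableSpace Ω] {P : Measure Ω}
    [IsProbabilityMeasure P] {z : ℕ → Ω → ℝ} {Λ : Measure ℝ} [SigmaFinite Λ]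
    (hz : IsPoissonProcess P z Λ) {h : ℝ → ℝ≥0∞} (hh : Measurable h) (h1 : ∀ t, h t ≤ 1) :
    ∫⁻ ω, infProd (fun j => h (z j ω)) ∂P = nexp (∫⁻ t, (1 - h t) ∂Λ) := by
  have := hz.laplace (nlog_measurable.comp hh)
  simp_rw [nexp_tsum, Function.comp_def, nexp_nlog (h1 _)] at this
  exact this

/-- At the Laplace parameter `∞` the exponential of the count is the indicator of the event that no
point lies in `B`. -/
theorem IsPoissonProcess.ae_mem {Ω : Type} [MeasurableSpace Ω] {P : Measure Ω}
    [IsProbabilityMeasure P] {z : ℕ → Ω → ℝ} {Λ : Measure ℝ}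
    (hz : IsPoissonProcess P z Λ) {B : Set ℝ} (hB : MeasurableSet B) (h0 : Λ B = 0) :
    ∀ᵐ ω ∂P, ∀ j, z j ω ∉ B := by
  have h := hz.lintegral_nexp_count hB (by simp [h0]) ∞
  rw [h0, mul_zero, nexp_zero] at h
  have hm : Measurable fun ω => nexp (∞ * count z B ω) :=
    nexp_measurable.comp (measurable_const.mul (count_measurable hz.measurable hB))
  have h2 : ∫⁻ ω, (1 - nexp (∞ * count z B ω)) ∂P = 0 := by
    rw [lintegral_sub hm (by rw [h]; simp) (ae_of_all _ fun _ => nexp_le_one _), h]; simp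
  rw [lintegral_eq_zero_iff (by exact measurable_const.sub hm)] at h2
  filter_upwards [h2] with ω hω j hj
  have h3 : count z B ω ≠ 0 := by
    rw [count, Ne, ENNReal.tsum_eq_zero]
    intro hall
    simpa [hj] using hall j
  simp [ENNReal.top_mul h3] at hω

end RPC
end

noncomputable section

namespace RPC

/-! ### Power measures on the half line -/

/-- The measure `t^{-p-1} dt` on `(0,∞)`. -/
def powerMeasure (p : ℝ) : Measure ℝ :=
  (volume.restrict (Set.Ioi 0)).withDensity fun t => ENNReal.ofReal (t ^ (-p - 1))

theorem measurable_powerDensity (p : ℝ) : Measurable fun t : ℝ => ENNReal.ofReal (t ^ (-p - 1)) := by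
  fun_prop

instance (p : ℝ) : SigmaFinite (powerMeasure p) :=
  SigmaFinite.withDensity_ofReal _

instance (x : ℝ) : SigmaFinite (remIntensity x) :=
  SigmaFinite.withDensity_ofReal _

theorem lintegral_powerMeasure (p : ℝ) {φ : ℝ → ℝ≥0∞} (hφ : Measurable φ) :
    ∫⁻ t, φ t ∂(powerMeasure p) = ∫⁻ t in Set.Ioi 0, ENNReal.ofReal (t ^ (-p - 1)) * φ t := by
  rw [powerMeasure, lintegral_withDensity_eq_lintegral_mul _ (measurable_powerDensity p) hφ]
  rfl

theorem remIntensity_eq {x : ℝ} (hx : 0 ≤ x) :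
    remIntensity x = ENNReal.ofReal x • powerMeasure x := by
  rw [powerMeasure, ← withDensity_smul _ (measurable_powerDensity x), remIntensity]
  congr 1
  ext t
  rw [Pi.smul_apply, smul_eq_mul, ← ENNReal.ofReal_mul hx]

theorem powerMeasure_ae_pos (p : ℝ) : ∀ᵐ t ∂(powerMeasure p), 0 < t :=
  (withDensity_absolutelyContinuous _ _).ae_le (ae_restrict_mem measurableSet_Ioi)

/-- The substitution `s = a t`. For `p > 0` this is the stability of the REM under random
multiplication; for `p = 0` it is the scale invariance of `dt/t` behind the Frullani formula. -/
theorem lintegral_powerMeasure_comp_mul (p : ℝ) {a : ℝ} (ha : 0 < a) {φ : ℝ → ℝ≥0∞}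
    (hφ : Measurable φ) :
    ∫⁻ t, φ (a * t) ∂(powerMeasure p) = ENNReal.ofReal (a ^ p) * ∫⁻ t, φ t ∂(powerMeasure p) := by
  rw [lintegral_powerMeasure p (φ := fun t => φ (a * t)) (hφ.comp (measurable_const_mul a)), lintegral_powerMeasure p hφ,
    ← lintegral_indicator measurableSet_Ioi, ← lintegral_indicator measurableSet_Ioi]
  let F : ℝ → ℝ≥0∞ := (Set.Ioi 0).indicator fun t => ENNReal.ofReal (t ^ (-p - 1)) * φ t
  have hF : Measurable F := ((measurable_powerDensity p).mul hφ).indicator measurableSet_Ioi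
  have h1 : ∀ t, (Set.Ioi 0).indicator (fun t => ENNReal.ofReal (t ^ (-p - 1)) * φ (a * t)) t =
      ENNReal.ofReal (a ^ (p + 1)) * F (a * t) := by
    intro t
    by_cases ht : 0 < t
    · have hat : 0 < a * t := mul_pos ha ht
      simp only [F, Set.indicator_of_mem (Set.mem_Ioi.2 ht), Set.indicator_of_mem (Set.mem_Ioi.2 hat)]
      rw [← mul_assoc, ← ENNReal.ofReal_mul (by positivity), Real.mul_rpow ha.le ht.le, ← mul_assoc,
        ← Real.rpow_add ha]
      simp
    · have hat : ¬ 0 < a * t := by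
        rw [mul_pos_iff_of_pos_left ha]; exact ht
      simp only [F, Set.indicator_of_notMem (show t ∉ Set.Ioi 0 from ht),
        Set.indicator_of_notMem (show a * t ∉ Set.Ioi 0 from hat), mul_zero]
  simp_rw [h1]
  rw [lintegral_const_mul _ (by exact hF.comp (measurable_const_mul a)),
    ← lintegral_map hF (measurable_const_mul a), Real.map_volume_mul_left ha.ne',
    lintegral_smul_measure, smul_eq_mul, ← mul_assoc, ← ENNReal.ofReal_mul (by positivity),
    abs_of_pos (inv_pos.2 ha), Real.rpow_add ha, Real.rpow_one, mul_assoc, mul_inv_cancel₀ ha.ne',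
    mul_one]

theorem lintegral_remIntensity_comp_mul {x : ℝ} (hx : 0 < x) {a : ℝ≥0∞} (ha : a ≠ ∞)
    {φ : ℝ≥0∞ → ℝ≥0∞} (hφ : Measurable φ) (h0 : φ 0 = 0) :
    ∫⁻ t, φ (a * ENNReal.ofReal t) ∂(remIntensity x) =
      a ^ x * ∫⁻ t, φ (ENNReal.ofReal t) ∂(remIntensity x) := by
  rcases eq_or_ne a 0 with rfl | ha0
  · simp [h0, ENNReal.zero_rpow_of_pos hx]
  have hr : 0 < a.toReal := ENNReal.toReal_pos ha0 ha
  rw [remIntensity_eq hx.le, lintegral_smul_measure, lintegral_smul_measure, smul_eq_mul,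
    smul_eq_mul]
  have h1 := lintegral_powerMeasure_comp_mul x hr
    (φ := fun t => φ (ENNReal.ofReal t)) (hφ.comp ENNReal.measurable_ofReal)
  simp_rw [ENNReal.ofReal_mul hr.le, ENNReal.ofReal_toReal ha] at h1
  rw [h1, ← ENNReal.ofReal_rpow_of_pos hr, ENNReal.ofReal_toReal ha]
  ring

theorem one_sub_nexp_le (s : ℝ≥0∞) : 1 - nexp s ≤ s := by
  rcases eq_or_ne s ∞ with rfl | hs
  · simp
  rw [← ENNReal.ofReal_toReal hs, nexp_ofReal ENNReal.toReal_nonneg, ← ENNReal.ofReal_one,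
    ← ENNReal.ofReal_sub _ (Real.exp_pos _).le]
  refine ENNReal.ofReal_le_ofReal ?_
  have := Real.add_one_le_exp (-s.toReal)
  linarith

theorem one_sub_nexp_pos {s : ℝ≥0∞} (hs : s ≠ 0) : 0 < 1 - nexp s := by
  rw [tsub_pos_iff_lt]
  rcases eq_or_ne s ∞ with rfl | ht
  · simp
  rw [← ENNReal.ofReal_toReal ht, nexp_ofReal ENNReal.toReal_nonneg]
  have := ENNReal.toReal_pos hs ht
  simpa using this

theorem powerMeasure_Ioi {p : ℝ} (hp : 0 < p) {a : ℝ} (ha : 0 < a) :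
    powerMeasure p (Set.Ioi a) = ENNReal.ofReal (a ^ (-p) / p) := by
  rw [← lintegral_indicator_one measurableSet_Ioi,
    lintegral_powerMeasure p (measurable_one.indicator measurableSet_Ioi)]
  have h1 : ∀ t, ENNReal.ofReal (t ^ (-p - 1)) * (Set.Ioi a).indicator 1 t =
      (Set.Ioi a).indicator (fun t => ENNReal.ofReal (t ^ (-p - 1))) t := fun t => by
    by_cases h : t ∈ Set.Ioi a <;> simp [h]
  simp_rw [h1]
  rw [setLIntegral_indicator measurableSet_Ioi,
    Set.inter_eq_left.2 (Set.Ioi_subset_Ioi ha.le),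
    ← ofReal_integral_eq_lintegral_ofReal (integrableOn_Ioi_rpow_of_lt (by linarith) ha)
      ((ae_restrict_mem measurableSet_Ioi).mono fun t ht =>
        Real.rpow_nonneg (ha.trans ht).le _),
    integral_Ioi_rpow_of_lt (by linarith) ha]
  congr 1
  rw [sub_add_cancel, neg_div_neg_eq]

/-- The constant `∫ (1 - exp (- c t^y)) x t^{-x-1} dt`. -/
def levyConst (x y : ℝ) (c : ℝ≥0∞) : ℝ≥0∞ :=
  ∫⁻ t, (1 - nexp (c * ENNReal.ofReal t ^ y)) ∂(remIntensity x)

theorem lintegral_Iic_powerMeasure_lt_top {p : ℝ} (hp : p < 0) :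
    powerMeasure p (Set.Iic 1) < ∞ := by
  rw [← lintegral_indicator_one measurableSet_Iic,
    lintegral_powerMeasure p (measurable_one.indicator measurableSet_Iic)]
  have h1 : ∀ t, ENNReal.ofReal (t ^ (-p - 1)) * (Set.Iic 1).indicator 1 t =
      (Set.Iic 1).indicator (fun t => ENNReal.ofReal (t ^ (-p - 1))) t := fun t => by
    by_cases h : t ∈ Set.Iic (1 : ℝ) <;> simp [h]
  simp_rw [h1]
  rw [setLIntegral_indicator measurableSet_Iic, Set.inter_comm, Set.Ioi_inter_Iic]
  have h2 : IntegrableOn (fun t : ℝ => t ^ (-p - 1)) (Set.Ioc 0 1) :=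
    (intervalIntegrable_iff_integrableOn_Ioc_of_le zero_le_one).1
      (intervalIntegral.intervalIntegrable_rpow' (by linarith))
  rw [← ofReal_integral_eq_lintegral_ofReal h2
      ((ae_restrict_mem measurableSet_Ioc).mono fun t ht =>
        Real.rpow_nonneg ht.1.le _)]
  exact ENNReal.ofReal_lt_top

/-- Away from `0` the integrand is at most `1` and the intensity is finite because `x > 0`. Near `0`
the integrand is at most `c t^y`, integrable against `t^{-x-1}` because `x < y`. This is why the
levels of the cascade must increase strictly. -/
theorem levyConst_ne_top {x y : ℝ} (hx : 0 < x) (hxy : x < y) {c : ℝ≥0∞} (hc : c ≠ ∞) :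
    levyConst x y c ≠ ∞ := by
  have hm : Measurable fun t : ℝ => 1 - nexp (c * ENNReal.ofReal t ^ y) :=
    measurable_const.sub (nexp_measurable.comp
      (measurable_const.mul (ENNReal.measurable_ofReal.pow_const y)))
  rw [levyConst, remIntensity_eq hx.le, lintegral_smul_measure, smul_eq_mul]
  refine ENNReal.mul_ne_top ENNReal.ofReal_ne_top ?_
  rw [← lintegral_add_compl _ (measurableSet_Ioi (a := (1 : ℝ))), Set.compl_Ioi]
  refine ENNReal.add_ne_top.2 ⟨?_, ?_⟩
  · refine ne_top_of_le_ne_top ?_ (lintegral_mono (g := fun _ => 1) fun t => tsub_le_self)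
    rw [setLIntegral_one, powerMeasure_Ioi hx one_pos]
    exact ENNReal.ofReal_ne_top
  · refine ne_top_of_le_ne_top ?_ (lintegral_mono fun t => one_sub_nexp_le _)
    rw [lintegral_const_mul _ (ENNReal.measurable_ofReal.pow_const y)]
    refine ENNReal.mul_ne_top hc ?_
    rw [← lintegral_indicator measurableSet_Iic, lintegral_powerMeasure _
      ((ENNReal.measurable_ofReal.pow_const y).indicator measurableSet_Iic)]
    have h2 := lintegral_Iic_powerMeasure_lt_top (p := x - y) (by linarith)
    rw [← lintegral_indicator_one measurableSet_Iic,
      lintegral_powerMeasure _ (measurable_one.indicator measurableSet_Iic)] at h2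
    refine ne_top_of_le_ne_top h2.ne (setLIntegral_mono' measurableSet_Ioi fun t ht => ?_)
    by_cases h : t ∈ Set.Iic (1 : ℝ)
    · rw [Set.indicator_of_mem h, Set.indicator_of_mem h, Pi.one_apply, mul_one,
        ENNReal.ofReal_rpow_of_pos ht, ← ENNReal.ofReal_mul (Real.rpow_nonneg (le_of_lt ht) _),
        ← Real.rpow_add ht]
      exact le_of_eq (by ring_nf)
    · simp [Set.indicator_of_notMem h]

theorem levyConst_ne_zero {x : ℝ} (y : ℝ) (hx : 0 < x) {c : ℝ≥0∞} (hc : c ≠ 0) :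
    levyConst x y c ≠ 0 := by
  have hm : Measurable fun t : ℝ => 1 - nexp (c * ENNReal.ofReal t ^ y) :=
    measurable_const.sub (nexp_measurable.comp
      (measurable_const.mul (ENNReal.measurable_ofReal.pow_const y)))
  rw [levyConst, remIntensity_eq hx.le, lintegral_smul_measure, smul_eq_mul]
  refine mul_ne_zero (by simpa using hx) ?_
  rw [Ne, lintegral_eq_zero_iff hm]
  intro h
  have h2 : ∀ᵐ t ∂(powerMeasure x), False := by
    filter_upwards [h, powerMeasure_ae_pos x] with t ht htp
    refine (one_sub_nexp_pos (s := c * ENNReal.ofReal t ^ y) ?_).ne' ht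
    refine mul_ne_zero hc ?_
    rw [ENNReal.ofReal_rpow_of_pos htp]
    simpa using Real.rpow_pos_of_pos htp y
  have h3 : powerMeasure x = 0 := by simpa using h2
  have h4 := powerMeasure_Ioi hx one_pos
  rw [h3] at h4
  simp at h4
  linarith

end RPC
end

noncomputable section

namespace RPC

/-! ### The logarithm as a difference of Laplace integrals -/

/-- `∫_0^1 (1 - exp (-(λ s)^x)) dλ/λ`. -/
def frullaniLow (x : ℝ) (s : ℝ≥0∞) : ℝ≥0∞ :=
  ∫⁻ l in Set.Ioc 0 1, (1 - nexp ((ENNReal.ofReal l * s) ^ x)) ∂(powerMeasure 0)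

/-- `∫_1^∞ exp (-(λ s)^x) dλ/λ`. -/
def frullaniHigh (x : ℝ) (s : ℝ≥0∞) : ℝ≥0∞ :=
  ∫⁻ l in Set.Ioi 1, nexp ((ENNReal.ofReal l * s) ^ x) ∂(powerMeasure 0)

theorem measurable_nexp_rpow (x : ℝ) : Measurable fun p : ℝ × ℝ≥0∞ =>
    nexp ((ENNReal.ofReal p.1 * p.2) ^ x) := by
  refine nexp_measurable.comp (Measurable.pow_const ?_ x)
  fun_prop

theorem frullaniLow_measurable (x : ℝ) : Measurable (frullaniLow x) :=
  Measurable.lintegral_prod_left' (f := fun p : ℝ × ℝ≥0∞ =>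
    1 - nexp ((ENNReal.ofReal p.1 * p.2) ^ x)) ((measurable_nexp_rpow x).const_sub 1)

theorem frullaniHigh_measurable (x : ℝ) : Measurable (frullaniHigh x) :=
  Measurable.lintegral_prod_left' (f := fun p : ℝ × ℝ≥0∞ =>
    nexp ((ENNReal.ofReal p.1 * p.2) ^ x)) (measurable_nexp_rpow x)

theorem setLIntegral_powerMeasure_zero_comp_mul {a : ℝ} (ha : 0 < a) {φ : ℝ → ℝ≥0∞}
    (hφ : Measurable φ) {S T : Set ℝ} (hS : MeasurableSet S) (hT : MeasurableSet T)
    (hST : ∀ t, t ∈ S ↔ a * t ∈ T) :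
    ∫⁻ t in S, φ (a * t) ∂(powerMeasure 0) = ∫⁻ t in T, φ t ∂(powerMeasure 0) := by
  rw [← lintegral_indicator hS, ← lintegral_indicator hT]
  have := lintegral_powerMeasure_comp_mul 0 ha (hφ.indicator hT)
  rw [Real.rpow_zero, ENNReal.ofReal_one, one_mul] at this
  rw [← this]
  refine lintegral_congr fun t => ?_
  by_cases h : t ∈ S
  · rw [Set.indicator_of_mem h, Set.indicator_of_mem ((hST t).1 h)]
  · rw [Set.indicator_of_notMem h, Set.indicator_of_notMem fun h' => h ((hST t).2 h')]

theorem frullaniLow_eq (x : ℝ) {s : ℝ} (hs : 0 < s) :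
    frullaniLow x (ENNReal.ofReal s) =
      ∫⁻ v in Set.Ioc 0 s, (1 - nexp (ENNReal.ofReal v ^ x)) ∂(powerMeasure 0) := by
  rw [← setLIntegral_powerMeasure_zero_comp_mul hs (S := Set.Ioc 0 1) _ measurableSet_Ioc
    measurableSet_Ioc]
  · simp_rw [ENNReal.ofReal_mul hs.le, mul_comm (ENNReal.ofReal s)]; rfl
  · intro t
    simp only [Set.mem_Ioc]
    rw [mul_pos_iff_of_pos_left hs, mul_le_iff_le_one_right hs]
  · exact measurable_const.sub (nexp_measurable.comp (ENNReal.measurable_ofReal.pow_const x))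

theorem frullaniHigh_eq (x : ℝ) {s : ℝ} (hs : 0 < s) :
    frullaniHigh x (ENNReal.ofReal s) =
      ∫⁻ v in Set.Ioi s, nexp (ENNReal.ofReal v ^ x) ∂(powerMeasure 0) := by
  rw [← setLIntegral_powerMeasure_zero_comp_mul hs (S := Set.Ioi 1) _ measurableSet_Ioi
    measurableSet_Ioi]
  · simp_rw [ENNReal.ofReal_mul hs.le, mul_comm (ENNReal.ofReal s)]; rfl
  · intro t
    simp only [Set.mem_Ioi]
    rw [lt_mul_iff_one_lt_right hs]
  · exact nexp_measurable.comp (ENNReal.measurable_ofReal.pow_const x)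

theorem powerMeasure_zero_Ioc {a b : ℝ} (ha : 0 < a) (hab : a ≤ b) :
    powerMeasure 0 (Set.Ioc a b) = ENNReal.ofReal (Real.log (b / a)) := by
  rw [← lintegral_indicator_one measurableSet_Ioc,
    lintegral_powerMeasure 0 (measurable_one.indicator measurableSet_Ioc)]
  have h1 : ∀ t, ENNReal.ofReal (t ^ (-(0 : ℝ) - 1)) * (Set.Ioc a b).indicator 1 t =
      (Set.Ioc a b).indicator (fun t => ENNReal.ofReal t⁻¹) t := fun t => by
    by_cases h : t ∈ Set.Ioc a b <;> simp [h, Real.rpow_neg_one]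
  simp_rw [h1]
  have hsub : Set.Ioc a b ⊆ Set.Ioi 0 := fun t ht => ha.trans ht.1
  rw [setLIntegral_indicator measurableSet_Ioc, Set.inter_eq_left.2 hsub]
  have hint : IntegrableOn (fun t : ℝ => t⁻¹) (Set.Ioc a b) :=
    (intervalIntegrable_iff_integrableOn_Ioc_of_le hab).1
      (intervalIntegral.intervalIntegrable_inv (fun t ht => by
        rw [Set.uIcc_of_le hab] at ht; exact (ha.trans_le ht.1).ne') continuousOn_id)
  rw [← ofReal_integral_eq_lintegral_ofReal hint
      ((ae_restrict_mem measurableSet_Ioc).mono fun t ht => inv_nonneg.2 (ha.trans ht.1).le),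
    ← intervalIntegral.integral_of_le hab, integral_inv_of_pos ha (ha.trans_le hab)]

/-- After rescaling, both sides differ only on `(r, s]`, where `1 - e` and `e` add up to the mass
`log (s / r)`. The additive form avoids subtraction in `[0,∞]`. -/
theorem frullani_of_le (x : ℝ) {r s : ℝ} (hr : 0 < r) (hrs : r ≤ s) :
    frullaniLow x (ENNReal.ofReal s) + frullaniHigh x (ENNReal.ofReal r) =
      frullaniLow x (ENNReal.ofReal r) + frullaniHigh x (ENNReal.ofReal s) +
        ENNReal.ofReal (Real.log (s / r)) := by
  have hs := hr.trans_le hrs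
  have hm : Measurable fun v : ℝ => nexp (ENNReal.ofReal v ^ x) :=
    nexp_measurable.comp (ENNReal.measurable_ofReal.pow_const x)
  rw [frullaniLow_eq x hs, frullaniHigh_eq x hr, frullaniLow_eq x hr, frullaniHigh_eq x hs,
    ← Set.Ioc_union_Ioc_eq_Ioc hr.le hrs, ← Set.Ioc_union_Ioi_eq_Ioi hrs,
    lintegral_union measurableSet_Ioc (Set.Ioc_disjoint_Ioc_of_le le_rfl),
    lintegral_union measurableSet_Ioi (Set.disjoint_left.2 fun t h1 h2 => not_lt.2 h1.2 h2),
    ← powerMeasure_zero_Ioc hr hrs, ← setLIntegral_one (μ := powerMeasure 0) (Set.Ioc r s)]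
  have h1 : ∫⁻ v in Set.Ioc r s, (1 : ℝ≥0∞) ∂(powerMeasure 0) =
      ∫⁻ v in Set.Ioc r s, (1 - nexp (ENNReal.ofReal v ^ x)) ∂(powerMeasure 0) +
      ∫⁻ v in Set.Ioc r s, nexp (ENNReal.ofReal v ^ x) ∂(powerMeasure 0) := by
    rw [← lintegral_add_right _ hm]
    exact lintegral_congr fun v => (tsub_add_cancel_of_le (nexp_le_one _)).symm
  rw [h1]
  abel

theorem frullaniLow_one_ne_top {x : ℝ} (hx : 0 < x) : frullaniLow x 1 ≠ ∞ := by
  rw [← ENNReal.ofReal_one, frullaniLow_eq x one_pos]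
  refine ne_top_of_le_ne_top ?_ (lintegral_mono fun t => one_sub_nexp_le _)
  rw [← lintegral_indicator measurableSet_Ioc, lintegral_powerMeasure _
    ((ENNReal.measurable_ofReal.pow_const x).indicator measurableSet_Ioc)]
  have h2 := lintegral_Iic_powerMeasure_lt_top (p := - x) (by linarith)
  rw [← lintegral_indicator_one measurableSet_Iic,
    lintegral_powerMeasure _ (measurable_one.indicator measurableSet_Iic)] at h2
  refine ne_top_of_le_ne_top h2.ne (setLIntegral_mono' measurableSet_Ioi fun t ht => ?_)
  by_cases h : t ∈ Set.Ioc (0 : ℝ) 1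
  · rw [Set.indicator_of_mem h, Set.indicator_of_mem (show t ∈ Set.Iic 1 from h.2), Pi.one_apply,
      mul_one,
      ENNReal.ofReal_rpow_of_pos ht, ← ENNReal.ofReal_mul (Real.rpow_nonneg (le_of_lt ht) _),
      ← Real.rpow_add ht]
    exact le_of_eq (by ring_nf)
  · simp [Set.indicator_of_notMem h]

theorem frullaniHigh_one_ne_top {x : ℝ} (hx : 0 < x) : frullaniHigh x 1 ≠ ∞ := by
  rw [← ENNReal.ofReal_one, frullaniHigh_eq x one_pos]
  have hle : ∀ t : ℝ, 0 < t → nexp (ENNReal.ofReal t ^ x) ≤ ENNReal.ofReal (t ^ (-x)) := by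
    intro t ht
    have hp := Real.rpow_pos_of_pos ht x
    rw [ENNReal.ofReal_rpow_of_pos ht, nexp_ofReal hp.le,
      Real.rpow_neg ht.le, Real.exp_neg]
    refine ENNReal.ofReal_le_ofReal (inv_anti₀ hp ?_)
    have := Real.add_one_le_exp (t ^ x)
    linarith
  have hm : Measurable fun t : ℝ => nexp (ENNReal.ofReal t ^ x) :=
    nexp_measurable.comp (ENNReal.measurable_ofReal.pow_const x)
  rw [← lintegral_indicator measurableSet_Ioi, lintegral_powerMeasure _
    (hm.indicator measurableSet_Ioi)]
  have h2 := powerMeasure_Ioi hx one_pos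
  rw [← lintegral_indicator_one measurableSet_Ioi,
    lintegral_powerMeasure _ (measurable_one.indicator measurableSet_Ioi)] at h2
  refine ne_top_of_le_ne_top (h2 ▸ ENNReal.ofReal_ne_top)
    (setLIntegral_mono' measurableSet_Ioi fun t ht => ?_)
  by_cases h : t ∈ Set.Ioi (1 : ℝ)
  · rw [Set.indicator_of_mem h, Set.indicator_of_mem h, Pi.one_apply, mul_one]
    refine (mul_le_mul_right (hle t ht) _).trans ?_
    rw [← ENNReal.ofReal_mul (Real.rpow_nonneg (le_of_lt ht) _), ← Real.rpow_add ht]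
    exact le_of_eq (by ring_nf)
  · simp [Set.indicator_of_notMem h]

theorem powerMeasure_zero_Ioc_zero_one : powerMeasure 0 (Set.Ioc 0 1) = ∞ := by
  refine ENNReal.eq_top_of_forall_nnreal_le fun r => ?_
  have h := powerMeasure_zero_Ioc (Real.exp_pos (-(r : ℝ)))
    (Real.exp_le_one_iff.2 (neg_nonpos.2 r.2))
  rw [one_div, ← Real.exp_neg, neg_neg, Real.log_exp, ENNReal.ofReal_coe_nnreal] at h
  rw [← h]
  exact measure_mono (Set.Ioc_subset_Ioc_left (Real.exp_pos _).le)

theorem powerMeasure_zero_Ioi_one : powerMeasure 0 (Set.Ioi 1) = ∞ := by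
  refine ENNReal.eq_top_of_forall_nnreal_le fun r => ?_
  have h := powerMeasure_zero_Ioc one_pos (Real.one_le_exp r.2)
  rw [div_one, Real.log_exp, ← ENNReal.ofReal_coe_nnreal] at *
  refine h.ge.trans (measure_mono Set.Ioc_subset_Ioi_self)

/-- Together with `frullaniHigh_zero`, this lets finiteness of the mean Frullani integrals exclude
the values `∞` and `0` of a random sum. -/
theorem frullaniLow_top {x : ℝ} (hx : 0 < x) : frullaniLow x ∞ = ∞ := by
  refine Eq.trans ?_ powerMeasure_zero_Ioc_zero_one
  rw [frullaniLow, ← setLIntegral_one (Set.Ioc 0 1)]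
  refine setLIntegral_congr_fun measurableSet_Ioc fun t ht => ?_
  rw [ENNReal.mul_top (by simpa using ht.1), ENNReal.top_rpow_of_pos hx, nexp_top, tsub_zero]

theorem frullaniHigh_zero {x : ℝ} (hx : 0 < x) : frullaniHigh x 0 = ∞ := by
  refine Eq.trans ?_ powerMeasure_zero_Ioi_one
  rw [frullaniHigh, ← setLIntegral_one (Set.Ioi 1)]
  refine setLIntegral_congr_fun measurableSet_Ioi fun t ht => ?_
  rw [mul_zero, ENNReal.zero_rpow_of_pos hx, nexp_zero]

/-- The constant in the Frullani formula `frullaniLow - frullaniHigh = log + const`. -/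
def frullaniConst (x : ℝ) : ℝ := (frullaniLow x 1).toReal - (frullaniHigh x 1).toReal

theorem frullaniLow_mono {x : ℝ} (hx : 0 ≤ x) : Monotone (frullaniLow x) := fun _ _ h =>
  lintegral_mono fun _ => tsub_le_tsub_left (nexp_antitone
    (ENNReal.rpow_le_rpow (mul_le_mul_right h _) hx)) _

theorem frullaniHigh_anti {x : ℝ} (hx : 0 ≤ x) : Antitone (frullaniHigh x) := fun _ _ h =>
  lintegral_mono fun _ => nexp_antitone (ENNReal.rpow_le_rpow (mul_le_mul_right h _) hx)

theorem frullani_finite {x : ℝ} (hx : 0 < x) {s : ℝ} (hs : 0 < s) :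
    frullaniLow x (ENNReal.ofReal s) ≠ ∞ ∧ frullaniHigh x (ENNReal.ofReal s) ≠ ∞ := by
  have h1 := frullaniLow_one_ne_top hx
  have h2 := frullaniHigh_one_ne_top hx
  rcases le_total 1 s with h | h
  · have hH : frullaniHigh x (ENNReal.ofReal s) ≠ ∞ :=
      ne_top_of_le_ne_top h2 (frullaniHigh_anti hx.le (by simpa using h))
    refine ⟨?_, hH⟩
    have := frullani_of_le x one_pos h
    rw [ENNReal.ofReal_one] at this
    refine ne_top_of_le_ne_top ?_ (le_self_add.trans this.le)
    simp [h1, hH]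
  · have hL : frullaniLow x (ENNReal.ofReal s) ≠ ∞ :=
      ne_top_of_le_ne_top h1 (frullaniLow_mono hx.le (by simpa using h))
    refine ⟨hL, ?_⟩
    have := frullani_of_le x hs h
    rw [ENNReal.ofReal_one] at this
    refine ne_top_of_le_ne_top ?_ (le_add_self.trans this.le)
    simp [hL, h2]

theorem frullani_log {x : ℝ} (hx : 0 < x) {s : ℝ} (hs : 0 < s) :
    (frullaniLow x (ENNReal.ofReal s)).toReal - (frullaniHigh x (ENNReal.ofReal s)).toReal =
      Real.log s + frullaniConst x := by
  have h1 := frullaniLow_one_ne_top hx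
  have h2 := frullaniHigh_one_ne_top hx
  obtain ⟨hL, hH⟩ := frullani_finite hx hs
  rw [frullaniConst]
  rcases le_total 1 s with h | h
  · have := frullani_of_le x one_pos h
    rw [ENNReal.ofReal_one, div_one] at this
    have h3 := congrArg ENNReal.toReal this
    rw [ENNReal.toReal_add hL h2, ENNReal.toReal_add (by simp [h1, hH]) (by simp),
      ENNReal.toReal_add h1 hH, ENNReal.toReal_ofReal (Real.log_nonneg h)] at h3
    linarith
  · have := frullani_of_le x hs h
    have hlog : 0 ≤ Real.log (1 / s) := Real.log_nonneg (by rw [le_div_iff₀ hs]; linarith)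
    rw [ENNReal.ofReal_one] at this
    have h3 := congrArg ENNReal.toReal this
    rw [ENNReal.toReal_add h1 hH, ENNReal.toReal_add (by simp [hL, h2]) (by simp),
      ENNReal.toReal_add hL h2, ENNReal.toReal_ofReal hlog, one_div, Real.log_inv] at h3
    linarith

/-- Domination by `|log s|` plus a constant transfers integrability of the logarithm to both
Frullani integrals. -/
theorem frullani_le {x : ℝ} (hx : 0 < x) {s : ℝ} (hs : 0 < s) :
    frullaniLow x (ENNReal.ofReal s) + frullaniHigh x (ENNReal.ofReal s) ≤
      ENNReal.ofReal |Real.log s| + 2 * (frullaniLow x 1 + frullaniHigh x 1) := by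
  rcases le_total 1 s with h | h
  · have h4 : frullaniHigh x (ENNReal.ofReal s) ≤ frullaniHigh x 1 :=
      frullaniHigh_anti hx.le (by simpa using h)
    have := frullani_of_le x one_pos h
    rw [ENNReal.ofReal_one, div_one] at this
    rw [abs_of_nonneg (Real.log_nonneg h)]
    calc _ ≤ (frullaniLow x 1 + frullaniHigh x (ENNReal.ofReal s) + ENNReal.ofReal (Real.log s)) +
          frullaniHigh x 1 := add_le_add (le_self_add.trans this.le) h4
      _ ≤ (frullaniLow x 1 + frullaniHigh x 1 + ENNReal.ofReal (Real.log s)) +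
          frullaniHigh x 1 := by gcongr
      _ ≤ (frullaniLow x 1 + frullaniHigh x 1 + ENNReal.ofReal (Real.log s)) +
          (frullaniLow x 1 + frullaniHigh x 1) := by gcongr; exact le_add_self
      _ = _ := by ring
  · have h4 : frullaniLow x (ENNReal.ofReal s) ≤ frullaniLow x 1 :=
      frullaniLow_mono hx.le (by simpa using h)
    have := frullani_of_le x hs h
    rw [ENNReal.ofReal_one, one_div, Real.log_inv] at this
    rw [abs_of_nonpos (Real.log_nonpos hs.le h)]
    calc _ ≤ frullaniLow x 1 + (frullaniLow x (ENNReal.ofReal s) + frullaniHigh x 1 +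
            ENNReal.ofReal (-Real.log s)) := add_le_add h4 (le_add_self.trans this.le)
      _ ≤ frullaniLow x 1 + (frullaniLow x 1 + frullaniHigh x 1 +
            ENNReal.ofReal (-Real.log s)) := by gcongr
      _ ≤ (frullaniLow x 1 + frullaniHigh x 1) + (frullaniLow x 1 + frullaniHigh x 1 +
            ENNReal.ofReal (-Real.log s)) := by gcongr; exact le_self_add
      _ = _ := by ring

/-- By Tonelli the mean is an integral of the Laplace transform against `dl/l`, and the Laplace
transforms agree for each `l > 0`. -/
theorem lintegral_frullaniLow_of_laplace {Ω E : Type*} [MeasurableSpace Ω] [MeasurableSpace E]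
    {P : Measure Ω} [IsProbabilityMeasure P] {ν : Measure E} [IsProbabilityMeasure ν]
    {S : Ω → ℝ≥0∞} (hS : Measurable S) {W : E → ℝ≥0∞} (hW' : Measurable W) {x : ℝ}
    (hL : ∀ l : ℝ, 0 < l → ∫⁻ ω, nexp (ENNReal.ofReal l * S ω) ∂P =
      ∫⁻ y, nexp ((ENNReal.ofReal l * W y) ^ x) ∂ν) :
    ∫⁻ ω, frullaniLow 1 (S ω) ∂P = ∫⁻ y, frullaniLow x (W y) ∂ν := by
  have hm1 : ∀ y : ℝ, Measurable fun p : Ω × ℝ => nexp ((ENNReal.ofReal p.2 * S p.1) ^ y) :=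
    fun y => nexp_measurable.comp (Measurable.pow_const (by fun_prop) y)
  have hm2 : Measurable fun p : E × ℝ => nexp ((ENNReal.ofReal p.2 * W p.1) ^ x) :=
    nexp_measurable.comp (Measurable.pow_const (by fun_prop) x)
  unfold frullaniLow
  rw [lintegral_lintegral_swap (μ := P) ((hm1 1).const_sub 1).aemeasurable,
    lintegral_lintegral_swap (μ := ν) (hm2.const_sub 1).aemeasurable]
  apply setLIntegral_congr_fun measurableSet_Ioc
  intro l hl
  simp only [ENNReal.rpow_one]
  rw [lintegral_sub, lintegral_sub, hL l hl.1]
  · simp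
  · exact nexp_measurable.comp (Measurable.pow_const (by fun_prop) x)
  · exact ne_top_of_le_ne_top (by simp) (lintegral_mono (g := fun _ => 1) fun y => nexp_le_one _)
  · exact ae_of_all _ fun _ => nexp_le_one _
  · exact nexp_measurable.comp (measurable_const.mul hS)
  · exact ne_top_of_le_ne_top (by simp) (lintegral_mono (g := fun _ => 1) fun y => nexp_le_one _)
  · exact ae_of_all _ fun _ => nexp_le_one _

theorem lintegral_frullaniHigh_of_laplace {Ω E : Type*} [MeasurableSpace Ω] [MeasurableSpace E]
    {P : Measure Ω} [IsProbabilityMeasure P] {ν : Measure E} [IsProbabilityMeasure ν]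
    {S : Ω → ℝ≥0∞} (hS : Measurable S) {W : E → ℝ≥0∞} (hW' : Measurable W) {x : ℝ}
    (hL : ∀ l : ℝ, 0 < l → ∫⁻ ω, nexp (ENNReal.ofReal l * S ω) ∂P =
      ∫⁻ y, nexp ((ENNReal.ofReal l * W y) ^ x) ∂ν) :
    ∫⁻ ω, frullaniHigh 1 (S ω) ∂P = ∫⁻ y, frullaniHigh x (W y) ∂ν := by
  have hm1 : ∀ y : ℝ, Measurable fun p : Ω × ℝ => nexp ((ENNReal.ofReal p.2 * S p.1) ^ y) :=
    fun y => nexp_measurable.comp (Measurable.pow_const (by fun_prop) y)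
  have hm2 : Measurable fun p : E × ℝ => nexp ((ENNReal.ofReal p.2 * W p.1) ^ x) :=
    nexp_measurable.comp (Measurable.pow_const (by fun_prop) x)
  unfold frullaniHigh
  rw [lintegral_lintegral_swap (μ := P) (hm1 1).aemeasurable,
    lintegral_lintegral_swap (μ := ν) hm2.aemeasurable]
  apply setLIntegral_congr_fun measurableSet_Ioi
  intro l hl
  simp only [ENNReal.rpow_one]
  exact hL l (one_pos.trans hl)

/-- A random sum whose Laplace transform is a mixture of `exp (-(λ W)^x)` is almost surely positive
and finite, its logarithm is integrable, and the mean of its logarithm is that of `W`, up to a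
constant that depends only on `x`. -/
theorem integral_log_of_laplace {Ω E : Type*} [MeasurableSpace Ω] [MeasurableSpace E]
    {P : Measure Ω} [IsProbabilityMeasure P] {ν : Measure E} [IsProbabilityMeasure ν]
    {S : Ω → ℝ≥0∞} (hS : Measurable S) {W : E → ℝ} (hW : Measurable W) (hW0 : ∀ y, 0 < W y)
    (hWi : Integrable (fun y => Real.log (W y)) ν) {x : ℝ} (hx : 0 < x)
    (hL : ∀ l : ℝ, 0 < l → ∫⁻ ω, nexp (ENNReal.ofReal l * S ω) ∂P =
      ∫⁻ y, nexp ((ENNReal.ofReal l * ENNReal.ofReal (W y)) ^ x) ∂ν) :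
    (∀ᵐ ω ∂P, 0 < S ω ∧ S ω ≠ ∞) ∧ Integrable (fun ω => Real.log (S ω).toReal) P ∧
      ∫ ω, Real.log (S ω).toReal ∂P =
        ∫ y, Real.log (W y) ∂ν + (frullaniConst x - frullaniConst 1) := by
  have hW' : Measurable fun y => ENNReal.ofReal (W y) := hW.ennreal_ofReal
  have hlow := lintegral_frullaniLow_of_laplace hS hW' hL
  have hhigh := lintegral_frullaniHigh_of_laplace hS hW' hL
  have hmlow : Measurable fun y => frullaniLow x (ENNReal.ofReal (W y)) :=
    (frullaniLow_measurable x).comp hW'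
  have hmhigh : Measurable fun y => frullaniHigh x (ENNReal.ofReal (W y)) :=
    (frullaniHigh_measurable x).comp hW'
  have hbound : ∫⁻ y, (frullaniLow x (ENNReal.ofReal (W y)) +
      frullaniHigh x (ENNReal.ofReal (W y))) ∂ν ≠ ∞ := by
    refine ne_top_of_le_ne_top ?_ (lintegral_mono fun y => frullani_le hx (hW0 y))
    rw [lintegral_add_right _ measurable_const]
    refine ENNReal.add_ne_top.2 ⟨?_, ?_⟩
    · have := hWi.hasFiniteIntegral.ne
      simp_rw [← ofReal_norm, Real.norm_eq_abs] at this
      exact this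
    · simp [frullaniLow_one_ne_top hx, frullaniHigh_one_ne_top hx, ENNReal.mul_eq_top]
  rw [lintegral_add_right _ hmhigh, ENNReal.add_ne_top] at hbound
  obtain ⟨hb1, hb2⟩ := hbound
  have hSlow : Measurable fun ω => frullaniLow 1 (S ω) := (frullaniLow_measurable 1).comp hS
  have hShigh : Measurable fun ω => frullaniHigh 1 (S ω) := (frullaniHigh_measurable 1).comp hS
  have hlowae := ae_lt_top hSlow (hlow ▸ hb1)
  have hhighae := ae_lt_top hShigh (hhigh ▸ hb2)
  have hpos : ∀ᵐ ω ∂P, 0 < S ω ∧ S ω ≠ ∞ := by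
    filter_upwards [hlowae, hhighae] with ω h1 h2
    refine ⟨pos_iff_ne_zero.2 fun h => ?_, fun h => ?_⟩
    · rw [h, frullaniHigh_zero one_pos] at h2; exact lt_irrefl _ h2
    · rw [h, frullaniLow_top one_pos] at h1; exact lt_irrefl _ h1
  have hid : ∀ᵐ ω ∂P, Real.log (S ω).toReal = (frullaniLow 1 (S ω)).toReal -
      (frullaniHigh 1 (S ω)).toReal - frullaniConst 1 := by
    filter_upwards [hpos] with ω h
    have := frullani_log one_pos (ENNReal.toReal_pos h.1.ne' h.2)
    rw [ENNReal.ofReal_toReal h.2] at this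
    linarith
  have i1 := integrable_toReal_of_lintegral_ne_top hSlow.aemeasurable (hlow ▸ hb1)
  have i2 := integrable_toReal_of_lintegral_ne_top hShigh.aemeasurable (hhigh ▸ hb2)
  refine ⟨hpos, ((i1.sub i2).sub (integrable_const _)).congr (hid.mono fun ω h => h.symm), ?_⟩
  have j1 := integrable_toReal_of_lintegral_ne_top hmlow.aemeasurable hb1
  have j2 := integrable_toReal_of_lintegral_ne_top hmhigh.aemeasurable hb2
  have hW2 : ∀ y, Real.log (W y) = (frullaniLow x (ENNReal.ofReal (W y))).toReal -
      (frullaniHigh x (ENNReal.ofReal (W y))).toReal - frullaniConst x := fun y => by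
    have := frullani_log hx (hW0 y)
    linarith
  rw [integral_congr_ae hid, integral_sub (by exact i1.sub i2) (integrable_const _), integral_sub i1 i2,
    integral_congr_ae (ae_of_all _ hW2), integral_sub (by exact j1.sub j2) (integrable_const _),
    integral_sub j1 j2, integral_toReal hSlow.aemeasurable hlowae,
    integral_toReal hShigh.aemeasurable hhighae,
    integral_toReal hmlow.aemeasurable (ae_lt_top hmlow hb1),
    integral_toReal hmhigh.aemeasurable (ae_lt_top hmhigh hb2), hlow, hhigh]
  simp

end RPC
end

noncomputable section

namespace RPC

/-! ### Random weights on the tree of finite sequences -/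

/-- The root and the vertices of the form `j :: v` are disjoint sets of coordinates of a product
measure. -/
theorem indepFun_root_subtrees {X : Type*} [MeasurableSpace X] (ρ : List ℕ → Measure X)
    [∀ v, IsProbabilityMeasure (ρ v)] :
    IndepFun (fun w : List ℕ → X => w []) (fun w j v => w (j :: v)) (Measure.infinitePi ρ) := by
  have h : iIndepFun (fun v (w : List ℕ → X) => w v) (Measure.infinitePi ρ) :=
    iIndepFun_infinitePi (X := fun _ x => x) fun _ => measurable_id
  have h2 := indep_iSup_of_disjoint
    (fun v => (measurable_pi_apply v : Measurable fun w : List ℕ → X => w v).comap_le) h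
    (S := {[]}) (T := {v | v ≠ []}) (by simp)
  rw [IndepFun_iff_Indep]
  refine indep_of_indep_of_le_right (indep_of_indep_of_le_left h2 ?_) ?_
  · simp
  · simp_rw [MeasurableSpace.pi, MeasurableSpace.comap_iSup, MeasurableSpace.comap_comp]
    refine iSup_le fun j => iSup_le fun v => ?_
    exact le_iSup₂_of_le (j :: v) (by simp) le_rfl

/-- Self-similarity of product measures on the tree: root and subtrees separate, and the subtrees
carry independent product measures of the same type. This drives the recursion over the depth. -/
theorem map_root_subtrees {X : Type*} [MeasurableSpace X] (ρ : List ℕ → Measure X)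
    [∀ v, IsProbabilityMeasure (ρ v)] :
    (Measure.infinitePi ρ).map (fun w => (w [], fun j v => w (j :: v))) =
      (ρ []).prod (Measure.infinitePi fun j => Measure.infinitePi fun v => ρ (j :: v)) := by
  have hm : Measurable (fun (w : List ℕ → X) (j : ℕ) v => w (j :: v)) := by fun_prop
  rw [(indepFun_iff_map_prod_eq_prod_map_map (measurable_pi_apply _).aemeasurable
    hm.aemeasurable).1 (indepFun_root_subtrees ρ), Measure.infinitePi_map_eval]
  congr 1
  have hinj : Function.Injective fun p : ℕ × List ℕ => p.1 :: p.2 := fun p q h => by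
    simpa [Prod.ext_iff] using h
  rw [← Measure.infinitePi_map_curry (fun j v => ρ (j :: v)),
    ← Measure.map_infinitePi_infinitePi_of_inj (P := ρ) hinj, Measure.map_map]
  · rfl
  · fun_prop
  · fun_prop

theorem lintegral_root_subtrees {X : Type*} [MeasurableSpace X] (ρ : List ℕ → Measure X)
    [∀ v, IsProbabilityMeasure (ρ v)] {F : X → (ℕ → List ℕ → X) → ℝ≥0∞}
    (hF : Measurable (Function.uncurry F)) :
    ∫⁻ w, F (w []) (fun j v => w (j :: v)) ∂(Measure.infinitePi ρ) =
      ∫⁻ a, ∫⁻ b, F a b ∂(Measure.infinitePi fun j => Measure.infinitePi fun v => ρ (j :: v))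
        ∂(ρ []) := by
  refine Eq.trans ?_ (lintegral_prod (Function.uncurry F) hF.aemeasurable)
  rw [← map_root_subtrees, lintegral_map hF (by fun_prop)]
  rfl

/-! ### The cascade recursion for Laplace transforms -/

section Tree

variable {E : Type*} [MeasurableSpace E] [AddMonoid E] [MeasurableAdd₂ E]

/-- The weighted sum `∑_α ξ_α U(φ_α)` over the leaves of the tree of depth `k`, where `ζ v` are the
points at the vertex `v` and `φ` is the sum of `y` and of the marks `G` along the path. -/
def treeSum (U : E → ℝ≥0∞) : ℕ → (List ℕ → ℕ → ℝ) → (List ℕ → E) → E → ℝ≥0∞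
  | 0, _, G, y => U (y + G [])
  | k + 1, ζ, G, y => ∑' j, ENNReal.ofReal (ζ [] j) *
      treeSum U k (fun v => ζ (j :: v)) (fun v => G (j :: v)) (y + G [])

/-- The iterated `L^x` norms of `U`. -/
def treeNorm (U : E → ℝ≥0∞) : ℕ → (ℕ → ℝ) → (ℕ → Measure E) → E → ℝ≥0∞
  | 0, _, _, y => U y
  | k + 1, x, γ, y => (∫⁻ g, treeNorm U k (fun l => x (l + 1)) (fun l => γ (l + 1)) (y + g) ^ x 0
      ∂(γ 1)) ^ (x 0)⁻¹

/-- The constant in the Laplace transform of `treeSum`. -/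
def treeConst : ℕ → (ℕ → ℝ) → ℝ≥0∞
  | 0, _ => 1
  | k + 1, x => levyConst (x 0) (x 1) (treeConst k fun l => x (l + 1))

/-- A law of random sequences that has the Laplace functional of REM(`x`). -/
def IsREMLaw (ρ : Measure (ℕ → ℝ)) (x : ℝ) : Prop :=
  ∀ h : ℝ → ℝ≥0∞, Measurable h → (∀ t, h t ≤ 1) →
    ∫⁻ z, infProd (fun j => h (z j)) ∂ρ = nexp (∫⁻ t, (1 - h t) ∂(remIntensity x))

theorem treeSum_measurable {U : E → ℝ≥0∞} (hU : Measurable U) (k : ℕ) :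
    Measurable fun p : (List ℕ → ℕ → ℝ) × (List ℕ → E) × E => treeSum U k p.1 p.2.1 p.2.2 := by
  induction k with
  | zero => exact hU.comp (by fun_prop)
  | succ k ih =>
    refine Measurable.tsum fun j => Measurable.mul (by fun_prop) ?_
    exact ih.comp (f := fun p : (List ℕ → ℕ → ℝ) × (List ℕ → E) × E =>
      ((fun v => p.1 (j :: v)), (fun v => p.2.1 (j :: v)), p.2.2 + p.2.1 [])) (by fun_prop)

theorem treeNorm_measurable {U : E → ℝ≥0∞} (hU : Measurable U) (k : ℕ) (x : ℕ → ℝ)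
    (γ : ℕ → Measure E) [∀ l, IsProbabilityMeasure (γ l)] : Measurable (treeNorm U k x γ) := by
  induction k generalizing x γ with
  | zero => exact hU
  | succ k ih =>
    have h := (ih (fun l => x (l + 1)) (fun l => γ (l + 1))).comp
      (measurable_fst.add measurable_snd : Measurable fun p : E × E => p.1 + p.2)
    exact (Measurable.lintegral_prod_right' (ν := γ 1) (h.pow_const (x 0))).pow_const _

theorem treeConst_ne_zero (k : ℕ) {x : ℕ → ℝ} (hx : ∀ l < k, 0 < x l) : treeConst k x ≠ 0 := by
  induction k generalizing x with
  | zero => simp [treeConst]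
  | succ k ih => exact levyConst_ne_zero _ (hx 0 (by omega)) (ih fun l hl => hx _ (by omega))

theorem treeConst_ne_top (k : ℕ) {x : ℕ → ℝ} (hx : ∀ l < k, 0 < x l)
    (hm : ∀ l < k, x l < x (l + 1)) : treeConst k x ≠ ∞ := by
  induction k generalizing x with
  | zero => simp [treeConst]
  | succ k ih =>
    exact levyConst_ne_top (hx 0 (by omega)) (hm 0 (by omega))
      (ih (fun l hl => hx _ (by omega)) fun l hl => hm _ (by omega))

theorem remIntensity_univ {x : ℝ} (hx : 0 < x) : remIntensity x Set.univ = ∞ := by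
  refine ENNReal.eq_top_of_forall_nnreal_le fun r => ?_
  have hr : (0 : ℝ) < r + 1 := by positivity
  have ha : 0 < ((r : ℝ) + 1) ^ (-x⁻¹) := Real.rpow_pos_of_pos hr _
  refine le_trans ?_ (measure_mono (Set.subset_univ (Set.Ioi (((r : ℝ) + 1) ^ (-x⁻¹)))))
  rw [remIntensity_eq hx.le, Measure.smul_apply, powerMeasure_Ioi hx ha, smul_eq_mul,
    ← ENNReal.ofReal_mul hx.le, ← Real.rpow_mul hr.le, neg_mul_neg, inv_mul_cancel₀ hx.ne',
    Real.rpow_one, mul_div_cancel₀ _ hx.ne', ← ENNReal.ofReal_coe_nnreal]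
  exact ENNReal.ofReal_le_ofReal (by linarith)

/-- Scaling pulls `a` out of the integral. The value `a = ∞` must be allowed because the iterated
norms live in `[0,∞]`; there both sides are `∞`, as the intensity has infinite total mass and `c ≠
0`. -/
theorem lintegral_one_sub_nexp_rpow {x y : ℝ} (hx : 0 < x) (hy : 0 < y) {c : ℝ≥0∞} (hc : c ≠ 0)
    (a : ℝ≥0∞) :
    ∫⁻ t, (1 - nexp (c * (a * ENNReal.ofReal t) ^ y)) ∂(remIntensity x) =
      a ^ x * levyConst x y c := by
  have hφ : Measurable fun s : ℝ≥0∞ => 1 - nexp (c * s ^ y) :=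
    (nexp_measurable.comp (measurable_const.mul (measurable_id.pow_const y))).const_sub 1
  rcases eq_or_ne a ∞ with rfl | ha
  · rw [ENNReal.top_rpow_of_pos hx, ENNReal.top_mul (levyConst_ne_zero y hx hc),
      ← remIntensity_univ hx, ← lintegral_one]
    refine lintegral_congr_ae ?_
    have h0 : ∀ᵐ t ∂(remIntensity x), 0 < t :=
      (withDensity_absolutelyContinuous _ _).ae_le (ae_restrict_mem measurableSet_Ioi)
    filter_upwards [h0] with t ht
    rw [lintegral_one, remIntensity_univ hx, ENNReal.top_mul (by simpa using ht),
      ENNReal.top_rpow_of_pos hy, ENNReal.mul_top hc, nexp_top, tsub_zero]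
  · exact lintegral_remIntensity_comp_mul hx ha hφ (by simp [ENNReal.zero_rpow_of_pos hy])

/-- The Laplace transform of the weighted sum over the leaves of a tree. -/
theorem laplace_treeSum {U : E → ℝ≥0∞} (hU : Measurable U) (k : ℕ) {x : ℕ → ℝ}
    {γ : ℕ → Measure E} [∀ l, IsProbabilityMeasure (γ l)] {ρ : List ℕ → Measure (ℕ → ℝ)}
    [∀ v, IsProbabilityMeasure (ρ v)] (hx : ∀ l ≤ k, 0 < x l) (hx1 : x k = 1)
    (hρ : ∀ v, v.length < k → IsREMLaw (ρ v) (x v.length)) (y : E) (a : ℝ≥0∞) :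
    ∫⁻ ζ, ∫⁻ G, nexp (a * treeSum U k ζ G y) ∂(Measure.infinitePi fun v => γ v.length)
      ∂(Measure.infinitePi ρ) =
    ∫⁻ g, nexp (treeConst k x * (a * treeNorm U k x γ (y + g)) ^ x 0) ∂(γ 0) := by
  induction k generalizing x γ ρ y a with
  | zero =>
    simp only [treeSum, treeConst, treeNorm, hx1, one_mul, ENNReal.rpow_one, lintegral_const,
      measure_univ, mul_one]
    have hm : Measurable fun g => nexp (a * U (y + g)) :=
      nexp_measurable.comp (measurable_const.mul (hU.comp (measurable_const_add y)))
    have h := Measure.infinitePi_map_eval (fun v : List ℕ => γ v.length) []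
    simp only [List.length_nil] at h
    rw [← h, lintegral_map hm (measurable_pi_apply _)]
  | succ k ih =>
    let γ' : ℕ → Measure E := fun l => γ (l + 1)
    let ΓE : Measure (List ℕ → E) := Measure.infinitePi fun v => γ' v.length
    let e : (List ℕ → ℕ → ℝ) → (List ℕ → E) → E → ℝ → ℝ≥0∞ := fun ζ G y t =>
      nexp (a * (ENNReal.ofReal t * treeSum U k ζ G y))
    have he1 : ∀ ζ G y t, e ζ G y t ≤ 1 := fun _ _ _ _ => nexp_le_one _
    have hem : Measurable fun p : (List ℕ → ℕ → ℝ) × (List ℕ → E) × E × ℝ =>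
        e p.1 p.2.1 p.2.2.1 p.2.2.2 := by
      refine nexp_measurable.comp (measurable_const.mul (Measurable.mul (by fun_prop) ?_))
      exact (treeSum_measurable hU k).comp (f := fun p : (List ℕ → ℕ → ℝ) × (List ℕ → E) × E × ℝ =>
        (p.1, p.2.1, p.2.2.1)) (by fun_prop)
    have hsum : ∀ ζ G, nexp (a * treeSum U (k + 1) ζ G y) =
        infProd fun j => e (fun v => ζ (j :: v)) (fun v => G (j :: v)) (y + G []) (ζ [] j) := by
      intro ζ G
      rw [treeSum, ← ENNReal.tsum_mul_left, nexp_tsum]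
    simp_rw [hsum]
    -- integrate out the marks of the subtrees
    have step1 : ∀ ζ : List ℕ → ℕ → ℝ,
        ∫⁻ G, infProd (fun j => e (fun v => ζ (j :: v)) (fun v => G (j :: v)) (y + G []) (ζ [] j))
          ∂(Measure.infinitePi fun v : List ℕ => γ v.length) =
        ∫⁻ g, infProd (fun j => ∫⁻ G, e (fun v => ζ (j :: v)) G (y + g) (ζ [] j) ∂ΓE) ∂(γ 0) := by
      intro ζ
      rw [lintegral_root_subtrees (fun v : List ℕ => γ v.length)
        (F := fun g G => infProd fun j => e (fun v => ζ (j :: v)) (G j) (y + g) (ζ [] j))]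
      · refine lintegral_congr fun g => ?_
        exact lintegral_infProd_infinitePi (fun _ => ΓE)
          (a := fun j G => e (fun v => ζ (j :: v)) G (y + g) (ζ [] j))
          (fun j => hem.comp (f := fun G => (_, G, _, _)) (by fun_prop)) (fun j G => he1 _ _ _ _)
      · refine infProd_measurable fun j => ?_
        exact hem.comp (f := fun p : E × (ℕ → List ℕ → E) =>
          ((fun v => ζ (j :: v)), p.2 j, y + p.1, ζ [] j)) (by fun_prop)
    simp_rw [step1]
    let e2 : (List ℕ → ℕ → ℝ) → E → ℝ → ℝ≥0∞ := fun ζ y t => ∫⁻ G, e ζ G y t ∂ΓE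
    have he2m : Measurable fun p : (List ℕ → ℕ → ℝ) × E × ℝ => e2 p.1 p.2.1 p.2.2 := by
      refine Measurable.lintegral_prod_right' (ν := ΓE)
        (f := fun q : ((List ℕ → ℕ → ℝ) × E × ℝ) × (List ℕ → E) => e q.1.1 q.2 q.1.2.1 q.1.2.2) ?_
      exact hem.comp (f := fun q : ((List ℕ → ℕ → ℝ) × E × ℝ) × (List ℕ → E) =>
        (q.1.1, q.2, q.1.2.1, q.1.2.2)) (by fun_prop)
    have he21 : ∀ ζ y t, e2 ζ y t ≤ 1 := fun ζ y t =>
      (lintegral_mono fun G => he1 ζ G y t).trans (by simp)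
    change ∫⁻ ζ, ∫⁻ g, infProd (fun j => e2 (fun v => ζ (j :: v)) (y + g) (ζ [] j)) ∂(γ 0)
      ∂(Measure.infinitePi ρ) = _
    -- The root mark `g` is shared by all subtrees, so it is kept fixed while the subtrees,
    -- independent given `g`, are integrated out.
    rw [lintegral_lintegral_swap]
    swap
    · refine Measurable.aemeasurable (infProd_measurable fun j => ?_)
      exact he2m.comp (f := fun p : (List ℕ → ℕ → ℝ) × E =>
        ((fun v => p.1 (j :: v)), y + p.2, p.1 [] j)) (by fun_prop)
    refine lintegral_congr fun g => ?_
    rw [lintegral_root_subtrees ρ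
      (F := fun z ζ => infProd fun j => e2 (ζ j) (y + g) (z j))]
    swap
    · refine infProd_measurable fun j => ?_
      exact he2m.comp (f := fun p : (ℕ → ℝ) × (ℕ → List ℕ → ℕ → ℝ) =>
        (p.2 j, y + g, p.1 j)) (by fun_prop)
    -- integrate out the points of the subtrees
    let c := treeConst k fun l => x (l + 1)
    let Y := treeNorm U k (fun l => x (l + 1)) γ'
    have hYm : Measurable Y := treeNorm_measurable hU k _ γ'
    let h : ℝ → ℝ≥0∞ := fun t => ∫⁻ g', nexp (c * ((a * ENNReal.ofReal t) * Y (y + g + g')) ^ x 1)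
      ∂(γ 1)
    have hmj : Measurable fun p : ℝ × E =>
        nexp (c * ((a * ENNReal.ofReal p.1) * Y (y + g + p.2)) ^ x 1) := by
      refine nexp_measurable.comp (measurable_const.mul (Measurable.pow_const ?_ _))
      exact Measurable.mul (by fun_prop) (hYm.comp (by fun_prop))
    have hhm : Measurable h := Measurable.lintegral_prod_right' (ν := γ 1) hmj
    have hh1 : ∀ t, h t ≤ 1 := fun t =>
      (lintegral_mono fun g' => nexp_le_one _).trans (by simp)
    have step2 : ∀ z : ℕ → ℝ, ∫⁻ ζ, infProd (fun j => e2 (ζ j) (y + g) (z j))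
        ∂(Measure.infinitePi fun j => Measure.infinitePi fun v => ρ (j :: v)) =
        infProd fun j => h (z j) := by
      intro z
      refine (lintegral_infProd_infinitePi (fun j => Measure.infinitePi fun v => ρ (j :: v))
        (a := fun j ζ => e2 ζ (y + g) (z j))
        (fun j => he2m.comp (f := fun ζ => (ζ, _, _)) (by fun_prop))
        (fun j ζ => he21 _ _ _)).trans ?_
      congr 1
      ext j
      have := ih (x := fun l => x (l + 1)) (γ := γ') (ρ := fun v => ρ (j :: v))
        (fun l hl => hx _ (by omega)) hx1 (fun v hv => hρ (j :: v) (by simpa using hv)) (y + g)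
        (a * ENNReal.ofReal (z j))
      simp_rw [mul_assoc a] at this
      simp only [e2, e, h, ΓE, mul_assoc a]
      exact this
    simp_rw [step2]
    have hx0 := hx 0 (by omega)
    -- What remains is a product over the points at the root, which the Laplace functional of the
    -- REM evaluates.
    rw [hρ [] (by simp) h hhm hh1]
    -- evaluate the exponent
    have step3 : ∀ t, 1 - h t =
        ∫⁻ g', (1 - nexp (c * ((a * Y (y + g + g')) * ENNReal.ofReal t) ^ x 1)) ∂(γ 1) := by
      intro t
      have hsw : ∀ g', a * Y (y + g + g') * ENNReal.ofReal t =
          a * ENNReal.ofReal t * Y (y + g + g') := fun g' => by ring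
      simp_rw [hsw]
      rw [lintegral_sub (by exact hmj.comp (f := fun g' => (t, g')) (by fun_prop))
        (ne_top_of_le_ne_top ENNReal.one_ne_top (hh1 t)) (ae_of_all _ fun _ => nexp_le_one _)]
      simp [h]
    simp only [List.length_nil]
    simp_rw [step3]
    rw [lintegral_lintegral_swap]
    swap
    · refine Measurable.aemeasurable (Measurable.const_sub ?_ 1)
      refine nexp_measurable.comp (measurable_const.mul (Measurable.pow_const ?_ _))
      exact Measurable.mul (measurable_const.mul (hYm.comp (by fun_prop))) (by fun_prop)
    have hc : c ≠ 0 := treeConst_ne_zero k fun l hl => hx _ (by omega)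
    simp_rw [lintegral_one_sub_nexp_rpow hx0 (hx 1 (by omega)) hc, ENNReal.mul_rpow_of_nonneg _ _ hx0.le]
    rw [lintegral_mul_const _ (by
      exact measurable_const.mul ((hYm.comp (measurable_const_add _)).pow_const _)),
      lintegral_const_mul _ (by exact (hYm.comp (measurable_const_add _)).pow_const _)]
    -- The power `x 0` undoes the root `1 / x 0` in the norm, and the scaling integral is by
    -- definition the constant of depth `k + 1`.
    rw [treeNorm, ← ENNReal.rpow_mul, inv_mul_cancel₀ hx0.ne', ENNReal.rpow_one, treeConst, mul_comm]

end Tree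

end RPC
end

noncomputable section

namespace RPC

/-! ### The one-step operators of the Parisi functional -/

/-- `x⁻¹ log E exp (x f(y + g))` for a centred Gaussian variable `g` of variance `v`; this is
`E f(y + g)` if `x = 0`. -/
def parisiStep (x : ℝ) (v : ℝ≥0) (f : ℝ → ℝ) (y : ℝ) : ℝ :=
  if x = 0 then ∫ g, f (y + g) ∂(gaussianReal 0 v)
  else x⁻¹ * Real.log (∫ g, Real.exp (x * f (y + g)) ∂(gaussianReal 0 v))

theorem integrable_exp_mul_abs_gaussian (c : ℝ) (v : ℝ≥0) :
    Integrable (fun g => Real.exp (c * |g|)) (gaussianReal 0 v) := by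
  have h1 := integrable_exp_mul_gaussianReal (μ := 0) (v := v) c
  have h2 := integrable_exp_mul_gaussianReal (μ := 0) (v := v) (-c)
  refine (h1.add h2).mono' (by fun_prop) (ae_of_all _ fun g => ?_)
  rw [Real.norm_eq_abs, abs_of_pos (Real.exp_pos _), Pi.add_apply]
  rcases abs_cases g with h | h
  · rw [h.1]; linarith [Real.exp_pos (-c * g)]
  · rw [h.1, mul_neg, neg_mul]; linarith [Real.exp_pos (c * g)]

section Lipschitz

variable {f h : ℝ → ℝ} {K K' : ℝ≥0}

theorem LipschitzWith.abs_sub_le_mul (hf : LipschitzWith K f) (y g : ℝ) :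
    |f (y + g) - f y| ≤ K * |g| := by
  have := hf.dist_le_mul (y + g) y
  rwa [Real.dist_eq, Real.dist_eq, add_sub_cancel_left] at this

theorem LipschitzWith.integrable_exp_gaussian (hf : LipschitzWith K f) (x y : ℝ) (v : ℝ≥0) :
    Integrable (fun g => Real.exp (x * f (y + g))) (gaussianReal 0 v) := by
  have hc := hf.continuous
  refine ((integrable_exp_mul_abs_gaussian (|x| * K) v).const_mul (Real.exp (x * f y))).mono'
    (by fun_prop) (ae_of_all _ fun g => ?_)
  rw [Real.norm_eq_abs, abs_of_pos (Real.exp_pos _), ← Real.exp_add, Real.exp_le_exp]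
  have h1 := LipschitzWith.abs_sub_le_mul hf y g
  have h2 : x * (f (y + g) - f y) ≤ |x| * (K * |g|) :=
    (le_abs_self _).trans (by rw [abs_mul]; gcongr)
  linarith

theorem integrable_abs_gaussian (v : ℝ≥0) : Integrable (fun g => |g|) (gaussianReal 0 v) :=
  (integrable_exp_mul_abs_gaussian 1 v).mono' (by fun_prop) (ae_of_all _ fun g => by
    rw [Real.norm_eq_abs, abs_abs, one_mul]
    linarith [Real.add_one_le_exp |g|])

theorem LipschitzWith.integrable_gaussian (hf : LipschitzWith K f) (y : ℝ) (v : ℝ≥0) :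
    Integrable (fun g => f (y + g)) (gaussianReal 0 v) := by
  have hc := hf.continuous
  refine ((integrable_const |f y|).add ((integrable_abs_gaussian v).const_mul K)).mono'
    (by fun_prop) (ae_of_all _ fun g => ?_)
  have h1 := LipschitzWith.abs_sub_le_mul hf y g
  have h2 := abs_sub_abs_le_abs_sub (f (y + g)) (f y)
  rw [Real.norm_eq_abs, Pi.add_apply]
  linarith

theorem LipschitzWith.integral_exp_pos (hf : LipschitzWith K f) (x y : ℝ) (v : ℝ≥0) :
    0 < ∫ g, Real.exp (x * f (y + g)) ∂(gaussianReal 0 v) :=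
  MeasureTheory.integral_exp_pos (LipschitzWith.integrable_exp_gaussian hf x y v)

/-- The operator is monotone and commutes with adding constants. Comparing two functions at two base
points at once yields Lipschitz bounds, the sup-norm contraction and preservation of lower bounds as
special cases. -/
theorem parisiStep_le_add (hf : LipschitzWith K f) (hh : LipschitzWith K' h) {x : ℝ} (hx : 0 ≤ x)
    (v : ℝ≥0) {y y' D : ℝ} (hle : ∀ g, f (y + g) ≤ h (y' + g) + D) :
    parisiStep x v f y ≤ parisiStep x v h y' + D := by
  unfold parisiStep
  split_ifs with h0
  · have h1 := LipschitzWith.integrable_gaussian hh y' v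
    calc _ ≤ ∫ g, (h (y' + g) + D) ∂(gaussianReal 0 v) :=
          integral_mono (LipschitzWith.integrable_gaussian hf y v) (h1.add (integrable_const D)) hle
      _ = _ := by rw [integral_add h1 (integrable_const D)]; simp
  · have hxp : 0 < x := lt_of_le_of_ne hx (Ne.symm h0)
    have i1 := LipschitzWith.integrable_exp_gaussian hf x y v
    have i2 := LipschitzWith.integrable_exp_gaussian hh x y' v
    have p2 := LipschitzWith.integral_exp_pos hh x y' v
    have h1 : ∫ g, Real.exp (x * f (y + g)) ∂(gaussianReal 0 v) ≤
        Real.exp (x * D) * ∫ g, Real.exp (x * h (y' + g)) ∂(gaussianReal 0 v) := by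
      rw [← integral_const_mul]
      refine integral_mono i1 (i2.const_mul _) fun g => ?_
      simp only
      rw [← Real.exp_add, Real.exp_le_exp]
      nlinarith [hle g]
    have h2 := Real.log_le_log (LipschitzWith.integral_exp_pos hf x y v) h1
    rw [Real.log_mul (Real.exp_pos _).ne' p2.ne', Real.log_exp] at h2
    calc _ ≤ x⁻¹ * (x * D + Real.log (∫ g, Real.exp (x * h (y' + g)) ∂(gaussianReal 0 v))) := by
          gcongr
      _ = _ := by field_simp; ring

theorem parisiStep_lipschitz (hf : LipschitzWith K f) {x : ℝ} (hx : 0 ≤ x) (v : ℝ≥0) :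
    LipschitzWith K (parisiStep x v f) := by
  refine LipschitzWith.of_le_add_mul K fun y y' => parisiStep_le_add hf hf hx v fun g => ?_
  have := hf.le_add_mul (y + g) (y' + g)
  rwa [dist_add_right] at this

theorem parisiStep_abs_sub_le (hf : LipschitzWith K f) (hh : LipschitzWith K' h) {x : ℝ}
    (hx : 0 ≤ x) (v : ℝ≥0) {D : ℝ} (hD : ∀ y, |f y - h y| ≤ D) (y : ℝ) :
    |parisiStep x v f y - parisiStep x v h y| ≤ D := by
  rw [abs_sub_le_iff]
  constructor
  · have := parisiStep_le_add hf hh hx v (y := y) (y' := y) (D := D) fun g => by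
      linarith [(abs_sub_le_iff.1 (hD (y + g))).1]
    linarith
  · have := parisiStep_le_add hh hf hx v (y := y) (y' := y) (D := D) fun g => by
      linarith [(abs_sub_le_iff.1 (hD (y + g))).2]
    linarith

theorem parisiStep_const (x : ℝ) (v : ℝ≥0) (c y : ℝ) : parisiStep x v (fun _ => c) y = c := by
  unfold parisiStep
  split_ifs with h0
  · simp
  · simp [h0]

theorem le_parisiStep (hf : LipschitzWith K f) {x : ℝ} (hx : 0 ≤ x) (v : ℝ≥0) {c : ℝ}
    (hc : ∀ y, c ≤ f y) (y : ℝ) : c ≤ parisiStep x v f y := by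
  have := parisiStep_le_add (LipschitzWith.const c (α := ℝ)) hf hx v (y := y) (y' := y) (D := 0)
    fun g => by simpa using hc (y + g)
  rwa [parisiStep_const, add_zero] at this

theorem parisiStep_zero (x : ℝ) (f : ℝ → ℝ) : parisiStep x 0 f = f := by
  ext y
  unfold parisiStep
  split_ifs with h0
  · simp
  · simp [h0]

theorem exp_parisiStep (hf : LipschitzWith K f) {x : ℝ} (hx : x ≠ 0) (v : ℝ≥0) (y : ℝ) :
    Real.exp (x * parisiStep x v f y) = ∫ g, Real.exp (x * f (y + g)) ∂(gaussianReal 0 v) := by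
  rw [parisiStep, if_neg hx, mul_inv_cancel_left₀ hx,
    Real.exp_log (LipschitzWith.integral_exp_pos hf x y v)]

/-- Semigroup property for a fixed parameter: Gaussian laws convolve, and the inner logarithm
cancels the outer exponential. It allows the intervals of a step function to be subdivided. -/
theorem parisiStep_add (hf : LipschitzWith K f) (x : ℝ) (v w : ℝ≥0) :
    parisiStep x v (parisiStep x w f) = parisiStep x (v + w) f := by
  have hconv : gaussianReal 0 (v + w) = (gaussianReal 0 v).conv (gaussianReal 0 w) := by
    rw [gaussianReal_conv_gaussianReal, add_zero]
  ext y
  by_cases h0 : x = 0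
  · simp only [parisiStep, if_pos h0]
    have hi := LipschitzWith.integrable_gaussian hf y (v + w)
    rw [hconv] at hi ⊢
    rw [integral_conv hi]
    simp_rw [add_assoc]
  · have hi := LipschitzWith.integrable_exp_gaussian hf x y (v + w)
    rw [parisiStep]
    simp_rw [exp_parisiStep hf h0]
    rw [if_neg h0, parisiStep, if_neg h0]
    rw [hconv] at hi ⊢
    rw [integral_conv hi]
    simp_rw [add_assoc]

/-! ### Lipschitz dependence on the parameter `x` -/

/-- A bound for the second derivative of the cumulant generating functions. -/
def cgfBound (K : ℝ≥0) : ℝ :=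
  K ^ 2 * (∫ z, z ^ 2 * Real.exp (K * |z|) ∂(gaussianReal 0 1)) /
    ∫ z, Real.exp (-K * |z|) ∂(gaussianReal 0 1)

theorem integrable_sq_mul_exp_gaussian (c : ℝ) (v : ℝ≥0) :
    Integrable (fun g => g ^ 2 * Real.exp (c * |g|)) (gaussianReal 0 v) := by
  refine ((integrable_exp_mul_abs_gaussian (c + 2) v)).mono' (by fun_prop)
    (ae_of_all _ fun g => ?_)
  rw [Real.norm_eq_abs, abs_mul, abs_of_pos (Real.exp_pos _), abs_pow, add_mul, Real.exp_add,
    mul_comm]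
  gcongr
  rw [two_mul, Real.exp_add, sq]
  have := Real.add_one_le_exp |g|
  gcongr <;> linarith

theorem cgfBound_nonneg (K : ℝ≥0) : 0 ≤ cgfBound K :=
  div_nonneg (mul_nonneg (by positivity) (integral_nonneg fun z => by positivity))
    (integral_nonneg fun z => by positivity)

theorem integral_gaussian_scale (v : ℝ≥0) {F : ℝ → ℝ} (hF : Measurable F) :
    ∫ g, F g ∂(gaussianReal 0 v) = ∫ z, F (Real.sqrt v * z) ∂(gaussianReal 0 1) := by
  have h := gaussianReal_map_const_mul (μ := 0) (v := 1) (Real.sqrt v)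
  have hv : gaussianReal 0 v = (gaussianReal 0 1).map (Real.sqrt v * ·) := by
    rw [h]
    congr 1
    · simp
    · ext; simp
  rw [hv, integral_map (by fun_prop) hF.aestronglyMeasurable]

/-- The variance is at most the tilted second moment, a quotient. Writing `g = √v z` extracts the
factor `v` from the numerator, and the denominator is bounded below by the mean of `exp (-K |z|)`,
using `v ≤ 1` and `x ∈ [0,1]`. -/
theorem variance_tilted_le {W : ℝ → ℝ} (hW : Continuous W) (hWK : ∀ g, |W g| ≤ K * |g|) {v : ℝ≥0}
    (hv : v ≤ 1) {x : ℝ} (hx0 : 0 ≤ x) (hx1 : x ≤ 1) :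
    Var[W; (gaussianReal 0 v).tilted fun g => x * W g] ≤ cgfBound K * v := by
  have hxW : ∀ g, |x * W g| ≤ K * |g| := fun g => by
    rw [abs_mul, abs_of_nonneg hx0]
    exact (mul_le_of_le_one_left (abs_nonneg _) hx1).trans (hWK g)
  have hie : Integrable (fun g => Real.exp (x * W g)) (gaussianReal 0 v) :=
    (integrable_exp_mul_abs_gaussian K v).mono' (by fun_prop) (ae_of_all _ fun g => by
      rw [Real.norm_eq_abs, abs_of_pos (Real.exp_pos _), Real.exp_le_exp]
      exact (le_abs_self _).trans (hxW g))
  have := isProbabilityMeasure_tilted hie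
  have hs : Real.sqrt v ≤ 1 := by
    rw [Real.sqrt_le_one]; exact_mod_cast hv
  have hs0 := Real.sqrt_nonneg (v : ℝ)
  have hd0 : 0 < ∫ z, Real.exp (-K * |z|) ∂(gaussianReal 0 1) :=
    integral_exp_pos (integrable_exp_mul_abs_gaussian (-K) 1)
  have hd : ∫ z, Real.exp (-K * |z|) ∂(gaussianReal 0 1) ≤
      ∫ g, Real.exp (x * W g) ∂(gaussianReal 0 v) := by
    calc _ ≤ ∫ g, Real.exp (-K * |g|) ∂(gaussianReal 0 v) := by
          rw [integral_gaussian_scale v (by fun_prop)]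
          refine integral_mono (integrable_exp_mul_abs_gaussian (-K) 1) ?_ fun z => ?_
          · simp_rw [abs_mul, ← mul_assoc]
            exact integrable_exp_mul_abs_gaussian _ 1
          · simp only [Real.exp_le_exp, abs_mul, abs_of_nonneg hs0]
            have : Real.sqrt v * |z| ≤ |z| := mul_le_of_le_one_left (abs_nonneg _) hs
            nlinarith [K.2, mul_le_mul_of_nonneg_left this K.2]
      _ ≤ _ := by
          refine integral_mono (integrable_exp_mul_abs_gaussian (-K) v) hie fun g => ?_
          rw [Real.exp_le_exp]
          have := neg_abs_le (x * W g)
          linarith [hxW g]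
  have hn : ∫ g, Real.exp (x * W g) * W g ^ 2 ∂(gaussianReal 0 v) ≤
      K ^ 2 * (∫ z, z ^ 2 * Real.exp (K * |z|) ∂(gaussianReal 0 1)) * v := by
    have hb : ∀ g, Real.exp (x * W g) * W g ^ 2 ≤ K ^ 2 * (g ^ 2 * Real.exp (K * |g|)) := fun g => by
      have h1 : W g ^ 2 ≤ K ^ 2 * g ^ 2 := by
        rw [← sq_abs (W g), ← sq_abs g, ← mul_pow]
        exact pow_le_pow_left₀ (abs_nonneg _) (hWK g) 2
      have h2 : Real.exp (x * W g) ≤ Real.exp (K * |g|) :=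
        Real.exp_le_exp.2 ((le_abs_self _).trans (hxW g))
      calc _ ≤ Real.exp (K * |g|) * (K ^ 2 * g ^ 2) := by gcongr
        _ = _ := by ring
    calc _ ≤ ∫ g, K ^ 2 * (g ^ 2 * Real.exp (K * |g|)) ∂(gaussianReal 0 v) :=
          integral_mono_of_nonneg (ae_of_all _ fun g => by positivity)
            ((integrable_sq_mul_exp_gaussian K v).const_mul _) (ae_of_all _ hb)
      _ = K ^ 2 * ∫ z, (Real.sqrt v * z) ^ 2 * Real.exp (K * |Real.sqrt v * z|)
            ∂(gaussianReal 0 1) := by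
          rw [integral_const_mul, integral_gaussian_scale v (by fun_prop)]
      _ ≤ K ^ 2 * ∫ z, v * (z ^ 2 * Real.exp (K * |z|)) ∂(gaussianReal 0 1) := by
          refine mul_le_mul_of_nonneg_left ?_ (by positivity)
          refine integral_mono_of_nonneg (ae_of_all _ fun g => by positivity)
            ((integrable_sq_mul_exp_gaussian K 1).const_mul _) (ae_of_all _ fun z => ?_)
          simp only
          rw [mul_pow, Real.sq_sqrt (NNReal.coe_nonneg v), mul_assoc, abs_mul, abs_of_nonneg hs0]
          gcongr
          exact mul_le_of_le_one_left (abs_nonneg _) hs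
      _ = _ := by rw [integral_const_mul]; ring
  have hvar : Var[W; (gaussianReal 0 v).tilted fun g => x * W g] ≤
      (∫ g, Real.exp (x * W g) * W g ^ 2 ∂(gaussianReal 0 v)) /
        ∫ g, Real.exp (x * W g) ∂(gaussianReal 0 v) := by
    refine (variance_le_expectation_sq hW.aestronglyMeasurable).trans (le_of_eq ?_)
    rw [integral_tilted, ← integral_div]
    refine integral_congr_ae (ae_of_all _ fun g => ?_)
    simp only [Pi.pow_apply, smul_eq_mul]
    ring
  refine hvar.trans ?_
  have hn0 : 0 ≤ K ^ 2 * (∫ z, z ^ 2 * Real.exp (K * |z|) ∂(gaussianReal 0 1)) * v :=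
    mul_nonneg (mul_nonneg (by positivity) (integral_nonneg fun z => by positivity)) v.2
  rw [cgfBound, div_mul_eq_mul_div]
  exact div_le_div₀ hn0 hn hd0 hd

/-- With `W = f(y + ·) - f(y)`, the step is `f(y)` plus the mean slope of the cumulant generating
function of `W` on `[0, x]`. Its second derivative is a tilted variance. The factor `v` in the bound
is essential: summed over intervals it produces an `L¹` distance. -/
theorem parisiStep_sub_param_le (hf : LipschitzWith K f) {v : ℝ≥0} (hv : v ≤ 1) {x x' : ℝ}
    (hx : x ∈ Set.Icc (0 : ℝ) 1) (hx' : x' ∈ Set.Icc (0 : ℝ) 1) (y : ℝ) :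
    |parisiStep x v f y - parisiStep x' v f y| ≤ cgfBound K * v * |x - x'| := by
  let W : ℝ → ℝ := fun g => f (y + g) - f y
  have hWc : Continuous W := by have := hf.continuous; fun_prop
  have hWK : ∀ g, |W g| ≤ K * |g| := fun g => LipschitzWith.abs_sub_le_mul hf y g
  let μ := gaussianReal 0 v
  have hie : ∀ x : ℝ, Integrable (fun g => Real.exp (x * W g)) μ := fun x => by
    refine ((LipschitzWith.integrable_exp_gaussian hf x y v).const_mul (Real.exp (-(x * f y)))).congr
      (ae_of_all _ fun g => ?_)
    simp only [W]
    rw [← Real.exp_add]; ring_nf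
  have hset : integrableExpSet W μ = Set.univ := Set.eq_univ_of_forall hie
  have hint : ∀ x, x ∈ interior (integrableExpSet W μ) := fun x => by simp [hset]
  have han : AnalyticOnNhd ℝ (cgf W μ) Set.univ := by
    have := analyticOnNhd_cgf (X := W) (μ := μ)
    rwa [hset, interior_univ] at this
  have hdiff : Differentiable ℝ (cgf W μ) := fun x => (han x trivial).differentiableAt
  have hdiff' : Differentiable ℝ (deriv (cgf W μ)) := fun x =>
    (han.deriv x trivial).differentiableAt
  have hd0 : deriv (cgf W μ) 0 = ∫ g, W g ∂μ := by
    rw [deriv_cgf_zero (hint 0)]; simp [μ]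
  have hlip : ∀ a ∈ Set.Icc (0 : ℝ) 1, ∀ b ∈ Set.Icc (0 : ℝ) 1,
      ‖deriv (cgf W μ) b - deriv (cgf W μ) a‖ ≤ cgfBound K * v * ‖b - a‖ := by
    intro a ha b hb
    refine (convex_Icc (0 : ℝ) 1).norm_image_sub_le_of_norm_deriv_le
      (fun t _ => hdiff' t) (fun t ht => ?_) ha hb
    have h2 := variance_tilted_mul (hint t)
    rw [iteratedDeriv_succ, iteratedDeriv_one] at h2
    rw [← h2, Real.norm_of_nonneg (variance_nonneg _ _)]
    exact variance_tilted_le hWc hWK hv ht.1 ht.2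
  -- The average slope `∫_0^1 Λ'(x s) ds`, with `Λ` the cumulant generating function, equals `Λ(x) /
  -- x` and extends it to `x = 0`, so the estimate below treats all parameters uniformly.
  have hT : ∀ x, parisiStep x v f y = f y + ∫ s in (0 : ℝ)..1, deriv (cgf W μ) (x * s) := by
    intro x
    have hfi := LipschitzWith.integrable_gaussian hf y v
    by_cases h0 : x = 0
    · rw [parisiStep, if_pos h0]
      simp only [h0, zero_mul, intervalIntegral.integral_const, sub_zero, one_smul]
      rw [hd0, integral_sub hfi (integrable_const _)]
      simp
    · rw [intervalIntegral.integral_comp_mul_left _ h0, mul_zero, mul_one,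
        intervalIntegral.integral_deriv_eq_sub (fun t _ => hdiff t)
          (hdiff'.continuous.intervalIntegrable _ _), cgf_zero, sub_zero, parisiStep, if_neg h0]
      have : ∫ g, Real.exp (x * f (y + g)) ∂(gaussianReal 0 v) = Real.exp (x * f y) * mgf W μ x := by
        rw [mgf, ← integral_const_mul]
        refine integral_congr_ae (ae_of_all _ fun g => ?_)
        simp only [W]
        rw [← Real.exp_add]; ring_nf
      rw [this, Real.log_mul (Real.exp_pos _).ne' (mgf_pos (hie x)).ne', Real.log_exp, cgf,
        smul_eq_mul]
      field_simp
  have hci : ∀ x, IntervalIntegrable (fun s => deriv (cgf W μ) (x * s)) volume 0 1 := fun x =>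
    (hdiff'.continuous.comp (continuous_const_mul x)).intervalIntegrable _ _
  rw [hT x, hT x', add_sub_add_left_eq_sub, ← intervalIntegral.integral_sub (hci x) (hci x'),
    ← Real.norm_eq_abs]
  have hc0 : 0 ≤ cgfBound K * v * |x - x'| :=
    mul_nonneg (mul_nonneg (cgfBound_nonneg K) v.2) (abs_nonneg _)
  refine (intervalIntegral.norm_integral_le_of_norm_le_const (C := cgfBound K * v * |x - x'|)
    fun s hs => ?_).trans (by simp)
  rw [Set.uIoc_of_le zero_le_one] at hs
  have hmem : ∀ x ∈ Set.Icc (0 : ℝ) 1, x * s ∈ Set.Icc (0 : ℝ) 1 := fun x hx =>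
    ⟨mul_nonneg hx.1 hs.1.le, mul_le_one₀ hx.2 hs.1.le hs.2⟩
  refine (hlip _ (hmem x' hx') _ (hmem x hx)).trans ?_
  rw [← sub_mul, norm_mul, Real.norm_eq_abs, Real.norm_eq_abs, abs_of_pos hs.1, ← mul_assoc]
  refine mul_le_of_le_one_right hc0 hs.2

end Lipschitz

end RPC
end

noncomputable section

namespace RPC

/-! ### The Parisi functional of a step function -/

/-- The composition of the operators `parisiStep (x l) (v (l + 1))`, `0 ≤ l < k`. -/
def parisiNest (f : ℝ → ℝ) : ℕ → (ℕ → ℝ) → (ℕ → ℝ≥0) → ℝ → ℝ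
  | 0, _, _ => f
  | k + 1, x, v => parisiStep (x 0) (v 1) (parisiNest f k (fun l => x (l + 1)) fun l => v (l + 1))

/-- The value at time `s` of the backward flow with terminal value `f` that is driven by the value
`a i` on `[b i, b (i + 1)]`, for `i < n`. -/
def parisiFlow (f : ℝ → ℝ) : ℕ → (ℕ → ℝ) → (ℕ → ℝ) → ℝ → ℝ → ℝ
  | 0, _, _, _ => f
  | n + 1, a, b, s => parisiStep (a 0) (b 1 - max (b 0) s).toNNReal
      (parisiFlow f n (fun i => a (i + 1)) (fun i => b (i + 1)) s)

section Flow

variable {f : ℝ → ℝ} {K : ℝ≥0}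

theorem parisiNest_lipschitz (hf : LipschitzWith K f) (k : ℕ) {x : ℕ → ℝ} (hx : ∀ l, 0 ≤ x l)
    (v : ℕ → ℝ≥0) : LipschitzWith K (parisiNest f k x v) := by
  induction k generalizing x v with
  | zero => exact hf
  | succ k ih => exact parisiStep_lipschitz (ih (fun l => hx _) _) (hx 0) _

theorem parisiNest_succ (f : ℝ → ℝ) (k : ℕ) (x : ℕ → ℝ) (v : ℕ → ℝ≥0) :
    parisiNest f (k + 1) x v = parisiNest (parisiStep (x k) (v (k + 1)) f) k x v := by
  induction k generalizing x v with
  | zero => rfl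
  | succ k ih => rw [parisiNest, ih]; rfl

theorem parisiNest_congr (k : ℕ) (x : ℕ → ℝ) {v w : ℕ → ℝ≥0} (h : ∀ l, v (l + 1) = w (l + 1)) :
    parisiNest f k x v = parisiNest f k x w := by
  induction k generalizing x v w with
  | zero => rfl
  | succ k ih =>
    rw [parisiNest, parisiNest, h 0, ih _ (w := fun l => w (l + 1)) fun l => h (l + 1)]

theorem parisiFlow_lipschitz (hf : LipschitzWith K f) (n : ℕ) {a : ℕ → ℝ} (ha : ∀ i, 0 ≤ a i)
    (b : ℕ → ℝ) (s : ℝ) : LipschitzWith K (parisiFlow f n a b s) := by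
  induction n generalizing a b with
  | zero => exact hf
  | succ n ih => exact parisiStep_lipschitz (ih (fun i => ha _) _) (ha 0) _

theorem le_parisiFlow (hf : LipschitzWith K f) (n : ℕ) {a : ℕ → ℝ} (ha : ∀ i, 0 ≤ a i)
    (b : ℕ → ℝ) (s : ℝ) {c : ℝ} (hc : ∀ y, c ≤ f y) (y : ℝ) : c ≤ parisiFlow f n a b s y := by
  induction n generalizing a b y with
  | zero => exact hc y
  | succ n ih =>
    exact le_parisiStep (parisiFlow_lipschitz hf n (fun i => ha _) _ s) (ha 0) _
      (fun y => ih (fun i => ha _) _ y) y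

theorem parisiFlow_of_le (n : ℕ) {a b : ℕ → ℝ} (hb : Monotone b) {s s' : ℝ} (hs : s ≤ b 0)
    (hs' : s' ≤ b 0) : parisiFlow f n a b s = parisiFlow f n a b s' := by
  induction n generalizing a b with
  | zero => rfl
  | succ n ih =>
    have h01 : b 0 ≤ b 1 := hb (by omega)
    rw [parisiFlow, parisiFlow, max_eq_left hs, max_eq_left hs',
      ih (b := fun i => b (i + 1)) (fun i j h => hb (by omega)) (hs.trans h01) (hs'.trans h01)]

theorem parisiFlow_of_ge (n : ℕ) {a b : ℕ → ℝ} {s : ℝ} (hs : ∀ i, b i ≤ s) :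
    parisiFlow f n a b s = f := by
  induction n generalizing a b with
  | zero => rfl
  | succ n ih =>
    rw [parisiFlow, ih (b := fun i => b (i + 1)) fun i => hs _, Real.toNNReal_of_nonpos,
      parisiStep_zero]
    linarith [hs 1, le_max_right (b 0) s]

theorem parisiFlow_eq_nest (n : ℕ) {a b : ℕ → ℝ} (hb : Monotone b) {s : ℝ} (hs : s ≤ b 0) :
    parisiFlow f n a b s = parisiNest f n a fun l => (b l - b (l - 1)).toNNReal := by
  induction n generalizing a b with
  | zero => rfl
  | succ n ih =>
    have h01 : b 0 ≤ b 1 := hb (by omega)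
    rw [parisiFlow, parisiNest, max_eq_left hs,
      ih (b := fun i => b (i + 1)) (fun i j h => hb (by omega)) (hs.trans h01)]
    simp only [Nat.sub_self, Nat.add_sub_cancel]
    congr 1
    exact parisiNest_congr n _ fun l => by simp

/-- Intervals before time `s` have clamped length `0` and act as the identity, later intervals do
not see `s`, and within one interval the semigroup property splits off `[s, s']`. -/
theorem parisiFlow_step (hf : LipschitzWith K f) (n : ℕ) {a b : ℕ → ℝ} (ha : ∀ i, 0 ≤ a i)
    (hb : Monotone b) {i : ℕ} (hi : i < n) {s s' : ℝ} (h1 : b i ≤ s) (h2 : s ≤ s')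
    (h3 : s' ≤ b (i + 1)) :
    parisiFlow f n a b s = parisiStep (a i) (s' - s).toNNReal (parisiFlow f n a b s') := by
  induction n generalizing a b i with
  | zero => omega
  | succ n ih =>
    have hb' : Monotone fun i => b (i + 1) := fun i j h => hb (by omega)
    rw [parisiFlow, parisiFlow]
    cases i with
    | zero =>
      rw [parisiFlow_of_le n (s := s) (s' := s') hb' (h2.trans h3) h3, max_eq_right h1,
        max_eq_right (h1.trans h2),
        parisiStep_add (parisiFlow_lipschitz hf n (fun i => ha _) _ s'),
        ← Real.toNNReal_add (by linarith) (by simpa using h3)]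
      congr 2
      ring
    | succ i =>
      have hb1 : b 1 ≤ s := (hb (by omega)).trans h1
      rw [Real.toNNReal_of_nonpos (r := b 1 - max (b 0) s),
        Real.toNNReal_of_nonpos (r := b 1 - max (b 0) s'), parisiStep_zero, parisiStep_zero]
      · exact ih (fun i => ha _) hb' (by omega) h1 h3
      · linarith [le_max_right (b 0) s']
      · linarith [le_max_right (b 0) s]

theorem exists_interval {n : ℕ} {b : ℕ → ℝ} (h0 : b 0 = 0) (hn : b n = 1) {p p' : ℝ}
    (hp0 : 0 ≤ p) (hp1 : p < 1) (hgap : ∀ i ≤ n, p < b i → p' ≤ b i) :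
    ∃ i < n, b i ≤ p ∧ p' ≤ b (i + 1) := by
  classical
  -- The last index with `b i ≤ p` works: the next point exceeds `p`, hence is at least `p'`, and `b
  -- n = 1 > p` keeps `i` below `n`.
  let i := Nat.findGreatest (fun i => b i ≤ p) n
  have hi : b i ≤ p := Nat.findGreatest_spec (P := fun i => b i ≤ p) (Nat.zero_le n) (h0 ▸ hp0)
  have hin : i ≤ n := Nat.findGreatest_le n
  have hlt : i < n := lt_of_le_of_ne hin fun h => by rw [h, hn] at hi; linarith
  refine ⟨i, hlt, hi, hgap _ hlt ?_⟩
  exact not_le.1 (Nat.findGreatest_is_greatest (P := fun i => b i ≤ p) (Nat.lt_succ_self i) hlt)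

/-- Both flows are run backwards from time `1` along a common refinement. On each of its intervals
the driving values are constants, and the error gained is a constant times length times the
difference of the values, which is the integral of `|F - F'|` there. -/
theorem parisiFlow_sub_le (hf : LipschitzWith K f) {n n' : ℕ} {a b a' b' : ℕ → ℝ}
    (ha : ∀ i, a i ∈ Set.Icc (0 : ℝ) 1) (ha' : ∀ i, a' i ∈ Set.Icc (0 : ℝ) 1)
    (hb : Monotone b) (hb' : Monotone b') (hb0 : b 0 = 0) (hb'0 : b' 0 = 0) (hbn : b n = 1)
    (hbn' : b' n' = 1) (hb1 : ∀ i, b i ≤ 1) (hb'1 : ∀ i, b' i ≤ 1) {F F' : ℝ → ℝ}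
    (hF : ∀ i < n, ∀ r ∈ Set.Ico (b i) (b (i + 1)), F r = a i)
    (hF' : ∀ i < n', ∀ r ∈ Set.Ico (b' i) (b' (i + 1)), F' r = a' i)
    (hint : ∀ s t, IntervalIntegrable (fun r => |F r - F' r|) volume s t) (y : ℝ) :
    |parisiFlow f n a b 0 y - parisiFlow f n' a' b' 0 y| ≤
      cgfBound K * ∫ r in (0 : ℝ)..1, |F r - F' r| := by
  classical
  let S : Finset ℝ := (Finset.range (n + 1)).image b ∪ (Finset.range (n' + 1)).image b'
  have hS : ∀ i ≤ n, b i ∈ S := fun i hi =>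
    Finset.mem_union_left _ (Finset.mem_image_of_mem _ (Finset.mem_range.2 (by omega)))
  have hS' : ∀ i ≤ n', b' i ∈ S := fun i hi =>
    Finset.mem_union_right _ (Finset.mem_image_of_mem _ (Finset.mem_range.2 (by omega)))
  have h1S : (1 : ℝ) ∈ S := hbn ▸ hS n le_rfl
  have h01 : ∀ p ∈ S, 0 ≤ p ∧ p ≤ 1 := by
    intro p hp
    rcases Finset.mem_union.1 hp with h | h
    · obtain ⟨i, -, rfl⟩ := Finset.mem_image.1 h
      exact ⟨hb0 ▸ hb (Nat.zero_le i), hb1 i⟩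
    · obtain ⟨i, -, rfl⟩ := Finset.mem_image.1 h
      exact ⟨hb'0 ▸ hb' (Nat.zero_le i), hb'1 i⟩
  -- Induction on the number of refinement points after `p`; at `p = 1` both flows equal `f`.
  suffices H : ∀ N : ℕ, ∀ p ∈ S, (S.filter (p < ·)).card = N → ∀ y,
      |parisiFlow f n a b p y - parisiFlow f n' a' b' p y| ≤
        cgfBound K * ∫ r in p..1, |F r - F' r| by
    exact H _ 0 (hb0 ▸ hS 0 (Nat.zero_le n)) rfl y
  intro N
  induction N using Nat.strong_induction_on with
  | _ N ih =>
    intro p hp hN y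
    obtain ⟨hp0, hp1⟩ := h01 p hp
    rcases hp1.eq_or_lt with rfl | hlt
    · rw [parisiFlow_of_ge n hb1, parisiFlow_of_ge n' hb'1]
      simp
    · have hne : (S.filter (p < ·)).Nonempty := ⟨1, Finset.mem_filter.2 ⟨h1S, hlt⟩⟩
      let p' := (S.filter (p < ·)).min' hne
      have hp' : p' ∈ S.filter (p < ·) := Finset.min'_mem _ hne
      obtain ⟨hp'S, hpp'⟩ := Finset.mem_filter.1 hp'
      have hmin : ∀ t ∈ S, p < t → p' ≤ t := fun t ht htp =>
        Finset.min'_le _ _ (Finset.mem_filter.2 ⟨ht, htp⟩)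
      have hcard : (S.filter (p' < ·)).card < N := by
        rw [← hN]
        refine Finset.card_lt_card ((Finset.ssubset_iff_of_subset fun t ht => ?_).2
          ⟨p', hp', by simp⟩)
        rw [Finset.mem_filter] at ht ⊢
        exact ⟨ht.1, hpp'.trans ht.2⟩
      obtain ⟨i, hi, hbi, hbi'⟩ := exists_interval hb0 hbn hp0 hlt
        (fun i hi => hmin _ (hS i hi))
      obtain ⟨j, hj, hbj, hbj'⟩ := exists_interval hb'0 hbn' hp0 hlt
        (fun j hj => hmin _ (hS' j hj))
      have hv1 : (p' - p).toNNReal ≤ 1 := by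
        rw [Real.toNNReal_le_one]
        linarith [(h01 p' hp'S).2]
      have hl1 := parisiFlow_lipschitz hf n (fun i => (ha i).1) b p'
      have hl2 := parisiFlow_lipschitz hf n' (fun i => (ha' i).1) b' p'
      rw [parisiFlow_step hf n (fun i => (ha i).1) hb hi hbi hpp'.le hbi',
        parisiFlow_step hf n' (fun i => (ha' i).1) hb' hj hbj hpp'.le hbj']
      -- On `[p, p']` first the parameter changes with the terminal function fixed, then the
      -- terminal function changes, for which the step is a contraction.
      have e1 := parisiStep_sub_param_le hl1 hv1 (ha i) (ha' j) y
      have e2 := parisiStep_abs_sub_le hl1 hl2 (ha' j).1 (p' - p).toNNReal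
        (fun y => ih _ hcard p' hp'S rfl y) y
      have e3 : ∫ r in p..p', |F r - F' r| = (p' - p) * |a i - a' j| := by
        rw [intervalIntegral.integral_congr_Ioo_of_le hpp'.le (g := fun _ => |a i - a' j|)]
        · simp
        · intro r hr
          simp only
          rw [hF i hi r ⟨hbi.trans hr.1.le, hr.2.trans_le hbi'⟩,
            hF' j hj r ⟨hbj.trans hr.1.le, hr.2.trans_le hbj'⟩]
      rw [← intervalIntegral.integral_add_adjacent_intervals (hint p p') (hint p' 1), e3, mul_add]
      rw [Real.coe_toNNReal _ (by linarith)] at e1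
      calc _ ≤ _ := abs_sub_le _ _ _
        _ ≤ _ := add_le_add e1 e2
        _ = _ := by ring

end Flow

end RPC
end

noncomputable section

namespace RPC

/-! ### The limiting functional on atomic measures -/

/-- The points `0, q_0, …, q_k, 1, 1, …`. -/
def AtomicMeasure.point (m : AtomicMeasure) : ℕ → ℝ
  | 0 => 0
  | i + 1 => if h : i < m.k + 1 then m.q ⟨i, h⟩ else 1

/-- The values `0, x_0, …, x_k, 1, 1, …` of the distribution function between these points. -/
def AtomicMeasure.level (m : AtomicMeasure) : ℕ → ℝ
  | 0 => 0
  | i + 1 => if h : i < m.k + 1 then m.x ⟨i, h⟩ else 1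

namespace AtomicMeasure

variable (m m' : AtomicMeasure)

theorem point_succ (i : Fin (m.k + 1)) : m.point (i + 1) = m.q i := by
  rw [point, dif_pos i.2]

theorem level_succ (i : Fin (m.k + 1)) : m.level (i + 1) = m.x i := by
  rw [level, dif_pos i.2]

theorem x_le_one (i : Fin (m.k + 1)) : m.x i ≤ 1 :=
  m.x_last ▸ m.x_strictMono.monotone (Fin.le_last i)

theorem point_nonneg (i : ℕ) : 0 ≤ m.point i := by
  cases i with
  | zero => exact le_rfl
  | succ i =>
    rw [point]
    split_ifs
    · exact m.q_nonneg _
    · exact zero_le_one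

theorem point_le_one (i : ℕ) : m.point i ≤ 1 := by
  cases i with
  | zero => exact zero_le_one
  | succ i =>
    rw [point]
    split_ifs
    · exact m.q_le_one _
    · exact le_rfl

theorem level_mem (i : ℕ) : m.level i ∈ Set.Icc (0 : ℝ) 1 := by
  cases i with
  | zero => exact ⟨le_rfl, zero_le_one⟩
  | succ i =>
    rw [level]
    split_ifs
    · exact ⟨(m.x_pos _).le, m.x_le_one _⟩
    · exact ⟨zero_le_one, le_rfl⟩

theorem point_monotone : Monotone m.point := by
  refine monotone_nat_of_le_succ fun i => ?_
  cases i with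
  | zero => exact m.point_nonneg 1
  | succ i =>
    rw [point, point]
    split_ifs with h1 h2
    · exact m.q_strictMono.monotone (Fin.mk_le_mk.2 (Nat.le_succ i))
    · exact m.q_le_one _
    · omega
    · exact le_rfl

/-- There are `k + 2` intervals: besides those between atoms, `[0, q_0]` with value `0` and `[q_k,
1]` with value `1`. Either of these two may be degenerate. -/
theorem point_last : m.point (m.k + 2) = 1 := by
  rw [point, dif_neg (by omega)]

theorem cdf_eq_x {r : ℝ} {i : Fin (m.k + 1)} (h1 : m.q i ≤ r) (h2 : ∀ j, i < j → r < m.q j) :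
    m.cdf r = m.x i := by
  refine le_antisymm (Finset.sup'_le _ _ fun j _ => ?_) ?_
  · split_ifs with h
    · exact m.x_strictMono.monotone (not_lt.1 fun hij => not_lt.2 h (h2 j hij))
    · exact (m.x_pos i).le
  · refine le_trans ?_ (Finset.le_sup' _ (Finset.mem_univ i))
    rw [if_pos h1]

theorem cdf_eq_zero {r : ℝ} (h : ∀ j, r < m.q j) : m.cdf r = 0 := by
  rw [cdf]
  simp_rw [if_neg (not_le.2 (h _)), Finset.sup'_const]

theorem cdf_eq_level {i : ℕ} (hi : i < m.k + 2) {r : ℝ}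
    (hr : r ∈ Set.Ico (m.point i) (m.point (i + 1))) : m.cdf r = m.level i := by
  cases i with
  | zero =>
    refine m.cdf_eq_zero fun j => hr.2.trans_le ?_
    rw [← m.point_succ]
    exact m.point_monotone (by omega)
  | succ i =>
    have hi' : i < m.k + 1 := by omega
    have h1 := m.point_succ ⟨i, hi'⟩
    have h2 := m.level_succ ⟨i, hi'⟩
    simp only at h1 h2
    rw [h2]
    refine m.cdf_eq_x (h1 ▸ hr.1) fun j hj => hr.2.trans_le ?_
    rw [← m.point_succ]
    exact m.point_monotone (Nat.succ_le_succ hj)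

theorem cdf_mem (r : ℝ) : m.cdf r ∈ Set.Icc (0 : ℝ) 1 := by
  constructor
  · refine le_trans ?_ (Finset.le_sup' _ (Finset.mem_univ 0))
    split_ifs
    · exact (m.x_pos 0).le
    · exact le_rfl
  · refine Finset.sup'_le _ _ fun j _ => ?_
    split_ifs
    · exact m.x_le_one j
    · exact zero_le_one

theorem cdf_monotone : Monotone m.cdf := fun r s hrs => by
  refine Finset.sup'_mono_fun fun j _ => ?_
  split_ifs with h1 h2
  · exact le_rfl
  · exact absurd (h1.trans hrs) h2
  · exact (m.x_pos j).le
  · exact le_rfl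

theorem cdf_intervalIntegrable (s t : ℝ) : IntervalIntegrable m.cdf volume s t :=
  m.cdf_monotone.intervalIntegrable

theorem intervalIntegrable_abs_cdf_sub (s t : ℝ) :
    IntervalIntegrable (fun r => |m.cdf r - m'.cdf r|) volume s t :=
  ((m.cdf_intervalIntegrable s t).sub (m'.cdf_intervalIntegrable s t)).abs

theorem intervalIntegrable_cdf_mul (s t : ℝ) :
    IntervalIntegrable (fun r => m.cdf r * r) volume s t :=
  (m.cdf_intervalIntegrable s t).mul_continuousOn continuousOn_id

theorem integral_cdf_mul : ∫ r in (0 : ℝ)..1, m.cdf r * r =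
    ∑ i ∈ Finset.range (m.k + 2), m.level i * ((m.point (i + 1) ^ 2 - m.point i ^ 2) / 2) := by
  have h := intervalIntegral.sum_integral_adjacent_intervals (a := m.point) (n := m.k + 2)
    (f := fun r => m.cdf r * r) (μ := volume) fun i _ => m.intervalIntegrable_cdf_mul _ _
  rw [m.point_last] at h
  change ∫ r in (m.point 0)..1, m.cdf r * r = _
  rw [← h]
  refine Finset.sum_congr rfl fun i hi => ?_
  rw [intervalIntegral.integral_congr_Ioo_of_le (m.point_monotone (Nat.le_succ i))
    (g := fun r => m.level i * r)]
  · rw [intervalIntegral.integral_const_mul, integral_id]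
  · intro r hr
    simp only
    rw [m.cdf_eq_level (Finset.mem_range.1 hi) ⟨hr.1.le, hr.2⟩]

end AtomicMeasure

theorem l1Dist_nonneg (m m' : AtomicMeasure) : 0 ≤ l1Dist m m' :=
  intervalIntegral.integral_nonneg zero_le_one fun _ _ => abs_nonneg _

/-- The Parisi functional with terminal value `f`. -/
def parisiFunctional (f : ℝ → ℝ) (m : AtomicMeasure) : ℝ :=
  parisiFlow f (m.k + 2) m.level m.point 0 0

theorem parisiFunctional_sub_le {f : ℝ → ℝ} {K : ℝ≥0} (hf : LipschitzWith K f)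
    (m m' : AtomicMeasure) :
    |parisiFunctional f m - parisiFunctional f m'| ≤ cgfBound K * l1Dist m m' :=
  parisiFlow_sub_le hf m.level_mem m'.level_mem m.point_monotone m'.point_monotone rfl rfl
    m.point_last m'.point_last m.point_le_one m'.point_le_one (fun _ hi _ hr => m.cdf_eq_level hi hr)
    (fun _ hi _ hr => m'.cdf_eq_level hi hr) (m.intervalIntegrable_abs_cdf_sub m') 0

/-! ### The functional for the SK model: continuity and lower bound -/

/-- The function `log (2 cosh (β y + h))`. -/
def logCosh (β h y : ℝ) : ℝ := Real.log (2 * Real.cosh (β * y + h))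

theorem cosh_add_le (a b : ℝ) : Real.cosh (a + b) ≤ Real.exp |b| * Real.cosh a := by
  rw [Real.cosh_eq, Real.cosh_eq]
  have h1 : Real.exp (a + b) ≤ Real.exp |b| * Real.exp a := by
    rw [← Real.exp_add, Real.exp_le_exp]; linarith [le_abs_self b]
  have h2 : Real.exp (-(a + b)) ≤ Real.exp |b| * Real.exp (-a) := by
    rw [← Real.exp_add, Real.exp_le_exp]; linarith [neg_abs_le b]
  linarith

theorem logCosh_lipschitz (β h : ℝ) : LipschitzWith ‖β‖₊ (logCosh β h) := by
  refine LipschitzWith.of_le_add_mul _ fun y y' => ?_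
  have h1 := cosh_add_le (β * y' + h) (β * (y - y'))
  have h2 : β * y' + h + β * (y - y') = β * y + h := by ring
  rw [h2] at h1
  have h3 : 2 * Real.cosh (β * y + h) ≤ Real.exp |β * (y - y')| * (2 * Real.cosh (β * y' + h)) := by
    linarith
  have h4 := Real.log_le_log (mul_pos two_pos (Real.cosh_pos _)) h3
  rw [Real.log_mul (Real.exp_pos _).ne' (mul_pos two_pos (Real.cosh_pos _)).ne', Real.log_exp,
    abs_mul] at h4
  rw [Real.dist_eq, coe_nnnorm, Real.norm_eq_abs, logCosh, logCosh]
  linarith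

theorem log_two_le_logCosh (β h y : ℝ) : Real.log 2 ≤ logCosh β h y :=
  Real.log_le_log two_pos (by linarith [Real.one_le_cosh (β * y + h)])

/-- The functional `G_{β,h}`. -/
def limitFunctional (β h : ℝ) (m : AtomicMeasure) : ℝ :=
  parisiFunctional (logCosh β h) m - β ^ 2 / 2 * ∫ r in (0 : ℝ)..1, m.cdf r * r

theorem limitFunctional_sub_le (β h : ℝ) (m m' : AtomicMeasure) :
    |limitFunctional β h m - limitFunctional β h m'| ≤
      (cgfBound ‖β‖₊ + β ^ 2 / 2) * l1Dist m m' := by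
  have h1 := parisiFunctional_sub_le (logCosh_lipschitz β h) m m'
  have h2 : |(∫ r in (0 : ℝ)..1, m.cdf r * r) - ∫ r in (0 : ℝ)..1, m'.cdf r * r| ≤
      l1Dist m m' := by
    rw [← intervalIntegral.integral_sub (m.intervalIntegrable_cdf_mul _ _)
      (m'.intervalIntegrable_cdf_mul _ _)]
    refine (intervalIntegral.abs_integral_le_integral_abs zero_le_one).trans ?_
    refine intervalIntegral.integral_mono_on zero_le_one
      ((m.intervalIntegrable_cdf_mul _ _).sub (m'.intervalIntegrable_cdf_mul _ _)).abs
      (m.intervalIntegrable_abs_cdf_sub m' _ _) fun r hr => ?_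
    rw [← sub_mul, abs_mul, abs_of_nonneg hr.1]
    exact mul_le_of_le_one_right (abs_nonneg _) hr.2
  have h3 : limitFunctional β h m - limitFunctional β h m' =
      (parisiFunctional (logCosh β h) m - parisiFunctional (logCosh β h) m') - β ^ 2 / 2 *
      ((∫ r in (0 : ℝ)..1, m.cdf r * r) - ∫ r in (0 : ℝ)..1, m'.cdf r * r) := by
    rw [limitFunctional, limitFunctional]; ring
  rw [h3, add_mul]
  refine (abs_sub _ _).trans (add_le_add h1 ?_)
  rw [abs_mul, abs_of_nonneg (by positivity : 0 ≤ β ^ 2 / 2)]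
  gcongr

theorem limitFunctional_continuous (β h : ℝ) : L1Continuous (limitFunctional β h) := by
  intro m ε hε
  have hC : 0 < cgfBound ‖β‖₊ + β ^ 2 / 2 + 1 :=
    add_pos_of_nonneg_of_pos (add_nonneg (cgfBound_nonneg _) (by positivity)) one_pos
  refine ⟨ε / (cgfBound ‖β‖₊ + β ^ 2 / 2 + 1), div_pos hε hC, fun m' hm => ?_⟩
  rw [lt_div_iff₀ hC, mul_comm] at hm
  have := limitFunctional_sub_le β h m m'
  rw [abs_sub_comm]
  linarith [l1Dist_nonneg m m']

/-- The flow preserves lower bounds of the terminal function, here `log 2`, and the subtracted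
integral is at most `1` because both factors are. -/
theorem limitFunctional_ge (β h : ℝ) (m : AtomicMeasure) :
    Real.log 2 - β ^ 2 / 2 ≤ limitFunctional β h m := by
  have h1 : Real.log 2 ≤ parisiFunctional (logCosh β h) m :=
    le_parisiFlow (logCosh_lipschitz β h) _ (fun i => (m.level_mem i).1) _ _
      (log_two_le_logCosh β h) 0
  have h2 : ∫ r in (0 : ℝ)..1, m.cdf r * r ≤ ∫ r in (0 : ℝ)..1, (1 : ℝ) :=
    intervalIntegral.integral_mono_on zero_le_one (m.intervalIntegrable_cdf_mul _ _) (by simp)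
      fun r hr => mul_le_one₀ (m.cdf_mem r).2 hr.1 hr.2
  rw [intervalIntegral.integral_const, sub_zero, one_smul] at h2
  rw [limitFunctional]
  have : β ^ 2 / 2 * (∫ r in (0 : ℝ)..1, m.cdf r * r) ≤ β ^ 2 / 2 * 1 := by gcongr
  linarith

/-! ### Density of the measures with an atom at `1` -/

/-- Moving a fraction `ε` of the mass to a new atom at `1`. -/
def AtomicMeasure.withAtomOne (m : AtomicMeasure) (hq : m.q (Fin.last m.k) < 1) (ε : ℝ)
    (h0 : 0 < ε) (h1 : ε < 1) : AtomicMeasure where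
  k := m.k + 1
  q := Fin.snoc (α := fun _ => ℝ) m.q 1
  x := Fin.snoc (α := fun _ => ℝ) (fun i => (1 - ε) * m.x i) 1
  q_nonneg := Fin.lastCases (by simp) fun i => by simpa using m.q_nonneg i
  q_le_one := Fin.lastCases (by simp) fun i => by simpa using m.q_le_one i
  q_strictMono := by
    refine Fin.strictMono_iff_lt_succ.2 (Fin.lastCases ?_ fun i => ?_)
    · simpa [Fin.succ_last] using hq
    · rw [← Fin.castSucc_succ, Fin.snoc_castSucc, Fin.snoc_castSucc]
      exact m.q_strictMono Fin.castSucc_lt_succ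
  x_pos := Fin.lastCases (by simp) fun i => by
    simpa using mul_pos (by linarith) (m.x_pos i)
  x_strictMono := by
    refine Fin.strictMono_iff_lt_succ.2 (Fin.lastCases ?_ fun i => ?_)
    · simpa [Fin.succ_last, m.x_last] using h0
    · rw [← Fin.castSucc_succ, Fin.snoc_castSucc, Fin.snoc_castSucc]
      exact mul_lt_mul_of_pos_left (m.x_strictMono Fin.castSucc_lt_succ) (by linarith)
  x_last := by simp

theorem AtomicMeasure.withAtomOne_cdf (m : AtomicMeasure) (hq : m.q (Fin.last m.k) < 1) (ε : ℝ)
    (h0 : 0 < ε) (h1 : ε < 1) {r : ℝ} (hr : r < 1) :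
    (m.withAtomOne hq ε h0 h1).cdf r = (1 - ε) * m.cdf r := by
  let F : Fin (m.k + 1 + 1) → ℝ := fun j =>
    if Fin.snoc (α := fun _ => ℝ) m.q 1 j ≤ r then
      Fin.snoc (α := fun _ => ℝ) (fun i => (1 - ε) * m.x i) 1 j else 0
  have hF : ∀ i : Fin (m.k + 1), F (Fin.castSucc i) = (1 - ε) * if m.q i ≤ r then m.x i else 0 :=
    fun i => by simp [F]
  have hl : F (Fin.last (m.k + 1)) = 0 := by simp [F, hr]
  change Finset.univ.sup' Finset.univ_nonempty F = _
  refine le_antisymm (Finset.sup'_le _ _ fun j _ => ?_) ?_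
  · refine Fin.lastCases ?_ (fun i => ?_) j
    · rw [hl]
      exact mul_nonneg (by linarith) (m.cdf_mem r).1
    · rw [hF]
      exact mul_le_mul_of_nonneg_left (Finset.le_sup' (fun i => if m.q i ≤ r then m.x i else 0)
        (Finset.mem_univ i)) (by linarith)
  · obtain ⟨i, -, hi⟩ := Finset.exists_mem_eq_sup' Finset.univ_nonempty
      (fun i => if m.q i ≤ r then m.x i else 0)
    rw [AtomicMeasure.cdf, hi, ← hF]
    exact Finset.le_sup' _ (Finset.mem_univ _)

theorem l1Dist_withAtomOne_le (m : AtomicMeasure) (hq : m.q (Fin.last m.k) < 1) (ε : ℝ)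
    (h0 : 0 < ε) (h1 : ε < 1) : l1Dist m (m.withAtomOne hq ε h0 h1) ≤ ε := by
  rw [l1Dist, intervalIntegral.integral_congr_Ioo_of_le zero_le_one (g := fun r => ε * m.cdf r)]
  · calc _ ≤ ∫ r in (0 : ℝ)..1, ε :=
          intervalIntegral.integral_mono_on zero_le_one ((m.cdf_intervalIntegrable _ _).const_mul ε)
            (by simp) fun r _ => mul_le_of_le_one_right h0.le (m.cdf_mem r).2
      _ = ε := by simp
  · intro r hr
    simp only
    rw [m.withAtomOne_cdf hq ε h0 h1 hr.2]
    have : m.cdf r - (1 - ε) * m.cdf r = ε * m.cdf r := by ring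
    rw [this, abs_of_nonneg (mul_nonneg h0.le (m.cdf_mem r).1)]

instance : Nonempty AtomicMeasureOne :=
  ⟨⟨⟨0, fun _ => 1, fun _ => 1, fun _ => zero_le_one, fun _ => le_rfl,
    Subsingleton.strictMono (α := Fin 1) _, fun _ => one_pos, Subsingleton.strictMono (α := Fin 1) _, rfl⟩, rfl⟩⟩

instance : Nonempty AtomicMeasure := ⟨(Classical.arbitrary AtomicMeasureOne).1⟩

/-- A measure without an atom at `1` is an `L¹` limit of measures that have one, so restricting a
continuous functional to the latter does not raise the infimum. -/
theorem L1Continuous.iInf_one_eq {G : AtomicMeasure → ℝ} (hG : L1Continuous G)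
    (hb : BddBelow (Set.range G)) :
    (⨅ m : AtomicMeasureOne, G m.1) = ⨅ m : AtomicMeasure, G m := by
  have hb1 : BddBelow (Set.range fun m : AtomicMeasureOne => G m.1) :=
    hb.mono (Set.range_comp_subset_range Subtype.val G)
  refine le_antisymm (le_ciInf fun m => ?_) (le_ciInf fun m => ciInf_le hb m.1)
  rcases (m.q_le_one (Fin.last m.k)).eq_or_lt with h | h
  · exact ciInf_le hb1 ⟨m, h⟩
  · refine le_of_forall_pos_lt_add fun ε hε => ?_
    obtain ⟨δ, hδ, hc⟩ := hG m ε hε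
    -- The moved mass must be below `δ` for the continuity estimate and below `1` so that the old
    -- levels remain positive.
    have h0 : 0 < min (δ / 2) (1 / 2) := by positivity
    have h1 : min (δ / 2) (1 / 2) < 1 := (min_le_right _ _).trans_lt (by norm_num)
    have h2 := hc (m.withAtomOne h _ h0 h1)
      ((l1Dist_withAtomOne_le m h _ h0 h1).trans_lt ((min_le_left _ _).trans_lt (by linarith)))
    have h3 := ciInf_le hb1 ⟨m.withAtomOne h _ h0 h1, Fin.snoc_last (α := fun _ => ℝ) _ _⟩
    simp only at h3
    linarith [(abs_lt.1 h2).2]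

end RPC
end

noncomputable section

namespace RPC

/-! ### Laws of Gaussian fields -/

/-- The law of a centred Gaussian field is determined by its covariance. -/
theorem IsCentredGaussianField.map_eq {Ω Ω' A : Type} [MeasurableSpace Ω] [MeasurableSpace Ω']
    {P : Measure Ω} {Q : Measure Ω'} {X : A → Ω → ℝ} {Y : A → Ω' → ℝ} {c : A → A → ℝ}
    (hX : IsCentredGaussianField P X c) (hY : IsCentredGaussianField Q Y c) :
    P.map (fun ω α => X α ω) = Q.map (fun ω α => Y α ω) := by
  classical
  have := hX.gaussian.isProbabilityMeasure
  have := hY.gaussian.isProbabilityMeasure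
  -- The characteristic function of each finite-dimensional marginal is expressed by `c` alone,
  -- since a linear form of the field is Gaussian with mean zero and variance a quadratic form in
  -- `c`.
  have key : ∀ {Ω : Type} [MeasurableSpace Ω] {P : Measure Ω} {X : A → Ω → ℝ}
      (hX : IsCentredGaussianField P X c) (I : Finset A) (L : StrongDual ℝ (I → ℝ)),
      charFunDual (P.map fun ω => I.restrict (X · ω)) L = Complex.exp
        (-((∑ i : I, ∑ j : I, L (Pi.single i 1) * L (Pi.single j 1) * c i j : ℝ) : ℂ) / 2) := by
    intro Ω _ P X hX I L
    have hL : ∀ ω, L (I.restrict (X · ω)) = ∑ i : I, L (Pi.single i 1) * X i ω := by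
      intro ω
      have : I.restrict (X · ω) = ∑ i : I, X i ω • (Pi.single i 1 : I → ℝ) := by
        ext j
        simp [Finset.sum_apply, Pi.single_apply]
      rw [this, map_sum]
      exact Finset.sum_congr rfl fun i _ => by rw [map_smul, smul_eq_mul, mul_comm]
    have h2 : ∀ i : I, MemLp (fun ω => L (Pi.single i 1) * X i ω) 2 P := fun i =>
      (hX.gaussian.hasGaussianLaw_eval i).memLp_two.const_mul _
    have hP := hX.gaussian.isProbabilityMeasure
    rw [(hX.gaussian.hasGaussianLaw I).charFunDual_map_eq_fun L]
    simp_rw [hL]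
    rw [integral_finsetSum _ fun i _ => (h2 i).integrable (by norm_num)]
    simp_rw [integral_const_mul, hX.centred]
    rw [← covariance_self (by exact Finset.aemeasurable_fun_sum _ fun i _ =>
      (hX.measurable i).aemeasurable.const_mul _), covariance_fun_sum_fun_sum h2 h2]
    simp_rw [covariance_const_mul_left, covariance_const_mul_right, hX.cov, ← mul_assoc]
    simp [neg_div]
  -- A measure on the full product is the unique projective limit of its finite-dimensional
  -- marginals.
  refine (isProjectiveLimit_map (measurable_pi_lambda _ hX.measurable).aemeasurable).unique
    (P := fun I => P.map fun ω => I.restrict (X · ω)) ?_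
  have h : ∀ I : Finset A, P.map (fun ω => I.restrict (X · ω)) =
      Q.map fun ω => I.restrict (Y · ω) := by
    intro I
    have := hX.gaussian.hasGaussianLaw I |>.isGaussian_map
    have := hY.gaussian.hasGaussianLaw I |>.isGaussian_map
    exact Measure.ext_of_charFunDual (funext fun L => (key hX I L).trans (key hY I L).symm)
  simp_rw [h]
  exact isProjectiveLimit_map (measurable_pi_lambda _ hY.measurable).aemeasurable

/-- The sum of the marks along the path from the root to the leaf `α`. -/
def pathSum {E : Type*} [AddCommMonoid E] {k : ℕ} (w : List ℕ → E) (α : Fin k → ℕ) : E :=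
  ∑ l ∈ Finset.range (k + 1), w ((List.ofFn α).take l)

theorem take_ofFn_eq_iff {k : ℕ} (α α' : Fin k → ℕ) (l : ℕ) :
    (List.ofFn α).take l = (List.ofFn α').take l ↔ ∀ i : Fin k, (i : ℕ) < l → α i = α' i := by
  constructor
  · intro h i hi
    have := congrArg (fun u => u[(i : ℕ)]?) h
    simpa [List.getElem?_take, hi] using this
  · intro h
    refine List.ext_getElem? fun i => ?_
    rw [List.getElem?_take, List.getElem?_take]
    split_ifs with hi
    · by_cases hk : i < k
      · simp [hk, h ⟨i, hk⟩ hi]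
      · simp [hk]
    · rfl

/-- The levels of agreement form an initial segment `0, …, s`, and `q` increases, so the overlap is
read off at the deepest common vertex. This translates overlaps into common prefixes. -/
theorem exists_overlap_eq (m : AtomicMeasure) (α α' : Fin m.k → ℕ) :
    ∃ s : Fin (m.k + 1), overlap m α α' = m.q s ∧ ∀ l < m.k + 1,
      ((List.ofFn α).take l = (List.ofFn α').take l ↔ l < (s : ℕ) + 1) := by
  have hmem : ∀ l : Fin (m.k + 1), l ∈ commonLevels α α' ↔
      (List.ofFn α).take l = (List.ofFn α').take l := fun l => by
    rw [take_ofFn_eq_iff, commonLevels, Finset.mem_filter]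
    simp
  refine ⟨(commonLevels α α').max' (commonLevels_nonempty α α'), le_antisymm ?_ ?_, ?_⟩
  · exact Finset.sup'_le _ _ fun l hl => m.q_strictMono.monotone (Finset.le_max' _ _ hl)
  · exact Finset.le_sup' _ (Finset.max'_mem _ _)
  · intro l hl
    constructor
    · intro h
      exact Nat.lt_succ_of_le (Finset.le_max' (commonLevels α α') ⟨l, hl⟩ ((hmem _).2 h))
    · intro h
      have h1 := (hmem _).1 (Finset.max'_mem (commonLevels α α') (commonLevels_nonempty α α'))
      have h2 := congrArg (List.take l) h1
      rwa [List.take_take, List.take_take, min_eq_left (Nat.lt_succ_iff.1 h)] at h2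

/-- The law of independent centred Gaussian marks with variances `v l` at the vertices of level
`l`. -/
abbrev gaussianMarks (v : ℕ → ℝ≥0) : Measure (List ℕ → ℝ) :=
  Measure.infinitePi fun u => gaussianReal 0 (v u.length)

theorem gaussianMarks_hasLaw (v : ℕ → ℝ≥0) (u : List ℕ) :
    HasLaw (fun w : List ℕ → ℝ => w u) (gaussianReal 0 (v u.length)) (gaussianMarks v) :=
  ⟨(measurable_pi_apply u).aemeasurable, Measure.infinitePi_map_eval _ u⟩

theorem isGaussianProcess_gaussianMarks (v : ℕ → ℝ≥0) :
    IsGaussianProcess (fun u (w : List ℕ → ℝ) => w u) (gaussianMarks v) where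
  hasGaussianLaw I := by
    have h : iIndepFun (fun (u : I) (w : List ℕ → ℝ) => w u) (gaussianMarks v) :=
      (iIndepFun_infinitePi (X := fun _ x => x) fun _ => measurable_id).precomp
        Subtype.val_injective
    exact h.hasGaussianLaw fun u => (gaussianMarks_hasLaw v u).hasGaussianLaw

theorem covariance_gaussianMarks (v : ℕ → ℝ≥0) (u u' : List ℕ) :
    covariance (fun w : List ℕ → ℝ => w u) (fun w => w u') (gaussianMarks v) =
      if u = u' then (v u.length : ℝ) else 0 := by
  split_ifs with h
  · subst h
    rw [covariance_self (measurable_pi_apply u).aemeasurable, (gaussianMarks_hasLaw v u).variance_eq,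
      variance_id_gaussianReal]
  · have hi : iIndepFun (fun u (w : List ℕ → ℝ) => w u) (gaussianMarks v) :=
      iIndepFun_infinitePi (X := fun _ x => x) fun _ => measurable_id
    exact (hi.indepFun h).covariance_eq_zero
      ((isGaussianProcess_gaussianMarks v).hasGaussianLaw_eval u).memLp_two
      ((isGaussianProcess_gaussianMarks v).hasGaussianLaw_eval u').memLp_two

/-- Two path sums share exactly the marks of their common vertices, so their covariance is the sum
of the variances down to the deepest common vertex; this telescopes to the prescribed `g`. -/
theorem isCentredGaussianField_pathSum (m : AtomicMeasure) {v : ℕ → ℝ≥0} {g : ℝ → ℝ}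
    (hv : ∀ s : Fin (m.k + 1), ∑ l ∈ Finset.range (s + 1), (v l : ℝ) = g (m.q s)) :
    IsCentredGaussianField (gaussianMarks v) (fun (α : Fin m.k → ℕ) w => pathSum w α)
      (fun α α' => g (overlap m α α')) where
  measurable α := by unfold pathSum; fun_prop
  gaussian := by
    have hG := isGaussianProcess_gaussianMarks v
    refine IsGaussianProcess.of_isGaussianProcess hG fun α => ?_
    refine ⟨(Finset.range (m.k + 1)).image fun l => (List.ofFn α).take l,
      ∑ l : Fin (m.k + 1), ContinuousLinearMap.proj (R := ℝ) (φ := fun _ => ℝ)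
        ⟨(List.ofFn α).take l, Finset.mem_image_of_mem (fun l => (List.ofFn α).take l)
          (Finset.mem_range.2 l.2)⟩, fun w => ?_⟩
    rw [pathSum, Finset.sum_range, sum_apply]
    rfl
  centred α := by
    have hG := isGaussianProcess_gaussianMarks v
    simp only [pathSum]
    rw [integral_finsetSum _ fun l _ => (hG.hasGaussianLaw_eval _).integrable]
    refine Finset.sum_eq_zero fun l _ => ?_
    rw [(gaussianMarks_hasLaw v _).integral_eq, integral_id_gaussianReal]
  cov α α' := by
    have hG := isGaussianProcess_gaussianMarks v
    obtain ⟨s, hs, hl⟩ := exists_overlap_eq m α α'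
    simp only [pathSum]
    rw [covariance_fun_sum_fun_sum' (fun l _ => (hG.hasGaussianLaw_eval _).memLp_two)
      (fun l _ => (hG.hasGaussianLaw_eval _).memLp_two)]
    simp_rw [covariance_gaussianMarks]
    rw [hs, ← hv, ← Finset.sum_filter_add_sum_filter_not (Finset.range (m.k + 1)) (· < (s : ℕ) + 1)]
    have hf : (Finset.range (m.k + 1)).filter (· < (s : ℕ) + 1) = Finset.range (s + 1) := by
      ext l
      simp only [Finset.mem_filter, Finset.mem_range]
      omega
    -- Equal prefixes have equal lengths, so only diagonal terms can survive, and below the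
    -- branching level not even these do.
    rw [hf, Finset.sum_eq_zero (s := Finset.filter _ _), add_zero]
    · refine Finset.sum_congr rfl fun l hls => ?_
      have hlk : l < m.k + 1 := by
        have := Finset.mem_range.1 hls
        omega
      rw [Finset.sum_eq_single l]
      · rw [if_pos ((hl l hlk).2 (Finset.mem_range.1 hls)), List.length_take, List.length_ofFn,
          min_eq_left (by omega)]
      · intro l' hl' hne
        rw [if_neg]
        intro h
        have := congrArg List.length h
        rw [List.length_take, List.length_take, List.length_ofFn, List.length_ofFn,
          min_eq_left (by omega), min_eq_left (by have := Finset.mem_range.1 hl'; omega)] at this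
        exact hne this.symm
      · exact fun h => absurd (Finset.mem_range.2 hlk) h
    · intro l hls
      rw [Finset.mem_filter, Finset.mem_range] at hls
      refine Finset.sum_eq_zero fun l' hl' => if_neg fun h => hls.2 ((hl l hls.1).1 ?_)
      have := congrArg List.length h
      rw [List.length_take, List.length_take, List.length_ofFn, List.length_ofFn,
        min_eq_left (by omega), min_eq_left (by have := Finset.mem_range.1 hl'; omega)] at this
      rw [h, this]

/-- Regroups a sequence of independent mark configurations by vertex, so that all the fields
together become one path sum with marks in `ℕ → ℝ`. -/
theorem infinitePi_map_swap {ι κ X : Type*} [MeasurableSpace X] (μ : ι → κ → Measure X)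
    [∀ i j, IsProbabilityMeasure (μ i j)] :
    (Measure.infinitePi fun i => Measure.infinitePi fun j => μ i j).map (fun w j i => w i j) =
      Measure.infinitePi fun j => Measure.infinitePi fun i => μ i j := by
  rw [← Measure.infinitePi_map_curry (fun j i => μ i j), ← Measure.infinitePi_map_curry μ,
    Measure.map_map (by fun_prop) (by fun_prop),
    show (Measure.infinitePi fun p : κ × ι => μ p.2 p.1) = _ from
      (Measure.map_infinitePi_infinitePi_of_inj (P := fun p : ι × κ => μ p.1 p.2)
        (f := Prod.swap) Prod.swap_injective).symm, Measure.map_map (by fun_prop) (by fun_prop)]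
  rfl

/-- Independent centred Gaussian fields with covariance `g (q_{α,α'})` have the law of the sums of
independent Gaussian marks along the paths of the tree. -/
theorem map_fields_eq (m : AtomicMeasure) {Ω : Type} [MeasurableSpace Ω] {P : Measure Ω}
    {X : ℕ → (Fin m.k → ℕ) → Ω → ℝ} {v : ℕ → ℝ≥0} {g : ℝ → ℝ}
    (hv : ∀ s : Fin (m.k + 1), ∑ l ∈ Finset.range (s + 1), (v l : ℝ) = g (m.q s))
    (hX : ∀ i, IsCentredGaussianField P (X i) fun α α' => g (overlap m α α'))
    (hi : iIndepFun (fun i ω α => X i α ω) P) :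
    P.map (fun ω i α => X i α ω) =
      (Measure.infinitePi fun u : List ℕ => Measure.infinitePi fun _ : ℕ =>
        gaussianReal 0 (v u.length)).map (fun (G : List ℕ → ℕ → ℝ) i α => pathSum G α i) := by
  have := (hX 0).gaussian.isProbabilityMeasure
  have hp : Measurable fun (w : List ℕ → ℝ) (α : Fin m.k → ℕ) => pathSum w α :=
    measurable_pi_lambda _ (isCentredGaussianField_pathSum m hv).measurable
  rw [(iIndepFun_iff_map_fun_eq_infinitePi_map fun i =>
    measurable_pi_lambda _ (hX i).measurable).1 hi]
  simp_rw [fun i => (hX i).map_eq (isCentredGaussianField_pathSum m hv)]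
  rw [← Measure.infinitePi_map_pi (fun _ : ℕ => gaussianMarks v) (fun _ => hp),
    ← infinitePi_map_swap fun (u : List ℕ) (_ : ℕ) => gaussianReal 0 (v u.length),
    Measure.map_map (by exact measurable_pi_lambda _ fun i => hp.comp (measurable_pi_apply i))
      (by fun_prop)]
  congr 1
  ext G i α
  simp [pathSum, Finset.sum_apply]

end RPC
end

noncomputable section

namespace RPC

/-! ### Weighted sums of exponentials of Gaussian marks -/

/-- Unfolds the recursion by splitting a leaf into its first coordinate and a leaf of the
corresponding subtree. -/
theorem treeSum_eq_tsum {E : Type*} [AddCommMonoid E] (U : E → ℝ≥0∞) (k : ℕ)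
    (ζ : List ℕ → ℕ → ℝ) (G : List ℕ → E) (y : E) :
    treeSum U k ζ G y = ∑' α : Fin k → ℕ,
      (∏ l : Fin k, ENNReal.ofReal (ζ ((List.ofFn α).take l) (α l))) * U (y + pathSum G α) := by
  induction k generalizing ζ G y with
  | zero => rw [tsum_fintype]; simp [treeSum, pathSum]
  | succ k ih =>
    rw [treeSum, ← (Fin.consEquiv fun _ => ℕ).tsum_eq, ENNReal.tsum_prod']
    refine tsum_congr fun j => ?_
    rw [ih, ← ENNReal.tsum_mul_left]
    refine tsum_congr fun α => ?_
    have h : pathSum G (Fin.cons j α : Fin (k + 1) → ℕ) =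
        G [] + pathSum (fun u => G (j :: u)) α := by
      rw [pathSum, Finset.sum_range_succ', add_comm]
      simp [pathSum]
    simp [Fin.consEquiv, Fin.prod_univ_succ, h, mul_assoc, add_assoc]

/-- The law of the marks at level `l`: independent centred Gaussian variables. -/
abbrev gaussianSeq (v : ℝ≥0) : Measure (ℕ → ℝ) := Measure.infinitePi fun _ => gaussianReal 0 v

/-- `exp ∑_{i < M} f (y i)`. -/
def expSum (f : ℝ → ℝ) (M : ℕ) (y : ℕ → ℝ) : ℝ≥0∞ :=
  ENNReal.ofReal (Real.exp (∑ i ∈ Finset.range M, f (y i)))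

theorem expSum_eq_prod (f : ℝ → ℝ) (M : ℕ) (y : ℕ → ℝ) :
    expSum f M y = ∏ i ∈ Finset.range M, ENNReal.ofReal (Real.exp (f (y i))) := by
  rw [expSum, Real.exp_sum, ENNReal.ofReal_prod_of_nonneg fun _ _ => (Real.exp_pos _).le]

theorem expSum_measurable {f : ℝ → ℝ} (hf : Measurable f) (M : ℕ) : Measurable (expSum f M) := by
  unfold expSum
  fun_prop

theorem expSum_rpow (f : ℝ → ℝ) (M : ℕ) (y : ℕ → ℝ) (x : ℝ) :
    expSum f M y ^ x = expSum (fun t => x * f t) M y := by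
  rw [expSum, expSum, ENNReal.ofReal_rpow_of_pos (Real.exp_pos _), ← Real.exp_mul, mul_comm,
    Finset.mul_sum]

/-- The integrand is a product over coordinates that are independent under `gaussianSeq`, so each
coordinate undergoes its own one-dimensional step. -/
theorem lintegral_expSum {f : ℝ → ℝ} {K : ℝ≥0} (hf : LipschitzWith K f) {x : ℝ} (hx : 0 < x)
    (M : ℕ) (v : ℝ≥0) (y : ℕ → ℝ) :
    ∫⁻ g, expSum f M (y + g) ^ x ∂(gaussianSeq v) = expSum (parisiStep x v f) M y ^ x := by
  have hc := hf.continuous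
  simp_rw [expSum_rpow, expSum_eq_prod, Pi.add_apply]
  have hm : ∀ i, Measurable fun t => ENNReal.ofReal (Real.exp (x * f (y i + t))) := fun i => by
    fun_prop
  have hi : iIndepFun (fun i (g : ℕ → ℝ) => ENNReal.ofReal (Real.exp (x * f (y i + g i))))
      (gaussianSeq v) := iIndepFun_infinitePi hm
  rw [lintegral_prod_eq_prod_lintegral_of_indepFun _ _ hi
    fun i => (hm i).comp (measurable_pi_apply i)]
  refine Finset.prod_congr rfl fun i _ => ?_
  rw [exp_parisiStep hf hx.ne', ofReal_integral_eq_lintegral_ofReal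
    (LipschitzWith.integrable_exp_gaussian hf x (y i) v) (ae_of_all _ fun _ => (Real.exp_pos _).le),
    ← Measure.infinitePi_map_eval (fun _ : ℕ => gaussianReal 0 v) i, lintegral_map (hm i)
    (measurable_pi_apply i)]

theorem treeNorm_expSum {f : ℝ → ℝ} {K : ℝ≥0} (hf : LipschitzWith K f) (M k : ℕ) {x : ℕ → ℝ}
    (hx : ∀ l, 0 < x l) (v : ℕ → ℝ≥0) (y : ℕ → ℝ) :
    treeNorm (expSum f M) k x (fun l => gaussianSeq (v l)) y = expSum (parisiNest f k x v) M y := by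
  induction k generalizing x v y with
  | zero => rfl
  | succ k ih =>
    have hn := parisiNest_lipschitz hf k (fun l => (hx (l + 1)).le) fun l => v (l + 1)
    rw [treeNorm]
    simp_rw [ih (x := fun l => x (l + 1)) (fun l => hx _) (fun l => v (l + 1))]
    rw [lintegral_expSum hn (hx 0), ← ENNReal.rpow_mul, mul_inv_cancel₀ (hx 0).ne',
      ENNReal.rpow_one]
    rfl

/-- The contribution of the point processes to the expected logarithm of a weighted sum. -/
def treeLogConst (k : ℕ) (x : ℕ → ℝ) : ℝ :=
  (x 0)⁻¹ * Real.log (treeConst k x).toReal + (frullaniConst (x 0) - frullaniConst 1)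

/-- The Laplace transform is the mixture required by `integral_log_of_laplace`. The `M` coordinates
of the root mark contribute equal means, taken with parameter `0`; everything else is a constant of
the levels. -/
theorem integral_log_treeSum {f : ℝ → ℝ} {K : ℝ≥0} (hf : LipschitzWith K f) (M k : ℕ) {x : ℕ → ℝ}
    (hx : ∀ l, 0 < x l) (hxm : ∀ l < k, x l < x (l + 1)) (hx1 : x k = 1) (v : ℕ → ℝ≥0)
    {ρ : List ℕ → Measure (ℕ → ℝ)} [∀ u, IsProbabilityMeasure (ρ u)]
    (hρ : ∀ u, u.length < k → IsREMLaw (ρ u) (x u.length)) {Q : Measure _}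
    (hQ : Q = (Measure.infinitePi ρ).prod (Measure.infinitePi fun u : List ℕ =>
      gaussianSeq (v u.length))) :
    (∀ᵐ p ∂Q, 0 < treeSum (expSum f M) k p.1 p.2 0 ∧ treeSum (expSum f M) k p.1 p.2 0 ≠ ∞) ∧
    Integrable (fun p => Real.log (treeSum (expSum f M) k p.1 p.2 0).toReal) Q ∧
    ∫ p, Real.log (treeSum (expSum f M) k p.1 p.2 0).toReal ∂Q =
      M * parisiStep 0 (v 0) (parisiNest f k x v) 0 + treeLogConst k x := by
  subst hQ
  let F := parisiNest f k x v
  have hF : LipschitzWith K F := parisiNest_lipschitz hf k (fun l => (hx l).le) v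
  have hFc := hF.continuous
  have hc0 := treeConst_ne_zero k (x := x) fun l _ => hx l
  have hct := treeConst_ne_top k (x := x) (fun l _ => hx l) hxm
  have hcp : 0 < (treeConst k x).toReal := ENNReal.toReal_pos hc0 hct
  -- The root `1 / x 0` of the tree constant is absorbed into `W`, so that `c (l N)^{x 0} = (l W)^{x
  -- 0}`.
  let W : (ℕ → ℝ) → ℝ := fun y => (treeConst k x).toReal ^ (x 0)⁻¹ *
    Real.exp (∑ i ∈ Finset.range M, F (y i))
  have hlogW : ∀ y, Real.log (W y) = (x 0)⁻¹ * Real.log (treeConst k x).toReal +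
      ∑ i ∈ Finset.range M, F (y i) := fun y => by
    rw [Real.log_mul (Real.rpow_pos_of_pos hcp _).ne' (Real.exp_pos _).ne', Real.log_exp,
      Real.log_rpow hcp]
  have hmap : ∀ i, (gaussianSeq (v 0)).map (fun y => y i) = gaussianReal 0 (v 0) := fun i =>
    Measure.infinitePi_map_eval (fun _ : ℕ => gaussianReal 0 (v 0)) i
  have hFi0 : Integrable F (gaussianReal 0 (v 0)) := by
    simpa using LipschitzWith.integrable_gaussian hF 0 (v 0)
  have hFi : ∀ i, Integrable (fun y : ℕ → ℝ => F (y i)) (gaussianSeq (v 0)) := fun i => by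
    rw [← hmap i] at hFi0
    exact hFi0.comp_measurable (measurable_pi_apply i)
  have hFint : ∀ i, ∫ y : ℕ → ℝ, F (y i) ∂(gaussianSeq (v 0)) = parisiStep 0 (v 0) F 0 := fun i => by
    rw [parisiStep, if_pos rfl, ← hmap i, integral_map (measurable_pi_apply i).aemeasurable
      (by fun_prop)]
    simp
  have hsum : Integrable (fun y : ℕ → ℝ => ∑ i ∈ Finset.range M, F (y i)) (gaussianSeq (v 0)) :=
    integrable_finsetSum _ fun i _ => hFi i
  have hS : Measurable fun p : (List ℕ → ℕ → ℝ) × (List ℕ → ℕ → ℝ) =>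
      treeSum (expSum f M) k p.1 p.2 0 :=
    (treeSum_measurable (expSum_measurable hf.continuous.measurable M) k).comp
      (f := fun p : (List ℕ → ℕ → ℝ) × (List ℕ → ℕ → ℝ) => (p.1, p.2, 0)) (by fun_prop)
  have key := integral_log_of_laplace (P := (Measure.infinitePi ρ).prod
    (Measure.infinitePi fun u : List ℕ => gaussianSeq (v u.length))) (ν := gaussianSeq (v 0)) (W := W) hS (by fun_prop)
    (fun y => mul_pos (Real.rpow_pos_of_pos hcp _) (Real.exp_pos _))
    (by simp_rw [hlogW]; exact (integrable_const _).add hsum) (hx 0) ?_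
  · refine ⟨key.1, key.2.1, key.2.2.trans ?_⟩
    simp_rw [hlogW]
    rw [integral_add (integrable_const _) hsum, integral_finsetSum _ fun i _ => hFi i]
    simp_rw [hFint]
    simp [treeLogConst, F]
    ring
  · intro l _
    have hm : Measurable fun p : (List ℕ → ℕ → ℝ) × (List ℕ → ℕ → ℝ) =>
        nexp (ENNReal.ofReal l * treeSum (expSum f M) k p.1 p.2 0) :=
      nexp_measurable.comp (measurable_const.mul hS)
    rw [lintegral_prod _ hm.aemeasurable, laplace_treeSum (γ := fun l => gaussianSeq (v l))
      (expSum_measurable hf.continuous.measurable M) k (fun l _ => hx l) hx1 hρ]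
    refine lintegral_congr fun y => ?_
    rw [zero_add, treeNorm_expSum hf M k hx, ENNReal.ofReal_mul (Real.rpow_pos_of_pos hcp _).le,
      ← ENNReal.ofReal_rpow_of_pos hcp, ENNReal.ofReal_toReal hct, mul_left_comm,
      ENNReal.mul_rpow_of_nonneg (_ ^ _) _ (hx 0).le, ← ENNReal.rpow_mul, inv_mul_cancel₀ (hx 0).ne',
      ENNReal.rpow_one]
    rfl

end RPC
end

noncomputable section

namespace RPC

/-! ### Weighted sums over the leaves of a GREM -/

/-- The inner node as a finite sequence. -/
def nodePath {k : ℕ} (n : Node k) : List ℕ := List.ofFn n.2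

theorem nodePath_injective {k : ℕ} : Function.Injective (nodePath : Node k → List ℕ) := by
  rintro ⟨l, a⟩ ⟨l', a'⟩ h
  have h1 : l = l' := Fin.ext (by simpa [nodePath] using congrArg List.length h)
  subst h1
  have h2 : a = a' := List.ofFn_injective h
  rw [h2]

theorem nodePath_trunc {k : ℕ} (α : Fin k → ℕ) (l : Fin k) :
    nodePath (trunc α l) = (List.ofFn α).take l := by
  refine List.ext_getElem (by simp [nodePath, trunc]) fun i h1 h2 => ?_
  simp [nodePath, trunc]

theorem exists_nodePath_eq {k : ℕ} {u : List ℕ} (hu : u.length < k) :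
    ∃ n : Node k, nodePath n = u ∧ (n.1 : ℕ) = u.length :=
  ⟨⟨⟨u.length, hu⟩, u.get⟩, List.ofFn_get u, rfl⟩

theorem remIntensity_Iic_zero (x : ℝ) : remIntensity x (Set.Iic 0) = 0 := by
  refine withDensity_absolutelyContinuous _ _ ?_
  rw [Measure.restrict_apply measurableSet_Iic, Set.Iic_inter_Ioi, Set.Ioc_self, measure_empty]

section Transfer

variable {Ω : Type} [MeasurableSpace Ω] {P : Measure Ω}

theorem IsREM.isREMLaw [IsProbabilityMeasure P] {z : ℕ → Ω → ℝ} {x : ℝ} (hz : IsREM P z x) :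
    IsREMLaw (P.map fun ω j => z j ω) x := by
  intro h hh h1
  rw [lintegral_map (f := fun w : ℕ → ℝ => infProd fun j => h (w j))
    (infProd_measurable fun j => hh.comp (measurable_pi_apply j)) (measurable_pi_lambda _ hz.measurable)]
  exact hz.lintegral_infProd hh h1

/-- The laws of the point processes of a GREM, indexed by all finite sequences. -/
def nodeLaw {k : ℕ} (P : Measure Ω) (ζ : Node k → ℕ → Ω → ℝ) : List ℕ → Measure (ℕ → ℝ) :=
  Function.extend nodePath (fun n => P.map fun ω j => ζ n j ω) fun _ => Measure.dirac 0

theorem nodeLaw_nodePath {k : ℕ} (ζ : Node k → ℕ → Ω → ℝ) (n : Node k) :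
    nodeLaw P ζ (nodePath n) = P.map fun ω j => ζ n j ω :=
  nodePath_injective.extend_apply _ _ n

variable [IsProbabilityMeasure P]

theorem isProbabilityMeasure_nodeLaw {k : ℕ} {ζ : Node k → ℕ → Ω → ℝ}
    (hζ : ∀ n j, Measurable (ζ n j)) (u : List ℕ) : IsProbabilityMeasure (nodeLaw P ζ u) := by
  by_cases h : ∃ n : Node k, nodePath n = u
  · obtain ⟨n, rfl⟩ := h
    rw [nodeLaw_nodePath]
    exact Measure.isProbabilityMeasure_map (measurable_pi_lambda _ (hζ n)).aemeasurable
  · rw [nodeLaw, Function.extend_apply' _ _ _ h]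
    infer_instance

/-- The sum `∑_α ξ_α exp ∑_{i < M} f (X^i_α)`. -/
def leafSum {k : ℕ} (f : ℝ → ℝ) (M : ℕ) (p : (Node k → ℕ → ℝ) × (ℕ → (Fin k → ℕ) → ℝ)) : ℝ≥0∞ :=
  ∑' α : Fin k → ℕ, (∏ l : Fin k, ENNReal.ofReal (p.1 (trunc α l) (α l))) *
    expSum f M fun i => p.2 i α

theorem leafSum_measurable {k : ℕ} {f : ℝ → ℝ} (hf : Measurable f) (M : ℕ) :
    Measurable (leafSum (k := k) f M) := by
  refine Measurable.tsum fun α => Measurable.mul (by fun_prop) ?_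
  exact (expSum_measurable hf M).comp (by fun_prop)

theorem leafSum_eq_treeSum {k : ℕ} (f : ℝ → ℝ) (M : ℕ) (z : List ℕ → ℕ → ℝ) (G : List ℕ → ℕ → ℝ) :
    leafSum f M ((fun n : Node k => z (nodePath n)), fun i (α : Fin k → ℕ) => pathSum G α i) =
      treeSum (expSum f M) k z G 0 := by
  rw [treeSum_eq_tsum]
  refine tsum_congr fun α => ?_
  simp_rw [nodePath_trunc, zero_add]

variable {m : AtomicMeasureOne} {ζ : Node m.1.k → ℕ → Ω → ℝ} {X : ℕ → (Fin m.1.k → ℕ) → Ω → ℝ}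
  {v : ℕ → ℝ≥0} {g : ℝ → ℝ}

/-- Points and fields of an arbitrary GREM have jointly the law of the explicit tree model, so
statements about their law may be proved there. Vertices that are not inner nodes receive the dummy
law of `nodeLaw`, which is never read. -/
theorem map_points_fields_eq (hζ : ∀ n j, Measurable (ζ n j))
    (hiζ : iIndepFun (fun (n : Node m.1.k) ω j => ζ n j ω) P)
    (hv : ∀ s : Fin (m.1.k + 1), ∑ l ∈ Finset.range (s + 1), (v l : ℝ) = g (m.1.q s))
    (hX : ∀ i, IsCentredGaussianField P (X i) fun α α' => g (overlap m.1 α α'))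
    (hiX : iIndepFun (fun i ω α => X i α ω) P)
    (hi : IndepFun (fun ω n j => ζ n j ω) (fun ω i α => X i α ω) P) :
    P.map (fun ω => ((fun n j => ζ n j ω), fun i α => X i α ω)) =
      ((Measure.infinitePi (nodeLaw P ζ)).prod (Measure.infinitePi fun u : List ℕ =>
        gaussianSeq (v u.length))).map
        fun p : (List ℕ → ℕ → ℝ) × (List ℕ → ℕ → ℝ) =>
          ((fun n => p.1 (nodePath n)), fun i α => pathSum p.2 α i) := by
  have := isProbabilityMeasure_nodeLaw (P := P) hζ
  have hζm : Measurable fun ω n j => ζ n j ω :=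
    measurable_pi_lambda _ fun n => measurable_pi_lambda _ (hζ n)
  have hXm : Measurable fun ω i α => X i α ω :=
    measurable_pi_lambda _ fun i => measurable_pi_lambda _ (hX i).measurable
  have hpm : Measurable fun (G : List ℕ → ℕ → ℝ) i (α : Fin m.1.k → ℕ) => pathSum G α i := by
    unfold pathSum
    simp_rw [Finset.sum_apply]
    fun_prop
  rw [(indepFun_iff_map_prod_eq_prod_map_map hζm.aemeasurable hXm.aemeasurable).1 hi,
    map_fields_eq m.1 hv hX hiX,
    (iIndepFun_iff_map_fun_eq_infinitePi_map fun n => measurable_pi_lambda _ (hζ n)).1 hiζ]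
  simp_rw [← nodeLaw_nodePath (P := P) ζ]
  rw [← Measure.map_infinitePi_infinitePi_of_inj (P := nodeLaw P ζ) nodePath_injective,
    Measure.map_prod_map _ _ (by fun_prop) hpm]
  rfl

/-- The expected logarithm of the sum `∑_α ξ_α exp ∑_{i < M} f (X^i_α)`. -/
theorem integral_log_leafSum (hrem : ∀ n : Node m.1.k, IsREM P (ζ n) (m.1.x n.1.castSucc))
    (hiζ : iIndepFun (fun (n : Node m.1.k) ω j => ζ n j ω) P)
    (hv : ∀ s : Fin (m.1.k + 1), ∑ l ∈ Finset.range (s + 1), (v l : ℝ) = g (m.1.q s))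
    (hX : ∀ i, IsCentredGaussianField P (X i) fun α α' => g (overlap m.1 α α'))
    (hiX : iIndepFun (fun i ω α => X i α ω) P)
    (hi : IndepFun (fun ω n j => ζ n j ω) (fun ω i α => X i α ω) P)
    {f : ℝ → ℝ} {K : ℝ≥0} (hf : LipschitzWith K f) (M : ℕ) :
    (∀ᵐ ω ∂P, 0 < leafSum f M ((fun n j => ζ n j ω), fun i α => X i α ω) ∧
      leafSum f M ((fun n j => ζ n j ω), fun i α => X i α ω) ≠ ∞) ∧
    Integrable (fun ω => Real.log
      (leafSum f M ((fun n j => ζ n j ω), fun i α => X i α ω)).toReal) P ∧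
    ∫ ω, Real.log (leafSum f M ((fun n j => ζ n j ω), fun i α => X i α ω)).toReal ∂P =
      M * parisiStep 0 (v 0) (parisiNest f m.1.k (fun l => m.1.level (l + 1)) v) 0 +
        treeLogConst m.1.k fun l => m.1.level (l + 1) := by
  have hζ : ∀ n j, Measurable (ζ n j) := fun n => (hrem n).measurable
  have := isProbabilityMeasure_nodeLaw (P := P) hζ
  have hlev : ∀ l (hl : l < m.1.k + 1), m.1.level (l + 1) = m.1.x ⟨l, hl⟩ := fun l hl =>
    m.1.level_succ ⟨l, hl⟩
  have hx : ∀ l, 0 < m.1.level (l + 1) := fun l => by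
    rw [AtomicMeasure.level]
    split_ifs
    · exact m.1.x_pos _
    · exact one_pos
  obtain ⟨h1, h2, h3⟩ := integral_log_treeSum (x := fun l => m.1.level (l + 1)) hf M m.1.k hx
    (fun l hl => by
      rw [hlev l (by omega), hlev (l + 1) (by omega)]
      exact m.1.x_strictMono (Fin.mk_lt_mk.2 (Nat.lt_succ_self l)))
    ((hlev _ (Nat.lt_succ_self _)).trans m.1.x_last) v (ρ := nodeLaw P ζ)
    (fun u hu => by
      obtain ⟨n, rfl, hn⟩ := exists_nodePath_eq hu
      rw [nodeLaw_nodePath, ← hn, hlev _ (by omega)]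
      exact (hrem n).isREMLaw) rfl
  have hL := leafSum_measurable (k := m.1.k) hf.continuous.measurable M
  have hJ : Measurable fun ω => ((fun n j => ζ n j ω), fun i α => X i α ω) :=
    (measurable_pi_lambda _ fun n => measurable_pi_lambda _ (hζ n)).prodMk
      (measurable_pi_lambda _ fun i => measurable_pi_lambda _ (hX i).measurable)
  have hT : Measurable fun p : (List ℕ → ℕ → ℝ) × (List ℕ → ℕ → ℝ) =>
      ((fun n : Node m.1.k => p.1 (nodePath n)), fun i (α : Fin m.1.k → ℕ) => pathSum p.2 α i) := by
    unfold pathSum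
    simp_rw [Finset.sum_apply]
    fun_prop
  have hmap := map_points_fields_eq hζ hiζ hv hX hiX hi
  have hlog : Measurable fun p => Real.log (leafSum (k := m.1.k) f M p).toReal :=
    Real.measurable_log.comp hL.ennreal_toReal
  simp_rw [← leafSum_eq_treeSum] at h1 h2 h3
  refine ⟨?_, ?_, ?_⟩
  · have hs : MeasurableSet {p | 0 < leafSum (k := m.1.k) f M p ∧ leafSum f M p ≠ ∞} :=
      (measurableSet_lt measurable_const hL).inter (hL (measurableSet_singleton ∞).compl)
    refine (ae_map_iff hJ.aemeasurable hs).1 ?_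
    rw [hmap]
    exact (ae_map_iff hT.aemeasurable hs).2 h1
  · refine (integrable_map_measure hlog.aestronglyMeasurable hJ.aemeasurable).1 ?_
    rw [hmap]
    exact (integrable_map_measure hlog.aestronglyMeasurable hT.aemeasurable).2 h2
  · refine (integral_map hJ.aemeasurable hlog.aestronglyMeasurable).symm.trans ?_
    rw [hmap]
    exact (integral_map hT.aemeasurable hlog.aestronglyMeasurable).trans h3

/-- The intensity gives no mass to `(-∞, 0]`. This makes the real-valued weights agree with the
`[0,∞]`-valued ones, where negative points are truncated to `0`. -/
theorem ae_points_pos (hrem : ∀ n : Node m.1.k, IsREM P (ζ n) (m.1.x n.1.castSucc)) :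
    ∀ᵐ ω ∂P, ∀ n j, 0 < ζ n j ω := by
  refine ae_all_iff.2 fun n => ?_
  filter_upwards [(hrem n).ae_mem measurableSet_Iic (remIntensity_Iic_zero _)] with ω h j
  exact not_le.1 (h j)

/-- The sum `∑_α ξ_α exp ∑_{i < M} f (X^i_α)` is almost surely finite and positive, and its
logarithm is integrable. -/
theorem integral_log_tsum (hrem : ∀ n : Node m.1.k, IsREM P (ζ n) (m.1.x n.1.castSucc))
    (hiζ : iIndepFun (fun (n : Node m.1.k) ω j => ζ n j ω) P)
    (hv : ∀ s : Fin (m.1.k + 1), ∑ l ∈ Finset.range (s + 1), (v l : ℝ) = g (m.1.q s))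
    (hX : ∀ i, IsCentredGaussianField P (X i) fun α α' => g (overlap m.1 α α'))
    (hiX : iIndepFun (fun i ω α => X i α ω) P)
    (hi : IndepFun (fun ω n j => ζ n j ω) (fun ω i α => X i α ω) P)
    {f : ℝ → ℝ} {K : ℝ≥0} (hf : LipschitzWith K f) (M : ℕ) {u : (Fin m.1.k → ℕ) → Ω → ℝ}
    (hu : ∀ α ω, u α ω = ∏ i ∈ Finset.range M, Real.exp (f (X i α ω))) :
    (∀ᵐ ω ∂P, Summable (fun α => cascadeWeight ζ α ω * u α ω) ∧
      0 < ∑' α, cascadeWeight ζ α ω * u α ω) ∧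
    Integrable (fun ω => Real.log (∑' α, cascadeWeight ζ α ω * u α ω)) P ∧
    ∫ ω, Real.log (∑' α, cascadeWeight ζ α ω * u α ω) ∂P =
      M * parisiStep 0 (v 0) (parisiNest f m.1.k (fun l => m.1.level (l + 1)) v) 0 +
        treeLogConst m.1.k fun l => m.1.level (l + 1) := by
  obtain ⟨h1, h2, h3⟩ := integral_log_leafSum hrem hiζ hv hX hiX hi hf M
  have hnn : ∀ ω, (∀ n j, 0 < ζ n j ω) → ∀ α, 0 ≤ cascadeWeight ζ α ω * u α ω := fun ω h α => by
    rw [hu]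
    exact mul_nonneg (Finset.prod_nonneg fun l _ => (h _ _).le)
      (Finset.prod_nonneg fun l _ => (Real.exp_pos _).le)
  have heq : ∀ ω, (∀ n j, 0 < ζ n j ω) →
      leafSum f M ((fun n j => ζ n j ω), fun i α => X i α ω) =
        ∑' α, ENNReal.ofReal (cascadeWeight ζ α ω * u α ω) := fun ω h => by
    refine tsum_congr fun α => ?_
    rw [ENNReal.ofReal_mul (by exact Finset.prod_nonneg fun l _ => (h _ _).le), cascadeWeight,
      ENNReal.ofReal_prod_of_nonneg fun l _ => (h _ _).le, expSum_eq_prod, hu,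
      ENNReal.ofReal_prod_of_nonneg fun l _ => (Real.exp_pos _).le]
  -- No finiteness is needed here: if the sum is infinite, both `toReal` and the real `tsum` take
  -- the default value `0`.
  have htr : ∀ ω, (∀ n j, 0 < ζ n j ω) →
      (leafSum f M ((fun n j => ζ n j ω), fun i α => X i α ω)).toReal =
        ∑' α, cascadeWeight ζ α ω * u α ω := fun ω h => by
    rw [heq ω h, ENNReal.tsum_toReal_eq fun _ => ENNReal.ofReal_ne_top]
    exact tsum_congr fun α => ENNReal.toReal_ofReal (hnn ω h α)
  have hpos := ae_points_pos hrem
  have hae : (fun ω => Real.log (leafSum f M ((fun n j => ζ n j ω), fun i α => X i α ω)).toReal)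
      =ᵐ[P] fun ω => Real.log (∑' α, cascadeWeight ζ α ω * u α ω) := by
    filter_upwards [hpos] with ω h
    rw [htr ω h]
  refine ⟨?_, h2.congr hae, (integral_congr_ae hae).symm.trans h3⟩
  filter_upwards [h1, hpos] with ω hω h
  refine ⟨?_, htr ω h ▸ ENNReal.toReal_pos hω.1.ne' hω.2⟩
  have := ENNReal.summable_toReal (heq ω h ▸ hω.2)
  exact this.congr fun α => ENNReal.toReal_ofReal (hnn ω h α)

end Transfer

end RPC
end

noncomputable section

namespace RPC

/-! ### The functionals of a GREM -/

theorem sum_range_toNNReal_sub {b : ℕ → ℝ} (hb : Monotone b) (n : ℕ) :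
    ∑ l ∈ Finset.range n, ((b (l + 1) - b l).toNNReal : ℝ) = b n - b 0 := by
  rw [← Finset.sum_range_sub]
  exact Finset.sum_congr rfl fun l _ =>
    Real.coe_toNNReal _ (sub_nonneg.2 (hb (Nat.le_succ l)))

namespace AtomicMeasure

/-- The variances of the increments of the field with covariance `g q = q`. -/
def increment (m : AtomicMeasure) (l : ℕ) : ℝ≥0 := (m.point (l + 1) - m.point l).toNNReal

/-- The variances of the increments of the field with covariance `g q = q ^ 2 / 2`. -/
def sqIncrement (m : AtomicMeasure) (l : ℕ) : ℝ≥0 :=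
  (m.point (l + 1) ^ 2 / 2 - m.point l ^ 2 / 2).toNNReal

variable (m : AtomicMeasure)

theorem sum_increment (s : Fin (m.k + 1)) :
    ∑ l ∈ Finset.range (s + 1), (m.increment l : ℝ) = m.q s := by
  rw [← m.point_succ]
  exact (sum_range_toNNReal_sub m.point_monotone _).trans (sub_zero _)

theorem monotone_point_sq : Monotone fun l => m.point l ^ 2 / 2 := fun i j hij => by
  have := m.point_monotone hij
  have := m.point_nonneg i
  simp only
  gcongr

theorem sum_sqIncrement (s : Fin (m.k + 1)) :
    ∑ l ∈ Finset.range (s + 1), (m.sqIncrement l : ℝ) = m.q s ^ 2 / 2 := by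
  rw [← m.point_succ]
  refine (sum_range_toNNReal_sub m.monotone_point_sq _).trans ?_
  simp [point]

end AtomicMeasure

theorem parisiStep_linear (x : ℝ) (v : ℝ≥0) (β c y : ℝ) :
    parisiStep x v (fun y => β * y + c) y = β * y + c + x * (β ^ 2 / 2 * v) := by
  rw [parisiStep]
  split_ifs with hx
  · have h : ∀ g, β * (y + g) + c = β * g + (β * y + c) := fun g => by ring
    simp_rw [h, hx]
    rw [integral_add (by exact (IsGaussian.integrable_id (μ := gaussianReal 0 v)).const_mul β) (integrable_const _),
      integral_const_mul, integral_id_gaussianReal]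
    simp
  · have h : ∀ g, Real.exp (x * (β * (y + g) + c)) =
        Real.exp (x * (β * y + c)) * Real.exp (x * β * g) := fun g => by
      rw [← Real.exp_add]
      ring_nf
    simp_rw [h]
    have h2 : ∫ g, Real.exp (x * β * g) ∂(gaussianReal 0 v) = Real.exp (v * (x * β) ^ 2 / 2) := by
      have := congrFun (mgf_id_gaussianReal (μ := 0) (v := v)) (x * β)
      simpa [mgf] using this
    rw [integral_const_mul, h2, ← Real.exp_add, Real.log_exp]
    field_simp

/-- A step maps a linear function to itself plus the constant `x β² v / 2`, so the nest only
accumulates constants. -/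
theorem parisiNest_linear (β : ℝ) (k : ℕ) (x : ℕ → ℝ) (v : ℕ → ℝ≥0) (y : ℝ) :
    parisiNest (fun y => β * y) k x v y =
      β * y + β ^ 2 / 2 * ∑ l ∈ Finset.range k, x l * v (l + 1) := by
  induction k generalizing x v y with
  | zero => simp [parisiNest]
  | succ k ih =>
    rw [parisiNest, funext (ih _ _), parisiStep_linear, Finset.sum_range_succ']
    ring

section GREM

variable {m : AtomicMeasureOne}

theorem AtomicMeasureOne.point_eq_one (m : AtomicMeasureOne) : m.1.point (m.1.k + 1) = 1 :=
  (m.1.point_succ (Fin.last _)).trans m.2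

/-- The root mark has variance `q_0` and corresponds to the first interval, with value `0`. The last
interval `[q_k, 1]` is degenerate because of the atom at `1`, so the flow has one trivial step more
than the tree. -/
theorem parisiNest_eq_parisiFunctional (f : ℝ → ℝ) (m : AtomicMeasureOne) :
    parisiStep 0 (m.1.increment 0)
      (parisiNest f m.1.k (fun l => m.1.level (l + 1)) m.1.increment) 0 =
      parisiFunctional f m.1 := by
  rw [parisiFunctional, parisiFlow_eq_nest _ m.1.point_monotone (show (0 : ℝ) ≤ m.1.point 0 from le_rfl)]
  have h : (m.1.point (m.1.k + 2) - m.1.point (m.1.k + 1)).toNNReal = 0 := by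
    rw [m.1.point_last, m.point_eq_one, sub_self, Real.toNNReal_zero]
  rw [parisiNest_succ, show m.1.k + 1 + 1 - 1 = m.1.k + 1 from rfl, h, parisiStep_zero]
  rfl

/-- The increments of `q² / 2` are the integrals of `r dr` over the intervals on which the
distribution function is constant. The first interval has value `0` and the last is degenerate, so
neither contributes. -/
theorem parisiNest_linear_eq (β : ℝ) (m : AtomicMeasureOne) :
    parisiStep 0 (m.1.sqIncrement 0)
      (parisiNest (fun y => β * y) m.1.k (fun l => m.1.level (l + 1)) m.1.sqIncrement) 0 =
      β ^ 2 / 2 * ∫ r in (0 : ℝ)..1, m.1.cdf r * r := by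
  rw [funext (parisiNest_linear β _ _ _), parisiStep_linear, m.1.integral_cdf_mul,
    Finset.sum_range_succ', Finset.sum_range_succ, m.1.point_last, m.point_eq_one]
  simp only [mul_zero, zero_add, zero_mul, add_zero, sub_self, zero_div, AtomicMeasure.level]
  congr 1
  refine Finset.sum_congr rfl fun l _ => ?_
  rw [AtomicMeasure.sqIncrement, Real.coe_toNNReal _ (sub_nonneg.2
    (m.1.monotone_point_sq (Nat.le_succ _))), sub_div]

/-- The common term `c`, which carries the contribution of the point processes, cancels between
numerator and denominator. -/
theorem LogRatio.of_log {A Ω : Type} [MeasurableSpace Ω] {P : Measure Ω} {ξ u v : A → Ω → ℝ}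
    {a b c : ℝ}
    (hu : (∀ᵐ ω ∂P, Summable (fun α => ξ α ω * u α ω) ∧ 0 < ∑' α, ξ α ω * u α ω) ∧
      Integrable (fun ω => Real.log (∑' α, ξ α ω * u α ω)) P ∧
      ∫ ω, Real.log (∑' α, ξ α ω * u α ω) ∂P = a + c)
    (hv : (∀ᵐ ω ∂P, Summable (fun α => ξ α ω * v α ω) ∧ 0 < ∑' α, ξ α ω * v α ω) ∧
      Integrable (fun ω => Real.log (∑' α, ξ α ω * v α ω)) P ∧
      ∫ ω, Real.log (∑' α, ξ α ω * v α ω) ∂P = b + c) :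
    LogRatioWellDefined P ξ u v ∧ ∫ ω, logRatio ξ u v ω ∂P = a - b := by
  have h : (fun ω => Real.log (∑' α, ξ α ω * u α ω) - Real.log (∑' α, ξ α ω * v α ω)) =ᵐ[P]
      logRatio ξ u v := by
    filter_upwards [hu.1, hv.1] with ω h1 h2
    rw [logRatio, Real.log_div h1.2.ne' h2.2.ne']
  refine ⟨⟨hu.1, hv.1, (hu.2.1.sub hv.2.1).congr h⟩, ?_⟩
  rw [← integral_congr_ae h, integral_sub hu.2.1 hv.2.1, hu.2.2, hv.2.2]
  ring

theorem exp_logCosh (β h y : ℝ) : Real.exp (logCosh β h y) = 2 * Real.cosh (β * y + h) :=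
  Real.exp_log (mul_pos two_pos (Real.cosh_pos _))

theorem lipschitzWith_const_mul (β : ℝ) : LipschitzWith ‖β‖₊ fun y : ℝ => β * y :=
  lipschitzWith_smul β

/-- The expected logarithm of a weighted sum over the cavity fields of a GREM. -/
theorem GREM.integral_log_eta (μ : GREM m) {f : ℝ → ℝ} {K : ℝ≥0} (hf : LipschitzWith K f) (M : ℕ)
    {u : (Fin m.1.k → ℕ) → μ.Ω → ℝ}
    (hu : ∀ α ω, u α ω = ∏ i ∈ Finset.range M, Real.exp (f (μ.η i α ω))) :
    (∀ᵐ ω ∂μ.P, Summable (fun α => μ.ξ α ω * u α ω) ∧ 0 < ∑' α, μ.ξ α ω * u α ω) ∧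
    Integrable (fun ω => Real.log (∑' α, μ.ξ α ω * u α ω)) μ.P ∧
    ∫ ω, Real.log (∑' α, μ.ξ α ω * u α ω) ∂μ.P =
      M * parisiFunctional f m.1 + treeLogConst m.1.k fun l => m.1.level (l + 1) := by
  rw [← parisiNest_eq_parisiFunctional]
  exact integral_log_tsum (g := fun q => q) μ.rem μ.indep_ζ m.1.sum_increment μ.field_η μ.indep_η
    (μ.indep_ζ_fields.comp measurable_id measurable_fst) hf M hu

/-- The expected logarithm of a weighted sum over the fields `κ` of a GREM. -/
theorem GREM.integral_log_kappa (μ : GREM m) (β : ℝ) (M : ℕ) {u : (Fin m.1.k → ℕ) → μ.Ω → ℝ}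
    (hu : ∀ α ω, u α ω = ∏ i ∈ Finset.range M, Real.exp (β * μ.κ i α ω)) :
    (∀ᵐ ω ∂μ.P, Summable (fun α => μ.ξ α ω * u α ω) ∧ 0 < ∑' α, μ.ξ α ω * u α ω) ∧
    Integrable (fun ω => Real.log (∑' α, μ.ξ α ω * u α ω)) μ.P ∧
    ∫ ω, Real.log (∑' α, μ.ξ α ω * u α ω) ∂μ.P =
      M * (β ^ 2 / 2 * ∫ r in (0 : ℝ)..1, m.1.cdf r * r) +
        treeLogConst m.1.k fun l => m.1.level (l + 1) := by
  rw [← parisiNest_linear_eq]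
  exact integral_log_tsum (g := fun q => q ^ 2 / 2) μ.rem μ.indep_ζ m.1.sum_sqIncrement μ.field_κ
    μ.indep_κ (μ.indep_ζ_fields.comp measurable_id measurable_snd) (lipschitzWith_const_mul β) M hu

/-- Both mean logarithms are `M` times a quantity free of `M` plus the same constant, so the
prefactor `1 / M` removes all dependence on `M`, and only the parameter of the GREM remains. -/
theorem GREM.asFunctional_eq (μ : GREM m) (β h : ℝ) {M : ℕ} (hM : 1 ≤ M) :
    AsWellDefined M β h μ ∧ asFunctional M β h μ = limitFunctional β h m.1 := by
  have key := LogRatio.of_log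
    (μ.integral_log_eta (logCosh_lipschitz β h) M (u := coshFactor β h M μ.η)
      fun α ω => Finset.prod_congr rfl fun i _ => (exp_logCosh _ _ _).symm)
    (μ.integral_log_kappa β M (u := expFactor β M μ.κ) fun α ω => rfl)
  refine ⟨key.1, ?_⟩
  have hM' : (M : ℝ) ≠ 0 := by positivity
  rw [asFunctional, key.2, limitFunctional]
  field_simp

/-- The denominator `∑_α ξ_α` is the weighted sum with `M = 0`, an empty product. -/
theorem GREM.rpcFunctional_eta (μ : GREM m) {f : ℝ → ℝ} {K : ℝ≥0} (hf : LipschitzWith K f) :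
    RpcWellDefined f μ (μ.η 0) ∧ rpcFunctional f μ (μ.η 0) = parisiFunctional f m.1 := by
  have key := LogRatio.of_log
    (μ.integral_log_eta hf 1 (u := fun α ω => Real.exp (f (μ.η 0 α ω))) (by simp))
    (μ.integral_log_eta hf 0 (u := fun _ _ => 1) (by simp))
  refine ⟨key.1, key.2.trans ?_⟩
  simp

theorem GREM.rpcFunctional_kappa (μ : GREM m) (β : ℝ) :
    RpcWellDefined (fun y => β * y) μ (μ.κ 0) ∧ rpcFunctional (fun y => β * y) μ (μ.κ 0) =
      β ^ 2 / 2 * ∫ r in (0 : ℝ)..1, m.1.cdf r * r := by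
  have key := LogRatio.of_log
    (μ.integral_log_kappa β 1 (u := fun α ω => Real.exp (β * μ.κ 0 α ω)) (by simp))
    (μ.integral_log_kappa β 0 (u := fun _ _ => 1) (by simp))
  refine ⟨key.1, key.2.trans ?_⟩
  simp

end GREM

/-- Existence of a GREM for every parameter is what makes each value of the limiting functional
attained. -/
theorem asValues_eq_range (hex : ∀ m : AtomicMeasureOne, Nonempty (GREM m)) (β h : ℝ) {M : ℕ}
    (hM : 1 ≤ M) :
    asValues M β h = Set.range fun m : AtomicMeasureOne => limitFunctional β h m.1 := by
  ext v
  constructor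
  · rintro ⟨m, μ, rfl⟩
    exact ⟨m, (μ.asFunctional_eq β h hM).2.symm⟩
  · rintro ⟨m, rfl⟩
    obtain ⟨μ⟩ := hex m
    exact ⟨m, μ, (μ.asFunctional_eq β h hM).2.symm⟩

theorem bddBelow_range_limitFunctional (β h : ℝ) : BddBelow (Set.range (limitFunctional β h)) :=
  ⟨_, Set.forall_mem_range.2 (limitFunctional_ge β h)⟩

end RPC
end

noncomputable section

namespace RPC

/-! ### Poisson processes are characterized by their Laplace functional -/

theorem nexp_injective : Function.Injective nexp := fun a b h => by
  have h1 := EReal.exp_strictMono.injective (inv_injective h)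
  exact_mod_cast h1

open BoundedContinuousFunction in
/-- The function `exp (-∑_i s_i y_i)`. -/
def expCharacter {n : ℕ} : Multiplicative (Fin n → ℕ) →* ((Fin n → ℝ≥0∞) →ᵇ ℝ) where
  toFun s := ofNormedAddCommGroup (fun y => (nexp (∑ i, s.toAdd i * y i)).toReal)
    (ENNReal.continuousOn_toReal.comp_continuous (nexp_continuous.comp (continuous_finsetSum _
      fun i _ => (ENNReal.continuous_const_mul (ENNReal.natCast_ne_top _)).comp
        (continuous_apply i))) fun y => nexp_ne_top _) 1 fun y => by
      rw [Real.norm_eq_abs, abs_of_nonneg ENNReal.toReal_nonneg]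
      exact ENNReal.toReal_le_of_le_ofReal zero_le_one (by simpa using nexp_le_one _)
  map_one' := by ext; simp
  map_mul' s t := by
    ext y
    simp [add_mul, Finset.sum_add_distrib, nexp_add]

theorem expCharacter_apply {n : ℕ} (s : Multiplicative (Fin n → ℕ)) (y : Fin n → ℝ≥0∞) :
    expCharacter s y = (nexp (∑ i, s.toAdd i * y i)).toReal := rfl

/-- A law on `[0,∞]^n` is determined by its Laplace transform. -/
theorem ext_of_laplace {n : ℕ} {μ ν : Measure (Fin n → ℝ≥0∞)} [IsProbabilityMeasure μ]
    [IsProbabilityMeasure ν]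
    (h : ∀ s : Fin n → ℕ, ∫⁻ y, nexp (∑ i, s i * y i) ∂μ = ∫⁻ y, nexp (∑ i, s i * y i) ∂ν) :
    μ = ν := by
  let A : StarSubalgebra ℝ (BoundedContinuousFunction (Fin n → ℝ≥0∞) ℝ) :=
    { Algebra.adjoin ℝ (Set.range (expCharacter (n := n))) with
      star_mem' := fun {a} ha => by
        have : star a = a := by ext; simp
        rwa [this] }
  -- The exponentials are closed under products, so the algebra they generate is their linear span,
  -- and agreement of integrals need only be checked on them.
  have hA : ∀ g, g ∈ A ↔ g ∈ Submodule.span ℝ (Set.range (expCharacter (n := n))) := fun g => by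
    rw [← MonoidHom.coe_mrange, ← Submonoid.closure_eq (MonoidHom.mrange expCharacter),
      ← Algebra.adjoin_eq_span, MonoidHom.coe_mrange]
    rfl
  have hm : ∀ s : Fin n → ℕ, Measurable fun y : Fin n → ℝ≥0∞ => nexp (∑ i, s i * y i) := fun s =>
    nexp_measurable.comp (by fun_prop)
  refine ext_of_forall_mem_subalgebra_integral_eq_of_polish (A := A) ?_ fun g hg => ?_
  · intro y y' hyy
    obtain ⟨i, hi⟩ := Function.ne_iff.1 hyy
    -- Points are separated by the exponential of a single coordinate in which they differ, `nexp`
    -- being injective on `[0,∞]`.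
    refine ⟨_, ⟨_, ⟨expCharacter (Multiplicative.ofAdd (Pi.single i 1)),
      Algebra.subset_adjoin ⟨_, rfl⟩, rfl⟩, rfl⟩, fun he => hi (nexp_injective ?_)⟩
    have h1 : ∀ y : Fin n → ℝ≥0∞,
        ∑ j, (((Pi.single i 1 : Fin n → ℕ) j : ℕ) : ℝ≥0∞) * y j = y i := fun y => by
      rw [Finset.sum_eq_single i (fun j _ hj => by simp [hj]) (by simp)]
      simp
    have h2 : (nexp (∑ j, (((Pi.single i 1 : Fin n → ℕ) j : ℕ) : ℝ≥0∞) * y j)).toReal =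
        (nexp (∑ j, (((Pi.single i 1 : Fin n → ℕ) j : ℕ) : ℝ≥0∞) * y' j)).toReal := he
    rwa [h1, h1, ENNReal.toReal_eq_toReal_iff' (nexp_ne_top _) (nexp_ne_top _)] at h2
  · rw [hA] at hg
    induction hg using Submodule.span_induction with
    | mem g hg =>
      obtain ⟨s, rfl⟩ := hg
      simp_rw [expCharacter_apply]
      rw [integral_toReal (hm _).aemeasurable (ae_of_all _ fun y => (nexp_ne_top _).lt_top),
        integral_toReal (hm _).aemeasurable (ae_of_all _ fun y => (nexp_ne_top _).lt_top), h]
    | zero => simp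
    | add g g' _ _ h1 h2 =>
      simp only [BoundedContinuousFunction.coe_add, Pi.add_apply]
      rw [integral_add (g.integrable _) (g'.integrable _),
        integral_add (g.integrable _) (g'.integrable _), h1, h2]
    | smul c g _ h1 =>
      simp only [BoundedContinuousFunction.coe_smul]
      rw [integral_smul, integral_smul, h1]

section Characterization

variable {Ω : Type} [MeasurableSpace Ω] {P : Measure Ω} {z : ℕ → Ω → ℝ} {Λ : Measure ℝ}

/-- The combination of counts is the sum over the points of a function constant on each `B i`.
Disjointness makes the exponent additive over `i`, which is where independence of the counts comes
from. -/
theorem lintegral_nexp_sum_count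
    (hL : ∀ f : ℝ → ℝ≥0∞, Measurable f →
      ∫⁻ ω, nexp (∑' j, f (z j ω)) ∂P = nexp (∫⁻ t, (1 - nexp (f t)) ∂Λ))
    {n : ℕ} {B : Fin n → Set ℝ} (hB : ∀ i, MeasurableSet (B i))
    (hd : Pairwise fun i j => Disjoint (B i) (B j)) (s : Fin n → ℕ) :
    ∫⁻ ω, nexp (∑ i, s i * count z (B i) ω) ∂P = ∏ i, nexp ((1 - nexp (s i)) * Λ (B i)) := by
  let f : ℝ → ℝ≥0∞ := fun t => ∑ i, s i * (B i).indicator (fun _ => 1) t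
  have hf : Measurable f := Finset.measurable_fun_sum _ fun i _ =>
    (measurable_const.indicator (hB i)).const_mul _
  have h1 : ∀ ω, ∑ i, s i * count z (B i) ω = ∑' j, f (z j ω) := fun ω => by
    simp only [f, count]
    rw [Summable.tsum_finsetSum fun _ _ => ENNReal.summable]
    simp_rw [ENNReal.tsum_mul_left]
  have h2 : ∀ t, 1 - nexp (f t) = ∑ i, (B i).indicator (fun _ => 1 - nexp (s i)) t := fun t => by
    by_cases ht : ∃ i, t ∈ B i
    · obtain ⟨i, hi⟩ := ht
      have hne : ∀ j, j ≠ i → t ∉ B j := fun j hj hj' =>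
        Set.disjoint_left.1 (hd hj) hj' hi
      simp only [f]
      rw [Finset.sum_eq_single i (fun j _ hj => by simp [hne j hj]) (by simp),
        Finset.sum_eq_single i (fun j _ hj => by simp [hne j hj]) (by simp)]
      simp [hi]
    · push Not at ht
      simp [f, ht]
  simp_rw [h1]
  rw [hL f hf]
  simp_rw [h2]
  rw [lintegral_finsetSum _ fun i _ => measurable_const.indicator (hB i), nexp_sum]
  refine Finset.prod_congr rfl fun i _ => ?_
  rw [lintegral_indicator_const (hB i)]

/-- A sequence of random points with the Laplace functional of a Poisson process is a Poisson
process. -/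
theorem isPoissonProcess_of_laplace [IsProbabilityMeasure P] (hz : ∀ j, Measurable (z j))
    (hL : ∀ f : ℝ → ℝ≥0∞, Measurable f →
      ∫⁻ ω, nexp (∑' j, f (z j ω)) ∂P = nexp (∫⁻ t, (1 - nexp (f t)) ∂Λ)) :
    IsPoissonProcess P z Λ := by
  have hcm : ∀ B, MeasurableSet B → Measurable (count z B) := fun B hB => count_measurable hz hB
  have hone : ∀ B, MeasurableSet B → ∀ s : ℕ,
      ∫⁻ ω, nexp (s * count z B ω) ∂P = nexp ((1 - nexp s) * Λ B) := fun B hB s => by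
    simpa using lintegral_nexp_sum_count hL (n := 1) (B := fun _ => B) (fun _ => hB)
      (fun i j hij => absurd (Subsingleton.elim i j) hij) fun _ => s
  have hms : ∀ {n : ℕ} (s : Fin n → ℕ),
      Measurable fun y : Fin n → ℝ≥0∞ => nexp (∑ i, s i * y i) := fun s =>
    nexp_measurable.comp (by fun_prop)
  refine ⟨hz, fun B hB hΛ => ?_, fun n B hB hd => ?_⟩
  · have hpm : IsProbabilityMeasure (P.map (count z B)) :=
      Measure.isProbabilityMeasure_map (hcm B hB).aemeasurable
    have hpp : IsProbabilityMeasure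
        ((poissonMeasure (Λ B).toNNReal).map (fun n : ℕ => (n : ℝ≥0∞))) :=
      Measure.isProbabilityMeasure_map measurable_from_top.aemeasurable
    let c : ℝ≥0∞ → Fin 1 → ℝ≥0∞ := fun y _ => y
    have hc : Measurable c := measurable_pi_lambda _ fun _ => measurable_id
    have hpm' := Measure.isProbabilityMeasure_map (μ := P.map (count z B)) hc.aemeasurable
    have hpp' := Measure.isProbabilityMeasure_map (μ := (poissonMeasure (Λ B).toNNReal).map
      (fun n : ℕ => (n : ℝ≥0∞))) hc.aemeasurable
    have h1 : (P.map (count z B)).map c =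
        ((poissonMeasure (Λ B).toNNReal).map (fun n : ℕ => (n : ℝ≥0∞))).map c := by
      refine ext_of_laplace fun s => ?_
      have hm1 : Measurable fun y : ℝ≥0∞ => nexp (s 0 * y) :=
        nexp_measurable.comp (measurable_const_mul _)
      rw [lintegral_map (hms s) hc, lintegral_map (hms s) hc]
      simp only [c, Finset.univ_unique, Fin.default_eq_zero, Finset.sum_singleton]
      rw [lintegral_map hm1 (hcm B hB), lintegral_map hm1 measurable_from_top, hone B hB]
      simp_rw [mul_comm ((s 0 : ℕ) : ℝ≥0∞), nexp_nat_mul]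
      rw [lintegral_pow_poissonMeasure _ (nexp_le_one _), ENNReal.coe_toNNReal hΛ, mul_comm]
    have h2 := congrArg (Measure.map fun y : Fin 1 → ℝ≥0∞ => y 0) h1
    rw [Measure.map_map (measurable_pi_apply 0) hc, Measure.map_map (measurable_pi_apply 0) hc]
      at h2
    simpa [Function.comp_def, c] using h2
  · rw [iIndepFun_iff_map_fun_eq_pi_map fun i => (hcm _ (hB i)).aemeasurable]
    have hcm' : ∀ i, Measurable (count z (B i)) := fun i => hcm _ (hB i)
    have hp : ∀ i, IsProbabilityMeasure (P.map (count z (B i))) := fun i =>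
      Measure.isProbabilityMeasure_map (hcm' i).aemeasurable
    have hpm := Measure.isProbabilityMeasure_map (μ := P)
      (measurable_pi_lambda (fun ω i => count z (B i) ω) hcm').aemeasurable
    -- Sets of infinite intensity are included: their counts may be `∞`, which the Laplace transform
    -- on `[0,∞]^n` accommodates.
    refine ext_of_laplace fun s => ?_
    rw [lintegral_map (hms s) (measurable_pi_lambda _ hcm'),
      lintegral_nexp_sum_count hL hB hd]
    simp_rw [nexp_sum]
    have hm1 : ∀ i, Measurable fun y : ℝ≥0∞ => nexp (s i * y) := fun i =>
      nexp_measurable.comp (measurable_const_mul _)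
    have hi : iIndepFun (fun i (y : Fin n → ℝ≥0∞) => nexp (s i * y i))
        (Measure.infinitePi fun i => P.map (count z (B i))) := iIndepFun_infinitePi hm1
    rw [← Measure.infinitePi_eq_pi, lintegral_prod_eq_prod_lintegral_of_indepFun _ _ hi
      fun i => (hm1 i).comp (measurable_pi_apply i)]
    refine Finset.prod_congr rfl fun i _ => ?_
    rw [← hone _ (hB i), ← lintegral_map (hm1 i) (hcm' i),
      ← Measure.infinitePi_map_eval (fun i => P.map (count z (B i))) i,
      lintegral_map (hm1 i) (measurable_pi_apply i)]

end Characterization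

end RPC
end

noncomputable section

namespace RPC

/-! ### Construction of Poisson processes -/

/-- A sequence of integers and a double sequence of points: `(ω n).1` is the number of points that
are drawn from the `n`-th part of the intensity measure, and `(ω n).2 i` are the points. -/
abbrev PointSpace : Type := ℕ → ℕ × (ℕ → ℝ)

/-- The law of a Poisson number and of independent points with law proportional to `μ`. -/
def partLaw (μ : FiniteMeasure ℝ) : Measure (ℕ × (ℕ → ℝ)) :=
  (poissonMeasure μ.mass).prod (Measure.infinitePi fun _ : ℕ => (μ.normalize : Measure ℝ))

instance (μ : FiniteMeasure ℝ) : IsProbabilityMeasure (partLaw μ) := by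
  unfold partLaw
  infer_instance

/-- The finite parts of an s-finite measure. -/
def sfinitePart (Λ : Measure ℝ) [SFinite Λ] (n : ℕ) : FiniteMeasure ℝ :=
  ⟨sfiniteSeq Λ n, inferInstance⟩

/-- The law of the numbers of points and of the points. -/
def pointLaw (Λ : Measure ℝ) [SFinite Λ] : Measure PointSpace :=
  Measure.infinitePi fun n => partLaw (sfinitePart Λ n)

instance (Λ : Measure ℝ) [SFinite Λ] : IsProbabilityMeasure (pointLaw Λ) := by
  unfold pointLaw
  infer_instance

theorem measurable_sum_range {f : ℝ → ℝ≥0∞} (hf : Measurable f) :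
    Measurable fun p : ℕ × (ℕ → ℝ) => ∑ i ∈ Finset.range p.1, f (p.2 i) :=
  measurable_from_prod_countable_right fun N => by
    simp only
    fun_prop

/-- Given the number of points, the mean is a power of `∫ nexp (f t)` under the normalised measure.
The Poisson generating function then restores the factor of total mass. -/
theorem laplace_partLaw (μ : FiniteMeasure ℝ) {f : ℝ → ℝ≥0∞} (hf : Measurable f) :
    ∫⁻ p : ℕ × (ℕ → ℝ), nexp (∑ i ∈ Finset.range p.1, f (p.2 i)) ∂(partLaw μ) =
      nexp (∫⁻ t, (1 - nexp (f t)) ∂(μ : Measure ℝ)) := by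
  have hm : Measurable fun t => nexp (f t) := nexp_measurable.comp hf
  rw [partLaw, lintegral_prod _ (by
    exact (nexp_measurable.comp (measurable_sum_range hf)).aemeasurable)]
  have h1 : ∀ N : ℕ, ∫⁻ x : ℕ → ℝ, nexp (∑ i ∈ Finset.range N, f (x i))
      ∂(Measure.infinitePi fun _ : ℕ => (μ.normalize : Measure ℝ)) =
      (∫⁻ t, nexp (f t) ∂(μ.normalize : Measure ℝ)) ^ N := fun N => by
    simp_rw [nexp_sum]
    have hi : iIndepFun (fun i (x : ℕ → ℝ) => nexp (f (x i)))
        (Measure.infinitePi fun _ : ℕ => (μ.normalize : Measure ℝ)) :=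
      iIndepFun_infinitePi fun _ => hm
    rw [lintegral_prod_eq_prod_lintegral_of_indepFun _ _ hi
      fun i => hm.comp (measurable_pi_apply i)]
    refine (Finset.prod_congr rfl fun i _ => ?_).trans (by rw [Finset.prod_const, Finset.card_range])
    rw [← Measure.infinitePi_map_eval (fun _ : ℕ => (μ.normalize : Measure ℝ)) i,
      lintegral_map hm (measurable_pi_apply i), Measure.infinitePi_map_eval]
  have h2 : ∫⁻ t, nexp (f t) ∂(μ.normalize : Measure ℝ) ≤ 1 :=
    (lintegral_mono fun t => nexp_le_one _).trans (by simp)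
  have h3 : (μ : Measure ℝ) = μ.mass • (μ.normalize : Measure ℝ) := by
    conv_lhs => rw [μ.self_eq_mass_smul_normalize]
    rfl
  simp_rw [h1]
  rw [lintegral_pow_poissonMeasure _ h2]
  conv_rhs => rw [h3]
  rw [lintegral_smul_measure, lintegral_sub hm (ne_top_of_le_ne_top ENNReal.one_ne_top h2)
    (ae_of_all _ fun t => nexp_le_one _), lintegral_one, measure_univ]
  rfl

/-- The finite pieces are independent, so their Laplace functionals multiply and the exponents add
up to the integral over `Λ`. -/
theorem laplace_pointLaw (Λ : Measure ℝ) [SFinite Λ] {f : ℝ → ℝ≥0∞} (hf : Measurable f) :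
    ∫⁻ ω, nexp (∑' n, ∑ i ∈ Finset.range (ω n).1, f ((ω n).2 i)) ∂(pointLaw Λ) =
      nexp (∫⁻ t, (1 - nexp (f t)) ∂Λ) := by
  simp_rw [nexp_tsum]
  rw [pointLaw, lintegral_infProd_infinitePi (X := fun _ => ℕ × (ℕ → ℝ)) _
    (a := fun _ p => nexp (∑ i ∈ Finset.range p.1, f (p.2 i)))
    (fun _ => nexp_measurable.comp (measurable_sum_range hf)) (fun _ _ => nexp_le_one _)]
  conv_rhs => rw [← sum_sfiniteSeq Λ]
  rw [lintegral_sum_measure, nexp_tsum]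
  congr 1
  ext n
  exact laplace_partLaw (sfinitePart Λ n) hf

/-- The pairs `(n, i)`, encoded as integers, that belong to a point of the configuration. -/
def IsPoint (ω : PointSpace) (c : ℕ) : Prop := c.unpair.2 < (ω c.unpair.1).1

/-- The point with the given code. -/
def codedPoint (ω : PointSpace) (c : ℕ) : ℝ := (ω c.unpair.1).2 c.unpair.2

open Classical in
theorem tsum_isPoint (ω : PointSpace) (f : ℝ → ℝ≥0∞) :
    ∑' c, (if IsPoint ω c then f (codedPoint ω c) else 0) =
      ∑' n, ∑ i ∈ Finset.range (ω n).1, f ((ω n).2 i) := by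
  rw [← Nat.pairEquiv.tsum_eq, ENNReal.tsum_prod']
  refine tsum_congr fun n => ?_
  have h : ∀ i, Nat.pairEquiv (n, i) = Nat.pair n i := fun _ => rfl
  simp only [h, IsPoint, codedPoint, Nat.unpair_pair]
  rw [tsum_eq_sum (s := Finset.range (ω n).1) fun i hi => if_neg (by simpa using hi)]
  exact Finset.sum_congr rfl fun i hi => if_pos (Finset.mem_range.1 hi)

/-- The configurations with infinitely many points. -/
def infiniteConfigurations : Set PointSpace :=
  {ω | ∑' n, ∑ _i ∈ Finset.range (ω n).1, (1 : ℝ≥0∞) = ∞}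

theorem measurableSet_infiniteConfigurations : MeasurableSet infiniteConfigurations := by
  have h : Measurable fun ω : PointSpace => ∑' n, ∑ _i ∈ Finset.range (ω n).1, (1 : ℝ≥0∞) :=
    Measurable.tsum fun n => (measurable_sum_range (f := fun _ => 1) measurable_const).comp
      (measurable_pi_apply n)
  exact h (measurableSet_singleton ∞)

/-- For `f = 1` the Laplace functional vanishes when the intensity is infinite, which forces
infinitely many points almost surely. -/
theorem ae_infiniteConfigurations {Λ : Measure ℝ} [SFinite Λ] (hΛ : Λ Set.univ = ∞) :
    ∀ᵐ ω ∂(pointLaw Λ), ω ∈ infiniteConfigurations := by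
  have h := laplace_pointLaw Λ (f := fun _ => 1) measurable_const
  have h1 : (1 : ℝ≥0∞) - nexp 1 ≠ 0 := by
    rw [Ne, tsub_eq_zero_iff_le, not_le]
    refine lt_of_le_of_ne (nexp_le_one 1) fun h => ?_
    exact one_ne_zero (nexp_injective (h.trans nexp_zero.symm))
  rw [lintegral_const, hΛ, ENNReal.mul_top h1, nexp_top, lintegral_eq_zero_iff] at h
  · filter_upwards [h] with ω hω
    exact nexp_injective (hω.trans nexp_top.symm)
  · exact nexp_measurable.comp (Measurable.tsum fun n =>
      (measurable_sum_range (f := fun _ => 1) measurable_const).comp (measurable_pi_apply n))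

/-- The codes that are enumerated: those of the points of the configuration, or all if there are only
finitely many points. -/
def IsEnumerated (ω : PointSpace) (c : ℕ) : Prop := IsPoint ω c ∨ ω ∉ infiniteConfigurations

/-- `Nat.nth` enumerates without default values only on infinite sets. Declaring all codes
enumerated in the exceptional case keeps the enumeration defined and measurable everywhere. -/
theorem infinite_isEnumerated (ω : PointSpace) : (Set.ofPred (IsEnumerated ω)).Infinite := by
  classical
  intro hfin
  by_cases hω : ω ∈ infiniteConfigurations
  · have h1 := tsum_isPoint ω fun _ => 1
    rw [show _ = ∞ from hω, tsum_eq_sum (s := hfin.toFinset)] at h1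
    · exact (ENNReal.sum_ne_top.2 fun c _ => by split_ifs <;> simp) h1
    · intro c hc
      rw [if_neg]
      exact fun h => hc (hfin.mem_toFinset.2 (Or.inl h))
  · exact Set.infinite_univ (hfin.subset fun c _ => Or.inr hω)

theorem measurableSet_isEnumerated (c : ℕ) : MeasurableSet {ω | IsEnumerated ω c} := by
  refine MeasurableSet.union ?_ measurableSet_infiniteConfigurations.compl
  exact measurableSet_lt measurable_const (measurable_fst.comp (measurable_pi_apply (X := fun _ => ℕ × (ℕ → ℝ)) _))

/-- The points of the configuration, enumerated. -/
def enumeratedPoint (j : ℕ) (ω : PointSpace) : ℝ := codedPoint ω (Nat.nth (IsEnumerated ω) j)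

theorem measurable_nth_isEnumerated (j : ℕ) :
    Measurable fun ω : PointSpace => Nat.nth (IsEnumerated ω) j := by
  classical
  have hc : ∀ c, Measurable fun ω : PointSpace => Nat.count (IsEnumerated ω) c := fun c => by
    induction c with
    | zero => simp
    | succ c ih =>
      simp_rw [Nat.count_succ]
      exact ih.add (Measurable.ite (measurableSet_isEnumerated c) measurable_const measurable_const)
  refine measurable_to_countable' fun c => ?_
  -- Code `c` is enumerated at place `j` exactly if it is enumerated and `j` enumerated codes
  -- precede it; both conditions are measurable.
  have h : (fun ω : PointSpace => Nat.nth (IsEnumerated ω) j) ⁻¹' {c} =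
      {ω | IsEnumerated ω c} ∩ {ω | Nat.count (IsEnumerated ω) c = j} := by
    ext ω
    constructor
    · rintro rfl
      exact ⟨Nat.nth_mem_of_infinite (infinite_isEnumerated ω) j,
        Nat.count_nth_of_infinite (infinite_isEnumerated ω) j⟩
    · rintro ⟨h1, rfl⟩
      exact Nat.nth_count h1
  rw [h]
  exact (measurableSet_isEnumerated c).inter (hc c (measurableSet_singleton j))

theorem enumeratedPoint_measurable (j : ℕ) : Measurable (enumeratedPoint j) := by
  have h : Measurable fun q : PointSpace × ℕ => codedPoint q.1 q.2 :=
    measurable_from_prod_countable_left fun c => by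
      exact (measurable_pi_apply (X := fun _ => ℝ) c.unpair.2).comp (measurable_snd.comp
        (measurable_pi_apply (X := fun _ => ℕ × (ℕ → ℝ)) c.unpair.1))
  exact h.comp (measurable_id.prodMk (measurable_nth_isEnumerated j))

theorem tsum_enumeratedPoint {ω : PointSpace} (hω : ω ∈ infiniteConfigurations) (f : ℝ → ℝ≥0∞) :
    ∑' j, f (enumeratedPoint j ω) = ∑' n, ∑ i ∈ Finset.range (ω n).1, f ((ω n).2 i) := by
  classical
  have hp : ∀ c, IsEnumerated ω c ↔ IsPoint ω c := fun c => or_iff_left (not_not.2 hω)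
  rw [← tsum_isPoint, ← (Nat.nth_injective (infinite_isEnumerated ω)).tsum_eq
    (f := fun c => if IsPoint ω c then f (codedPoint ω c) else 0)]
  · refine tsum_congr fun j => ?_
    rw [if_pos ((hp _).1 (Nat.nth_mem_of_infinite (infinite_isEnumerated ω) j))]
    rfl
  · rw [Nat.range_nth_of_infinite (infinite_isEnumerated ω)]
    intro c hc
    by_contra h
    exact hc (if_neg fun h' => h ((hp c).2 h'))

/-- The law of the points of a Poisson process with intensity `Λ`. -/
def poissonProcessLaw (Λ : Measure ℝ) [SFinite Λ] : Measure (ℕ → ℝ) :=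
  (pointLaw Λ).map fun ω j => enumeratedPoint j ω

instance (Λ : Measure ℝ) [SFinite Λ] : IsProbabilityMeasure (poissonProcessLaw Λ) :=
  Measure.isProbabilityMeasure_map (measurable_pi_lambda _ enumeratedPoint_measurable).aemeasurable

theorem laplace_poissonProcessLaw {Λ : Measure ℝ} [SFinite Λ] (hΛ : Λ Set.univ = ∞)
    {f : ℝ → ℝ≥0∞} (hf : Measurable f) :
    ∫⁻ w, nexp (∑' j, f (w j)) ∂(poissonProcessLaw Λ) = nexp (∫⁻ t, (1 - nexp (f t)) ∂Λ) := by
  rw [poissonProcessLaw, lintegral_map (by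
      exact nexp_measurable.comp (Measurable.tsum fun j => hf.comp (measurable_pi_apply j)))
    (measurable_pi_lambda _ enumeratedPoint_measurable), ← laplace_pointLaw Λ hf]
  refine lintegral_congr_ae ?_
  filter_upwards [ae_infiniteConfigurations hΛ] with ω hω
  rw [tsum_enumeratedPoint hω]

end RPC
end

noncomputable section

namespace RPC

/-! ### Existence of GREMs -/

section MeasurePreserving

variable {Ω Ω' : Type} [MeasurableSpace Ω] [MeasurableSpace Ω'] {P : Measure Ω} {Q : Measure Ω'}
  {T : Ω → Ω'}

theorem IsCentredGaussianField.comp_measurePreserving {A : Type} {X : A → Ω' → ℝ} {c : A → A → ℝ}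
    (hX : IsCentredGaussianField Q X c) (hT : MeasurePreserving T P Q) :
    IsCentredGaussianField P (fun α ω => X α (T ω)) c where
  measurable α := (hX.measurable α).comp hT.measurable
  gaussian := ⟨fun I => ⟨by
    have h := (hX.gaussian.hasGaussianLaw I).isGaussian_map
    rw [← hT.map_eq, Measure.map_map (by
      exact measurable_pi_lambda _ fun i => hX.measurable i) hT.measurable] at h
    exact h⟩⟩
  centred α := by
    rw [← hX.centred α, ← hT.map_eq, integral_map hT.aemeasurable
      (hX.measurable α).aestronglyMeasurable]
  cov α α' := by
    rw [← hX.cov, ← hT.map_eq, covariance_map_fun (hX.measurable α).aestronglyMeasurable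
      (hX.measurable α').aestronglyMeasurable hT.aemeasurable]

theorem iIndepFun_of_measurePreserving {ι : Type} {E : ι → Type} [∀ i, MeasurableSpace (E i)]
    (ρ : ∀ i, Measure (E i)) [∀ i, IsProbabilityMeasure (ρ i)] [IsProbabilityMeasure P]
    {X : ∀ i, Ω → E i}
    (hX : MeasurePreserving (fun ω i => X i ω) P (Measure.infinitePi ρ)) : iIndepFun X P := by
  have hm : ∀ i, Measurable (X i) := fun i => (measurable_pi_apply i).comp hX.measurable
  have h : ∀ i, P.map (X i) = ρ i := fun i => by
    rw [← Measure.infinitePi_map_eval ρ i, ← hX.map_eq, Measure.map_map (measurable_pi_apply i)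
      hX.measurable]
    rfl
  rw [iIndepFun_iff_map_fun_eq_infinitePi_map hm, hX.map_eq]
  simp_rw [h]

theorem indepFun_fst_snd {E F : Type} [MeasurableSpace E] [MeasurableSpace F] {μ : Measure E}
    {ν : Measure F} [IsProbabilityMeasure μ] [IsProbabilityMeasure ν] [IsProbabilityMeasure P]
    {X : Ω → E × F} (hX : MeasurePreserving X P (μ.prod ν)) :
    IndepFun (fun ω => (X ω).1) (fun ω => (X ω).2) P := by
  have h1 := (measurePreserving_fst (μ := μ) (ν := ν)).comp hX
  have h2 := (measurePreserving_snd (μ := μ) (ν := ν)).comp hX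
  refine (indepFun_iff_map_prod_eq_prod_map_map h1.aemeasurable h2.aemeasurable).2 ?_
  exact hX.map_eq.trans (by rw [h1.map_eq, h2.map_eq])

end MeasurePreserving

/-- The sample space of a GREM of depth `k`: the points at the inner nodes and the Gaussian marks at
the vertices. -/
abbrev GREMSpace (k : ℕ) : Type :=
  (Node k → ℕ → ℝ) × (ℕ → List ℕ → ℝ) × (ℕ → List ℕ → ℝ)

/-- The law of the points and of the marks of a GREM. -/
def gremLaw (m : AtomicMeasure) : Measure (GREMSpace m.k) :=
  (Measure.infinitePi fun n : Node m.k => poissonProcessLaw (remIntensity (m.x n.1.castSucc))).prod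
    ((Measure.infinitePi fun _ : ℕ => gaussianMarks m.increment).prod
      (Measure.infinitePi fun _ : ℕ => gaussianMarks m.sqIncrement))

instance (m : AtomicMeasure) : IsProbabilityMeasure (gremLaw m) := by
  unfold gremLaw
  infer_instance

theorem pathSum_measurable (k : ℕ) :
    Measurable fun (w : List ℕ → ℝ) (α : Fin k → ℕ) => pathSum w α := by
  unfold pathSum
  fun_prop

/-- The fields are path sums of independent Gaussian marks, and all independence requirements hold
because points and marks live on separate factors of a product space. -/
theorem nonempty_GREM (m : AtomicMeasureOne) : Nonempty (GREM m) := by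
  have h0 : MeasurePreserving id (gremLaw m.1) (gremLaw m.1) := MeasurePreserving.id _
  have hfst : MeasurePreserving (fun ω : GREMSpace m.1.k => ω.1) (gremLaw m.1) _ :=
    measurePreserving_fst
  have hsnd : MeasurePreserving (fun ω : GREMSpace m.1.k => ω.2) (gremLaw m.1) _ :=
    measurePreserving_snd
  have hη : MeasurePreserving (fun ω : GREMSpace m.1.k => ω.2.1) (gremLaw m.1) _ :=
    measurePreserving_fst.comp hsnd
  have hκ : MeasurePreserving (fun ω : GREMSpace m.1.k => ω.2.2) (gremLaw m.1) _ :=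
    measurePreserving_snd.comp hsnd
  have hp := pathSum_measurable m.1.k
  have hps : Measurable fun (w : ℕ → List ℕ → ℝ) i (α : Fin m.1.k → ℕ) => pathSum (w i) α :=
    measurable_pi_lambda _ fun i => hp.comp (measurable_pi_apply i)
  refine ⟨{
    Ω := GREMSpace m.1.k
    P := gremLaw m.1
    ζ := fun n j ω => ω.1 n j
    η := fun i α ω => pathSum (ω.2.1 i) α
    κ := fun i α ω => pathSum (ω.2.2 i) α
    rem := fun n => ?_
    field_η := fun i => (isCentredGaussianField_pathSum m.1 (g := fun q => q)
      m.1.sum_increment).comp_measurePreserving ((measurePreserving_eval_infinitePi _ i).comp hη)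
    field_κ := fun i => (isCentredGaussianField_pathSum m.1 (g := fun q => q ^ 2 / 2)
      m.1.sum_sqIncrement).comp_measurePreserving ((measurePreserving_eval_infinitePi _ i).comp hκ)
    indep_ζ := iIndepFun_of_measurePreserving _ hfst
    indep_η := (iIndepFun_of_measurePreserving _ hη).comp (fun _ w α => pathSum w α) fun _ => hp
    indep_κ := (iIndepFun_of_measurePreserving _ hκ).comp (fun _ w α => pathSum w α) fun _ => hp
    indep_η_κ := (indepFun_fst_snd hsnd).comp hps hps
    indep_ζ_fields := (indepFun_fst_snd h0).comp measurable_id (hps.prodMap hps) }⟩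
  refine isPoissonProcess_of_laplace (fun j => by fun_prop) fun f hf => ?_
  have hn := (measurePreserving_eval_infinitePi _ n).comp hfst
  have hm : Measurable fun w : ℕ → ℝ => nexp (∑' j, f (w j)) :=
    nexp_measurable.comp (Measurable.tsum fun j => hf.comp (measurable_pi_apply j))
  -- The infinite total mass of the REM intensity justifies listing its points as an infinite
  -- sequence.
  rw [← laplace_poissonProcessLaw (remIntensity_univ (m.1.x_pos _)) hf]
  exact hn.lintegral_comp hm

end RPC
end

/-! ### The variational principle -/

theorem mainTheorem7 (β h : ℝ) :
    (∀ m : RPC.AtomicMeasureOne, Nonempty (RPC.GREM m)) ∧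
    (∀ (m : RPC.AtomicMeasureOne) (μ : RPC.GREM m),
      (∀ M : ℕ, 1 ≤ M → RPC.AsWellDefined M β h μ ∧
        RPC.asFunctional M β h μ = RPC.asFunctional 1 β h μ) ∧
      RPC.RpcWellDefined (fun y => Real.log (2 * Real.cosh (β * y + h))) μ (μ.η 0) ∧
      RPC.RpcWellDefined (fun y => β * y) μ (μ.κ 0) ∧
      RPC.asFunctional 1 β h μ =
        RPC.rpcFunctional (fun y => Real.log (2 * Real.cosh (β * y + h))) μ (μ.η 0)
          - RPC.rpcFunctional (fun y => β * y) μ (μ.κ 0)) ∧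
    (∃ G : RPC.AtomicMeasure → ℝ,
      RPC.L1Continuous G ∧
      (∀ (m : RPC.AtomicMeasureOne) (μ : RPC.GREM m), G m.1 = RPC.asFunctional 1 β h μ) ∧
      BddBelow (Set.range G) ∧
      (∀ M : ℕ, 1 ≤ M → BddBelow (RPC.asValues M β h)) ∧
      Tendsto (fun M : ℕ => sInf (RPC.asValues M β h)) atTop (𝓝 (⨅ m : RPC.AtomicMeasure, G m)) ∧
      (⨅ m : RPC.AtomicMeasureOne, G m.1) = (⨅ m : RPC.AtomicMeasure, G m)) := by
  have hex : ∀ m : RPC.AtomicMeasureOne, Nonempty (RPC.GREM m) := RPC.nonempty_GREM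
  have hb := RPC.bddBelow_range_limitFunctional β h
  have hc := RPC.limitFunctional_continuous β h
  have hinf := hc.iInf_one_eq hb
  refine ⟨hex, fun m μ => ?_, RPC.limitFunctional β h, hc,
    fun m μ => (μ.asFunctional_eq β h le_rfl).2.symm, hb, fun M hM => ?_, ?_, hinf⟩
  · have h1 := μ.rpcFunctional_eta (RPC.logCosh_lipschitz β h)
    have h2 := μ.rpcFunctional_kappa β
    refine ⟨fun M hM => ⟨(μ.asFunctional_eq β h hM).1, (μ.asFunctional_eq β h hM).2.trans
      (μ.asFunctional_eq β h le_rfl).2.symm⟩, h1.1, h2.1, ?_⟩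
    rw [(μ.asFunctional_eq β h le_rfl).2, h2.2]
    exact congrArg (· - _) h1.2.symm
  · rw [RPC.asValues_eq_range hex β h hM]
    exact hb.mono (by rintro _ ⟨m, rfl⟩; exact ⟨m.1, rfl⟩)
  -- For `M ≥ 1` the infimum does not depend on `M`; only `M = 0`, with the default prefactor `1 / 0
  -- = 0`, is excluded.
  · refine tendsto_const_nhds.congr' ?_
    filter_upwards [eventually_ge_atTop 1] with M hM
    rw [RPC.asValues_eq_range hex β h hM, ← hinf]
    rfl
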